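/- Let $N\ge 2$. A set $S\subset\mathbb{C}^N$ is a $C^\infty$ hypersurface if it is an embedded $C^\infty$ submanifold of real codimension $1$ (not necessarily closed in $\mathbb C^N$). It is Levi-flat if the bundle $T^cS$, with fibres $T^c_pS=J(T_pS)\cap T_pS$ where $J$ is the complex structure of $\mathbb{C}^N$, is involutive. A set $H\subset\mathbb{C}^N$ is a $C^\infty$ hypersurface with boundary $\partial H\subset H$ if $H\setminus\partial H$ is a $C^\infty$ hypersurface and every $p\in\partial H$ has an open neighbourhood $U\subset\mathbb{C}^N$ with a $C^\infty$ diffeomorphism $\varphi\colon U\to\mathbb{R}^{2N}$ such that $\varphi(H\cap U)=\{x: x_{2N-1}\ge 0,\ x_{2N}=0\}$ and $\varphi(\partial H\cap U)=\{x: x_{2N-1}=0,\ x_{2N}=0\}$; it is called Levi-flat if $H\setminus\partial H$ is Levi-flat. Regard $\mathbb{C}^{N-2}\times\mathbb{R}^2$ as the set of points of $\mathbb{C}^N$ whose last two coordinates are real. Theorem. Suppose $H\subset\mathbb{C}^N$ is a $C^\infty$ Levi-flat hypersurface with boundary, and $0\in\partial H\subset\mathbb{C}^{N-2}\times\mathbb{R}^2$.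 Then for some neighbourhood $U$ of the origin there exists a $C^\infty$ Levi-flat hypersurface $\mathcal{H}\subset\mathbb{C}^N$ (without boundary) such that $H\cap U\subset\mathcal{H}$. Further, the germ $(\mathcal{H},0)$ is unique: if $\mathcal{H}'\subset\mathbb C^N$ is a $C^\infty$ Levi-flat hypersurface such that $H\cap V\subset\mathcal{H}'$ for some neighbourhood $V$ of $0$, then $\mathcal{H}'\cap W=\mathcal{H}\cap W$ for some neighbourhood $W$ of $0$. -/

import Mathlib

open scoped ContDiff Topology

/-- `φ` is a `C^∞` diffeomorphism from an open subset of `ℂ^N` onto an open subset of `ℝ^{2N}`. -/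
def IsSmoothChart {N : ℕ} (φ : OpenPartialHomeomorph (Fin N → ℂ) (Fin (2 * N) → ℝ)) : Prop :=
  ContDiffOn ℝ ∞ φ φ.source ∧ ContDiffOn ℝ ∞ φ.symm φ.target

/-- `{x ∈ ℝ^{2N} | x_{2N} = 0}` (coordinates are indexed from `0` in `Fin (2 * N)`). -/
def modelHyperplane (N : ℕ) : Set (Fin (2 * N) → ℝ) :=
  {x | ∀ i : Fin (2 * N), (i : ℕ) + 1 = 2 * N → x i = 0}

/-- `{x ∈ ℝ^{2N} | x_{2N-1} ≥ 0, x_{2N} = 0}`. -/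
def modelHalf (N : ℕ) : Set (Fin (2 * N) → ℝ) :=
  {x | (∀ i : Fin (2 * N), (i : ℕ) + 2 = 2 * N → 0 ≤ x i) ∧
    ∀ i : Fin (2 * N), (i : ℕ) + 1 = 2 * N → x i = 0}

/-- `{x ∈ ℝ^{2N} | x_{2N-1} = 0, x_{2N} = 0}`. -/
def modelEdge (N : ℕ) : Set (Fin (2 * N) → ℝ) :=
  {x | (∀ i : Fin (2 * N), (i : ℕ) + 2 = 2 * N → x i = 0) ∧
    ∀ i : Fin (2 * N), (i : ℕ) + 1 = 2 * N → x i = 0}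

/-- `S` is a `C^∞` hypersurface of `ℂ^N` (without boundary): an embedded `C^∞` submanifold of
real codimension one. It need not be closed in `ℂ^N`. -/
def IsSmoothHypersurface {N : ℕ} (S : Set (Fin N → ℂ)) : Prop :=
  ∀ p ∈ S, ∃ φ : OpenPartialHomeomorph (Fin N → ℂ) (Fin (2 * N) → ℝ),
    p ∈ φ.source ∧ IsSmoothChart φ ∧ φ '' (S ∩ φ.source) = φ.target ∩ modelHyperplane N

/-- `H` is a `C^∞` hypersurface with boundary in `ℂ^N`, whose boundary is `bH`. -/
structure IsSmoothHypersurfaceWithBoundary {N : ℕ} (H bH : Set (Fin N → ℂ)) : Prop where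
  boundary_subset : bH ⊆ H
  interior_hypersurface : IsSmoothHypersurface (H \ bH)
  boundary_chart : ∀ p ∈ bH, ∃ φ : OpenPartialHomeomorph (Fin N → ℂ) (Fin (2 * N) → ℝ),
    p ∈ φ.source ∧ IsSmoothChart φ ∧ φ.target = Set.univ ∧
      φ '' (H ∩ φ.source) = modelHalf N ∧ φ '' (bH ∩ φ.source) = modelEdge N

/-- The real tangent space `T_p S`: velocities at `p` of curves in `S`. -/
def realTangent {N : ℕ} (S : Set (Fin N → ℂ)) (p : Fin N → ℂ) : Set (Fin N → ℂ) :=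
  {v | ∃ γ : ℝ → Fin N → ℂ, γ 0 = p ∧ HasDerivAt γ v 0 ∧ ∀ᶠ t in 𝓝 (0 : ℝ), γ t ∈ S}

/-- The complex tangent space `T^c_p S = J (T_p S) ∩ T_p S`, `J` being multiplication by `i`. -/
def complexTangent {N : ℕ} (S : Set (Fin N → ℂ)) (p : Fin N → ℂ) : Set (Fin N → ℂ) :=
  ((fun v : Fin N → ℂ => Complex.I • v) '' realTangent S p) ∩ realTangent S p

/-- Levi-flatness of a hypersurface `S`: the bundle `T^c S` is involutive, that is, the Lie bracket
of two local `C^∞` sections of `T^c S` is a section of `T^c S`. Local sections are given by `C^∞`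
vector fields on open subsets of `ℂ^N` whose values along `S` lie in `T^c S`; along `S` the bracket
depends only on the restrictions of the fields to `S`. -/
def IsLeviFlat {N : ℕ} (S : Set (Fin N → ℂ)) : Prop :=
  ∀ (U : Set (Fin N → ℂ)) (X Y : (Fin N → ℂ) → (Fin N → ℂ)), IsOpen U →
    ContDiffOn ℝ ∞ X U → ContDiffOn ℝ ∞ Y U →
    (∀ p ∈ S ∩ U, X p ∈ complexTangent S p) → (∀ p ∈ S ∩ U, Y p ∈ complexTangent S p) →
    ∀ p ∈ S ∩ U, VectorField.lieBracket ℝ X Y p ∈ complexTangent S p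

/-- `ℂ^{N-2} × ℝ²` inside `ℂ^N`: the last two coordinates are real. -/
def flatModel (N : ℕ) : Set (Fin N → ℂ) :=
  {p | ∀ i : Fin N, N ≤ (i : ℕ) + 2 → (p i).im = 0}

/-! The boundary lies in ℂ^{N-2} × ℝ² and has the same dimension, so it is open there near 0. Hence
H is, near 0, the side σ Im p_j ≥ 0 of a graph Im p_k = r(p). Here j, k are the last two coordinates
in some order, σ = ±1, and r vanishes on the edge Im p_j = 0 (`exists_boundary_graph`).

Existence is by reflection. Conjugation of all coordinates reverses the sign of Im p_j and preserves
Levi-flatness, so H can be continued by its conjugate, the graph of r*(p) = -r(conj p). The issue is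
smoothness at the edge: r and r* must agree there to infinite order
(`IsGraphFun.vanishTo_sub_reflectFun`). Write e = σ e_j and let b be the slope for which e + b e_k
is complex tangent. Levi-flatness gives the Burgers equation D̄_b b = 0, where D̄_b = ∂_e + i ∂_{ie}
+ conj(b) ∂_S and ∂_S is the derivative in Re p_k. This determines the derivative of b normal to the
edge from tangential ones. On the edge b is real. Conjugation does not fix the edge pointwise, but
the remaining integrability equations show that b there does not vary with the first N-2
coordinates. So b and the reflected slope agree on the edge, and then all their normal derivatives
do; those of r follow.

Uniqueness is unique continuation for D̄_b. Its conjugate operator D_b commutes with it because D̄_b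
b = 0, which yields a Carleman estimate without straightening the Levi foliation
(`carleman_inequality`). If two extensions have slopes b, b', then δ = b - b' satisfies |D̄_b δ| ≤
C|δ| and vanishes for σ Im p_j ≥ 0, hence near 0 (`eventually_eq_zero_of_side`). With equal slopes
the difference of the two graph functions is killed by D̄_b, and the same argument shows that it
vanishes. -/

/-! ### Calculus of derivatives in constant directions -/

section DirDeriv

variable {E : Type*} [NormedAddCommGroup E] [NormedSpace ℝ E]
  {G : Type*} [NormedAddCommGroup G] [NormedSpace ℝ G]

/-- The derivative of `f` in the constant direction `v`. -/
noncomputable def dirDeriv (v : E) (f : E → G) : E → G := fun p => fderiv ℝ f p v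

theorem ContDiff.dirDeriv {f : E → G} (hf : ContDiff ℝ ∞ f) (v : E) :
    ContDiff ℝ ∞ (dirDeriv v f) :=
  (hf.fderiv_right (m := ∞) (by simp)).clm_apply contDiff_const

theorem ContDiff.differentiableAt_of_smooth {f : E → G} (hf : ContDiff ℝ ∞ f) (p : E) :
    DifferentiableAt ℝ f p := (hf.differentiable (by simp)) p

theorem dirDeriv_comm {f : E → G} (hf : ContDiff ℝ ∞ f) (u v : E) :
    dirDeriv u (dirDeriv v f) = dirDeriv v (dirDeriv u f) := by
  funext p
  have hd : DifferentiableAt ℝ (fderiv ℝ f) p :=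
    (hf.fderiv_right (m := ∞) (by simp)).differentiableAt_of_smooth p
  have key : ∀ a b : E, dirDeriv a (dirDeriv b f) p = fderiv ℝ (fderiv ℝ f) p a b := by
    intro a b
    change fderiv ℝ (fun q => fderiv ℝ f q b) p a = _
    rw [fderiv_clm_apply hd (by fun_prop)]
    simp
  rw [key, key]
  exact (hf.contDiffAt.isSymmSndFDerivAt (by simp; exact WithTop.coe_le_coe.2 (le_top (a := (2 : ℕ∞))))) u v

theorem dirDeriv_add {f g : E → G} (hf : ContDiff ℝ ∞ f) (hg : ContDiff ℝ ∞ g) (v : E) :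
    dirDeriv v (fun p => f p + g p) = fun p => dirDeriv v f p + dirDeriv v g p := by
  funext p
  simp only [dirDeriv]
  rw [fderiv_fun_add (hf.differentiableAt_of_smooth p) (hg.differentiableAt_of_smooth p)]
  rfl

theorem dirDeriv_sub {f g : E → G} (hf : ContDiff ℝ ∞ f) (hg : ContDiff ℝ ∞ g) (v : E) :
    dirDeriv v (fun p => f p - g p) = fun p => dirDeriv v f p - dirDeriv v g p := by
  funext p
  simp only [dirDeriv]
  rw [fderiv_fun_sub (hf.differentiableAt_of_smooth p) (hg.differentiableAt_of_smooth p)]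
  rfl

theorem dirDeriv_mul {f g : E → ℂ} (hf : ContDiff ℝ ∞ f) (hg : ContDiff ℝ ∞ g) (v : E) :
    dirDeriv v (fun p => f p * g p) = fun p => dirDeriv v f p * g p + f p * dirDeriv v g p := by
  funext p
  simp only [dirDeriv]
  rw [fderiv_fun_mul (hf.differentiableAt_of_smooth p) (hg.differentiableAt_of_smooth p)]
  simp
  ring

theorem dirDeriv_const_mul {f : E → ℂ} (hf : ContDiff ℝ ∞ f) (c : ℂ) (v : E) :
    dirDeriv v (fun p => c * f p) = fun p => c * dirDeriv v f p := by
  funext p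
  simp only [dirDeriv]
  rw [fderiv_const_mul (hf.differentiableAt_of_smooth p)]
  simp

theorem dirDeriv_clm_comp {G' : Type*} [NormedAddCommGroup G'] [NormedSpace ℝ G']
    {f : E → G} (hf : ContDiff ℝ ∞ f) (T : G →L[ℝ] G') (v : E) :
    dirDeriv v (fun p => T (f p)) = fun p => T (dirDeriv v f p) := by
  funext p
  have := (T.hasFDerivAt.comp p (hf.differentiableAt_of_smooth p).hasFDerivAt).fderiv
  simp only [dirDeriv]
  exact congrArg (fun A => A v) this

theorem dirDeriv_comp_clm {f : E → G} (hf : ContDiff ℝ ∞ f) (T : E →L[ℝ] E) (v : E) :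
    dirDeriv v (fun p => f (T p)) = fun p => dirDeriv (T v) f (T p) := by
  funext p
  have := ((hf.differentiableAt_of_smooth (T p)).hasFDerivAt.comp p T.hasFDerivAt).fderiv
  simp only [dirDeriv]
  exact congrArg (fun A => A v) this

theorem dirDeriv_conj {f : E → ℂ} (hf : ContDiff ℝ ∞ f) (v : E) :
    dirDeriv v (fun p => starRingEnd ℂ (f p)) = fun p => starRingEnd ℂ (dirDeriv v f p) :=
  dirDeriv_clm_comp hf (Complex.conjCLE : ℂ →L[ℝ] ℂ) v

theorem dirDeriv_ofReal {f : E → ℝ} (hf : ContDiff ℝ ∞ f) (v : E) :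
    dirDeriv v (fun p => (f p : ℂ)) = fun p => ((dirDeriv v f p : ℝ) : ℂ) :=
  dirDeriv_clm_comp hf Complex.ofRealCLM v

theorem ContDiff.conj {f : E → ℂ} (hf : ContDiff ℝ ∞ f) :
    ContDiff ℝ ∞ (fun p => starRingEnd ℂ (f p)) :=
  (Complex.conjCLE : ℂ →L[ℝ] ℂ).contDiff.comp hf

theorem ContDiff.complex_ofReal {f : E → ℝ} (hf : ContDiff ℝ ∞ f) :
    ContDiff ℝ ∞ (fun p => (f p : ℂ)) :=
  Complex.ofRealCLM.contDiff.comp hf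

/-- Derivatives in direction `v` vanish at `p` if the function is constant along the line through `p`
in direction `v`, near `p`. -/
theorem dirDeriv_eq_zero_of_eventually_line {p : E} {f : E → G} (hf : DifferentiableAt ℝ f p) {v : E} {c : G}
    (h : ∀ᶠ t : ℝ in 𝓝 0, f (p + t • v) = c) : dirDeriv v f p = 0 := by
  have h1 : HasLineDerivAt ℝ f (fderiv ℝ f p v) p v := hf.hasFDerivAt.hasLineDerivAt v
  have h2 : HasDerivAt (fun t : ℝ => f (p + t • v)) 0 0 :=
    (hasDerivAt_const (0 : ℝ) c).congr_of_eventuallyEq h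
  exact h1.unique h2

end DirDeriv

/-! ### Vanishing to finite and infinite order on a hyperplane -/

section Vanishing

variable {E : Type*} [NormedAddCommGroup E] [NormedSpace ℝ E]

/-- `f` vanishes to order `n` along the part in `C` of the hyperplane `y = 0`. -/
def VanishTo (C : Set E) (y : E →L[ℝ] ℝ) : ℕ → (E → ℂ) → Prop
  | 0, _ => True
  | n + 1, f => (∀ p ∈ C, y p = 0 → f p = 0) ∧ ∀ v, VanishTo C y n (dirDeriv v f)

variable {C : Set E} {y : E →L[ℝ] ℝ}

theorem VanishTo.mono_succ {n : ℕ} {f : E → ℂ} (h : VanishTo C y (n + 1) f) :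
    VanishTo C y n f := by
  induction n generalizing f with
  | zero => trivial
  | succ n ih => exact ⟨h.1, fun v => ih (h.2 v)⟩

theorem VanishTo.add {n : ℕ} {f g : E → ℂ} (hf : ContDiff ℝ ∞ f) (hg : ContDiff ℝ ∞ g)
    (h : VanishTo C y n f) (h' : VanishTo C y n g) : VanishTo C y n (fun p => f p + g p) := by
  induction n generalizing f g with
  | zero => trivial
  | succ n ih =>
    refine ⟨fun p hp hy => by simp [h.1 p hp hy, h'.1 p hp hy], fun v => ?_⟩
    rw [dirDeriv_add hf hg]
    exact ih (hf.dirDeriv v) (hg.dirDeriv v) (h.2 v) (h'.2 v)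

theorem VanishTo.mul_right {n : ℕ} {f g : E → ℂ} (hf : ContDiff ℝ ∞ f) (hg : ContDiff ℝ ∞ g)
    (h : VanishTo C y n f) : VanishTo C y n (fun p => f p * g p) := by
  induction n generalizing f g with
  | zero => trivial
  | succ n ih =>
    refine ⟨fun p hp hy => by simp [h.1 p hp hy], fun v => ?_⟩
    rw [dirDeriv_mul hf hg]
    exact VanishTo.add ((hf.dirDeriv v).mul hg) (hf.mul (hg.dirDeriv v))
      (ih (hf.dirDeriv v) hg (h.2 v)) (ih hf (hg.dirDeriv v) h.mono_succ)

theorem VanishTo.mul_left {n : ℕ} {f g : E → ℂ} (hf : ContDiff ℝ ∞ f) (hg : ContDiff ℝ ∞ g)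
    (h : VanishTo C y n g) : VanishTo C y n (fun p => f p * g p) := by
  simpa [mul_comm] using h.mul_right hg hf

theorem VanishTo.conj {n : ℕ} {f : E → ℂ} (hf : ContDiff ℝ ∞ f)
    (h : VanishTo C y n f) : VanishTo C y n (fun p => starRingEnd ℂ (f p)) := by
  induction n generalizing f with
  | zero => trivial
  | succ n ih =>
    refine ⟨fun p hp hy => by simp [h.1 p hp hy], fun v => ?_⟩
    rw [dirDeriv_conj hf]
    exact ih (hf.dirDeriv v) (h.2 v)

theorem dirDeriv_eq_zero_of_tangent (hC : IsOpen C) {f : E → ℂ} (hf : ContDiff ℝ ∞ f)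
    (h : ∀ p ∈ C, y p = 0 → f p = 0) {v : E} (hv : y v = 0) :
    ∀ p ∈ C, y p = 0 → dirDeriv v f p = 0 := by
  intro p hp hy
  refine dirDeriv_eq_zero_of_eventually_line (c := 0) (hf.differentiableAt_of_smooth p) ?_
  have hc : ContinuousAt (fun t : ℝ => p + t • v) 0 := by fun_prop
  have : ∀ᶠ t : ℝ in 𝓝 0, p + t • v ∈ C :=
    hc.eventually_mem (by simpa using hC.mem_nhds hp)
  filter_upwards [this] with t ht
  exact h _ ht (by simp [hv, hy])

/-- Differentiating along the hyperplane costs no order, because a tangential derivative of a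
function that is zero on the hyperplane is again zero there, and derivatives commute. -/
theorem VanishTo.dirDeriv_tangent (hC : IsOpen C) {n : ℕ} {f : E → ℂ} (hf : ContDiff ℝ ∞ f)
    (h : VanishTo C y n f) {v : E} (hv : y v = 0) : VanishTo C y n (dirDeriv v f) := by
  induction n generalizing f with
  | zero => trivial
  | succ n ih =>
    refine ⟨dirDeriv_eq_zero_of_tangent hC hf h.1 hv, fun w => ?_⟩
    rw [dirDeriv_comm hf]
    exact ih (hf.dirDeriv w) (h.2 w)

/-- Every direction is a tangential one plus a multiple of `Y`, so only the normal derivative needs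
control. This is the induction step for functions whose normal derivative is given by an equation.
-/
theorem VanishTo.succ_of_normal (hC : IsOpen C) {Y : E} (hY : y Y = 1) {n : ℕ} {f : E → ℂ}
    (hf : ContDiff ℝ ∞ f) (h0 : ∀ p ∈ C, y p = 0 → f p = 0)
    (h : VanishTo C y n (dirDeriv Y f)) : VanishTo C y (n + 1) f := by
  have main : ∀ v, y v = 0 → VanishTo C y n (dirDeriv v f) := by
    intro v hv
    induction n generalizing f with
    | zero => trivial
    | succ n ih =>
      have h1 : VanishTo C y n (dirDeriv v f) := ih hf h0 h.mono_succ
      refine ⟨dirDeriv_eq_zero_of_tangent hC hf h0 hv, fun w => ?_⟩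
      rw [dirDeriv_comm hf]
      have hw : dirDeriv w f = fun p => dirDeriv (w - y w • Y) f p + y w * dirDeriv Y f p := by
        funext p
        simp [dirDeriv]
      have h2 : VanishTo C y n (dirDeriv v (dirDeriv (w - y w • Y) f)) := by
        have ht : y (w - y w • Y) = 0 := by simp [hY]
        refine ih (hf.dirDeriv _) (dirDeriv_eq_zero_of_tangent hC hf h0 ht) ?_
        rw [dirDeriv_comm hf]
        exact h.mono_succ.dirDeriv_tangent hC (hf.dirDeriv Y) ht
      rw [hw, dirDeriv_add (hf.dirDeriv _) (contDiff_const.mul (hf.dirDeriv _)),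
        dirDeriv_const_mul (hf.dirDeriv _)]
      refine h2.add ((hf.dirDeriv _).dirDeriv _)
        (contDiff_const.mul ((hf.dirDeriv _).dirDeriv _)) ?_
      exact (h.mono_succ.dirDeriv_tangent hC (hf.dirDeriv Y) hv).mul_left contDiff_const
        ((hf.dirDeriv _).dirDeriv _)
  refine ⟨h0, fun w => ?_⟩
  have hw : dirDeriv w f = fun p => dirDeriv (w - y w • Y) f p + y w * dirDeriv Y f p := by
    funext p
    simp [dirDeriv]
  rw [hw]
  exact (main _ (by simp [hY])).add (hf.dirDeriv _) (contDiff_const.mul (hf.dirDeriv _))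
    (h.mul_left contDiff_const (hf.dirDeriv _))

theorem eq_zero_on_hyperplane_of_side (hC : IsOpen C) {Y : E} (hY : 0 < y Y) {f : E → ℂ}
    (hf : Continuous f) (h : ∀ p ∈ C, 0 < y p → f p = 0) : ∀ p ∈ C, y p = 0 → f p = 0 := by
  intro p hp hy
  have hc : Continuous (fun t : ℝ => p + t • Y) := by fun_prop
  have h1 : Filter.Tendsto (fun t : ℝ => f (p + t • Y)) (𝓝[>] 0) (𝓝 (f p)) := by
    have := ((hf.comp hc).tendsto 0).mono_left (nhdsWithin_le_nhds (s := Set.Ioi 0))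
    simpa [Function.comp_def] using this
  have h2 : ∀ᶠ t : ℝ in 𝓝[>] 0, f (p + t • Y) = 0 := by
    have : ∀ᶠ t : ℝ in 𝓝 0, p + t • Y ∈ C :=
      hc.continuousAt.eventually_mem (by simpa using hC.mem_nhds hp)
    filter_upwards [nhdsWithin_le_nhds this, self_mem_nhdsWithin] with t ht ht0
    refine h _ ht ?_
    simp only [map_add, map_smul, hy, smul_eq_mul, zero_add]
    exact mul_pos ht0 hY
  exact tendsto_nhds_unique (h1.congr' h2) tendsto_const_nhds |>.symm ▸ rfl

/-- All derivatives vanish on the open side, and by continuity on the hyperplane bounding it. -/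
theorem vanishTo_of_side (hC : IsOpen C) {Y : E} (hY : 0 < y Y) {f : E → ℂ}
    (hf : ContDiff ℝ ∞ f) (h : ∀ p ∈ C, 0 < y p → f p = 0) (n : ℕ) : VanishTo C y n f := by
  induction n generalizing f with
  | zero => trivial
  | succ n ih =>
    refine ⟨eq_zero_on_hyperplane_of_side hC hY hf.continuous h, fun v => ih (hf.dirDeriv v) ?_⟩
    intro p hp hy
    have : f =ᶠ[𝓝 p] fun _ => 0 := by
      have h1 : ∀ᶠ q in 𝓝 p, 0 < y q := y.continuous.continuousAt.eventually (lt_mem_nhds hy)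
      filter_upwards [h1, hC.mem_nhds hp] with q h1 h2 using h q h2 h1
    simp [dirDeriv, this.fderiv_eq]

theorem VanishTo.neg_functional {n : ℕ} {f : E → ℂ} (h : VanishTo C (-y) n f) :
    VanishTo C y n f := by
  induction n generalizing f with
  | zero => trivial
  | succ n ih => exact ⟨fun p hp hy => h.1 p hp (by simp [hy]), fun v => ih (h.2 v)⟩

/-- The function equal to `f` on `y ≥ 0` and to `0` elsewhere. -/
noncomputable def cutSide (y : E →L[ℝ] ℝ) (f : E → ℂ) : E → ℂ :=
  open Classical in fun p => if 0 ≤ y p then f p else 0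

/-- Order 2 means that `f` and its first derivatives vanish. At a point of the hyperplane the cut
function is dominated by |f|, which is o(distance), so its derivative is 0. -/
theorem hasFDerivAt_cutSide {f : E → ℂ} (hf : ContDiff ℝ ∞ f)
    (h : VanishTo C y 2 f) {p : E} (hp : p ∈ C) :
    HasFDerivAt (cutSide y f) (open Classical in if 0 ≤ y p then fderiv ℝ f p else 0) p := by
  classical
  have hd := (hf.differentiableAt_of_smooth p).hasFDerivAt
  rcases lt_trichotomy (y p) 0 with hy | hy | hy
  · have h1 : ∀ᶠ q in 𝓝 p, y q < 0 := y.continuous.continuousAt.eventually (gt_mem_nhds hy)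
    rw [if_neg (not_le.2 hy)]
    refine (hasFDerivAt_const (0 : ℂ) p).congr_of_eventuallyEq ?_
    filter_upwards [h1] with q hq
    simp [cutSide, not_le.2 hq]
  · have h0 : f p = 0 := h.1 p hp hy
    have h1 : fderiv ℝ f p = 0 := by
      ext v
      exact (h.2 v).1 p hp hy
    rw [if_pos hy.ge, h1]
    rw [h1] at hd
    have hc : cutSide y f p = 0 := by simp [cutSide, hy, h0]
    rw [hasFDerivAt_iff_isLittleO] at hd ⊢
    refine Asymptotics.IsBigO.trans_isLittleO (Asymptotics.IsBigO.of_bound 1 ?_) hd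
    refine Filter.Eventually.of_forall fun q => ?_
    simp only [hc, h0, sub_zero, zero_apply, one_mul]
    unfold cutSide
    split_ifs <;> simp
  · have h1 : ∀ᶠ q in 𝓝 p, 0 < y q := y.continuous.continuousAt.eventually (lt_mem_nhds hy)
    rw [if_pos hy.le]
    refine hd.congr_of_eventuallyEq ?_
    filter_upwards [h1] with q hq
    simp [cutSide, hq.le]

/-- The derivative of the cut function is the cut of the derivative, which is again flat on the
hyperplane; induct on the order of smoothness. -/
theorem contDiffOn_cutSide [FiniteDimensional ℝ E] (hC : IsOpen C) {f : E → ℂ}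
    (hf : ContDiff ℝ ∞ f) (h : ∀ n, VanishTo C y n f) : ContDiffOn ℝ ∞ (cutSide y f) C := by
  refine contDiffOn_infty.2 fun n => ?_
  induction n generalizing f with
  | zero =>
    refine contDiffOn_zero.2 fun p hp => ?_
    exact (hasFDerivAt_cutSide hf (h 2) hp).continuousAt.continuousWithinAt
  | succ n ih =>
    have hcast : ((n + 1 : ℕ) : WithTop ℕ∞) = (n : WithTop ℕ∞) + 1 := by norm_cast
    rw [hcast, contDiffOn_succ_iff_fderiv_of_isOpen hC]
    refine ⟨fun p hp =>
      (hasFDerivAt_cutSide hf (h 2) hp).differentiableAt.differentiableWithinAt, by simp, ?_⟩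
    rw [contDiffOn_clm_apply]
    intro v
    refine (ih (hf.dirDeriv v) fun n => (h (n + 1)).2 v).congr fun p hp => ?_
    rw [(hasFDerivAt_cutSide hf (h 2) hp).fderiv]
    unfold cutSide
    split_ifs <;> rfl

end Vanishing

/-! ### The Cauchy–Riemann operators along a Levi foliation -/

section CauchyRiemann

variable {E : Type*} [NormedAddCommGroup E] [NormedSpace ℝ E]

/-- The operator `∂_X + i ∂_Y + \bar b ∂_S`. -/
noncomputable def dbarOp (X Y S : E) (b f : E → ℂ) : E → ℂ := fun p =>
  dirDeriv X f p + Complex.I * dirDeriv Y f p + starRingEnd ℂ (b p) * dirDeriv S f p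

/-- The operator `∂_X - i ∂_Y + b ∂_S`. -/
noncomputable def dOp (X Y S : E) (b f : E → ℂ) : E → ℂ := fun p =>
  dirDeriv X f p - Complex.I * dirDeriv Y f p + b p * dirDeriv S f p

variable {X Y S : E} {b f g : E → ℂ}

theorem ContDiff.dbarOp (hb : ContDiff ℝ ∞ b) (hf : ContDiff ℝ ∞ f) :
    ContDiff ℝ ∞ (dbarOp X Y S b f) :=
  ((hf.dirDeriv X).add (contDiff_const.mul (hf.dirDeriv Y))).add (hb.conj.mul (hf.dirDeriv S))

theorem ContDiff.dOp (hb : ContDiff ℝ ∞ b) (hf : ContDiff ℝ ∞ f) :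
    ContDiff ℝ ∞ (dOp X Y S b f) :=
  ((hf.dirDeriv X).sub (contDiff_const.mul (hf.dirDeriv Y))).add (hb.mul (hf.dirDeriv S))

theorem dbarOp_mul (hf : ContDiff ℝ ∞ f) (hg : ContDiff ℝ ∞ g) :
    dbarOp X Y S b (fun p => f p * g p) =
      fun p => dbarOp X Y S b f p * g p + f p * dbarOp X Y S b g p := by
  funext p
  simp only [dbarOp, dirDeriv_mul hf hg]
  ring

theorem dOp_mul (hf : ContDiff ℝ ∞ f) (hg : ContDiff ℝ ∞ g) :
    dOp X Y S b (fun p => f p * g p) =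
      fun p => dOp X Y S b f p * g p + f p * dOp X Y S b g p := by
  funext p
  simp only [dOp, dirDeriv_mul hf hg]
  ring

theorem dbarOp_add (hf : ContDiff ℝ ∞ f) (hg : ContDiff ℝ ∞ g) :
    dbarOp X Y S b (fun p => f p + g p) =
      fun p => dbarOp X Y S b f p + dbarOp X Y S b g p := by
  funext p
  simp only [dbarOp, dirDeriv_add hf hg]
  ring

theorem dOp_const_mul (hf : ContDiff ℝ ∞ f) (c : ℂ) :
    dOp X Y S b (fun p => c * f p) = fun p => c * dOp X Y S b f p := by
  funext p
  simp only [dOp, dirDeriv_const_mul hf]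
  ring

theorem dOp_sub (hf : ContDiff ℝ ∞ f) (hg : ContDiff ℝ ∞ g) :
    dOp X Y S b (fun p => f p - g p) =
      fun p => dOp X Y S b f p - dOp X Y S b g p := by
  funext p
  simp only [dOp, dirDeriv_sub hf hg]
  ring

theorem dbarOp_conj (hf : ContDiff ℝ ∞ f) :
    dbarOp X Y S b (fun p => starRingEnd ℂ (f p)) =
      fun p => starRingEnd ℂ (dOp X Y S b f p) := by
  funext p
  simp [dbarOp, dOp, dirDeriv_conj hf]

theorem dOp_conj (hf : ContDiff ℝ ∞ f) :
    dOp X Y S b (fun p => starRingEnd ℂ (f p)) =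
      fun p => starRingEnd ℂ (dbarOp X Y S b f p) := by
  funext p
  simp [dbarOp, dOp, dirDeriv_conj hf]
  ring

theorem dirDeriv_dbarOp (hb : ContDiff ℝ ∞ b) (hf : ContDiff ℝ ∞ f) (v p : E) :
    dirDeriv v (dbarOp X Y S b f) p = dirDeriv v (dirDeriv X f) p
      + Complex.I * dirDeriv v (dirDeriv Y f) p
      + (dirDeriv v (fun q => starRingEnd ℂ (b q)) p * dirDeriv S f p
        + starRingEnd ℂ (b p) * dirDeriv v (dirDeriv S f) p) := by
  have hx := hf.dirDeriv X
  have hy := hf.dirDeriv Y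
  have hs := hf.dirDeriv S
  unfold dbarOp
  rw [dirDeriv_add (hx.add (contDiff_const.mul hy)) (hb.conj.mul hs),
    dirDeriv_add hx (contDiff_const.mul hy), dirDeriv_const_mul hy, dirDeriv_mul hb.conj hs]

theorem dirDeriv_dOp (hb : ContDiff ℝ ∞ b) (hf : ContDiff ℝ ∞ f) (v p : E) :
    dirDeriv v (dOp X Y S b f) p = dirDeriv v (dirDeriv X f) p
      - Complex.I * dirDeriv v (dirDeriv Y f) p
      + (dirDeriv v b p * dirDeriv S f p + b p * dirDeriv v (dirDeriv S f) p) := by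
  have hx := hf.dirDeriv X
  have hy := hf.dirDeriv Y
  have hs := hf.dirDeriv S
  unfold dOp
  rw [dirDeriv_add (hx.sub (contDiff_const.mul hy)) (hb.mul hs),
    dirDeriv_sub hx (contDiff_const.mul hy), dirDeriv_const_mul hy, dirDeriv_mul hb hs]

/-- If `b` solves `dbarOp b b = 0` the operators `dOp b` and `dbarOp b` commute. -/
theorem dOp_dbarOp_comm (hb : ContDiff ℝ ∞ b) (hf : ContDiff ℝ ∞ f) {p : E}
    (h : dbarOp X Y S b b p = 0) :
    dOp X Y S b (dbarOp X Y S b f) p = dbarOp X Y S b (dOp X Y S b f) p := by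
  -- The second-order terms of the commutator cancel, leaving (D b̄ - D̄ b) ∂_S f; here D b̄ =
  -- conj(D̄ b), so both coefficients vanish.
  have h' : dOp X Y S b (fun p => starRingEnd ℂ (b p)) p = 0 := by
    rw [dOp_conj hb]
    simp [h]
  have l : dOp X Y S b (dbarOp X Y S b f) p = dirDeriv X (dbarOp X Y S b f) p
    - Complex.I * dirDeriv Y (dbarOp X Y S b f) p + b p * dirDeriv S (dbarOp X Y S b f) p := rfl
  have r : dbarOp X Y S b (dOp X Y S b f) p = dirDeriv X (dOp X Y S b f) p
    + Complex.I * dirDeriv Y (dOp X Y S b f) p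
    + starRingEnd ℂ (b p) * dirDeriv S (dOp X Y S b f) p := rfl
  simp only [l, r, dirDeriv_dbarOp hb hf, dirDeriv_dOp hb hf]
  rw [dirDeriv_comm hf Y X, dirDeriv_comm hf S X,
    dirDeriv_comm hf S Y]
  simp only [dOp, dbarOp] at h h'
  linear_combination dirDeriv S f p * h' - dirDeriv S f p * h

theorem HasCompactSupport.dbarOp (hf : HasCompactSupport f) :
    HasCompactSupport (dbarOp X Y S b f) :=
  ((hf.fderiv_apply (𝕜 := ℝ) X).add (HasCompactSupport.mul_left (hf.fderiv_apply (𝕜 := ℝ) Y))).add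
    (HasCompactSupport.mul_left (hf.fderiv_apply (𝕜 := ℝ) S))

theorem HasCompactSupport.dOp (hf : HasCompactSupport f) :
    HasCompactSupport (dOp X Y S b f) :=
  ((hf.fderiv_apply (𝕜 := ℝ) X).sub (HasCompactSupport.mul_left (hf.fderiv_apply (𝕜 := ℝ) Y))).add
    (HasCompactSupport.mul_left (hf.fderiv_apply (𝕜 := ℝ) S))

end CauchyRiemann

/-! ### The Carleman estimate -/

section Carleman

open MeasureTheory

variable {E : Type*} [NormedAddCommGroup E] [NormedSpace ℝ E] [FiniteDimensional ℝ E]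
  [MeasurableSpace E] [BorelSpace E] (μ : Measure E) [μ.IsAddHaarMeasure]
variable {X Y S : E} {b f g u : E → ℂ}

theorem integral_dirDeriv_mul (hf : ContDiff ℝ ∞ f) (hg : ContDiff ℝ ∞ g)
    (hc : HasCompactSupport g) (v : E) :
    ∫ p, dirDeriv v f p * g p ∂μ = - ∫ p, f p * dirDeriv v g p ∂μ := by
  have hc' : HasCompactSupport (dirDeriv v g) := hc.fderiv_apply (𝕜 := ℝ) v
  have := integral_mul_fderiv_eq_neg_fderiv_mul_of_integrable (μ := μ) (f := f) (g := g) (v := v)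
    (((hf.dirDeriv v).continuous.mul hg.continuous).integrable_of_hasCompactSupport hc.mul_left)
    ((hf.continuous.mul (hg.dirDeriv v).continuous).integrable_of_hasCompactSupport hc'.mul_left)
    ((hf.continuous.mul hg.continuous).integrable_of_hasCompactSupport hc.mul_left)
    (fun p _ => hf.differentiableAt_of_smooth p) (fun p _ => hg.differentiableAt_of_smooth p)
  simp only [dirDeriv]
  rw [this, neg_neg]

/-- Integration by parts: the formal L² adjoint of `dbarOp` is -(`dOp` + ∂_S b), the zero-order term
coming from the variable coefficient. -/
theorem integral_dbarOp_mul_conj (hb : ContDiff ℝ ∞ b) (hf : ContDiff ℝ ∞ f)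
    (hg : ContDiff ℝ ∞ g) (hc : HasCompactSupport g) :
    ∫ p, dbarOp X Y S b f p * starRingEnd ℂ (g p) ∂μ =
      - ∫ p, f p * starRingEnd ℂ (dOp X Y S b g p + dirDeriv S b p * g p) ∂μ := by
  have hcg : HasCompactSupport (fun p => starRingEnd ℂ (g p)) :=
    hc.comp_left (g := starRingEnd ℂ) (map_zero _)
  have hI : ContDiff ℝ ∞ (fun p => Complex.I * starRingEnd ℂ (g p)) := contDiff_const.mul hg.conj
  have hB : ContDiff ℝ ∞ (fun p => starRingEnd ℂ (b p) * starRingEnd ℂ (g p)) :=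
    hb.conj.mul hg.conj
  have hcI : HasCompactSupport (fun p => Complex.I * starRingEnd ℂ (g p)) := hcg.mul_left
  have hcB : HasCompactSupport (fun p => starRingEnd ℂ (b p) * starRingEnd ℂ (g p)) :=
    hcg.mul_left
  have int1 : ∀ {h : E → ℂ} (v : E), ContDiff ℝ ∞ h → HasCompactSupport h →
      Integrable (fun p => dirDeriv v f p * h p) μ := fun v hh hch =>
    ((hf.dirDeriv v).continuous.mul hh.continuous).integrable_of_hasCompactSupport hch.mul_left
  have int2 : ∀ {h : E → ℂ} (v : E), ContDiff ℝ ∞ h → HasCompactSupport h →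
      Integrable (fun p => f p * dirDeriv v h p) μ := fun v hh hch =>
    (hf.continuous.mul (hh.dirDeriv v).continuous).integrable_of_hasCompactSupport
      (HasCompactSupport.mul_left (hch.fderiv_apply (𝕜 := ℝ) v))
  have l : ∀ p, dbarOp X Y S b f p * starRingEnd ℂ (g p) =
      dirDeriv X f p * starRingEnd ℂ (g p) + dirDeriv Y f p * (Complex.I * starRingEnd ℂ (g p))
      + dirDeriv S f p * (starRingEnd ℂ (b p) * starRingEnd ℂ (g p)) := by
    intro p
    simp only [dbarOp]
    ring
  have r : ∀ p, f p * starRingEnd ℂ (dOp X Y S b g p + dirDeriv S b p * g p) =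
      f p * dirDeriv X (fun p => starRingEnd ℂ (g p)) p
      + f p * dirDeriv Y (fun p => Complex.I * starRingEnd ℂ (g p)) p
      + f p * dirDeriv S (fun p => starRingEnd ℂ (b p) * starRingEnd ℂ (g p)) p := by
    intro p
    rw [dirDeriv_const_mul hg.conj, dirDeriv_mul hb.conj hg.conj, dirDeriv_conj hg,
      dirDeriv_conj hg, dirDeriv_conj hg, dirDeriv_conj hb]
    simp [dOp]
    ring
  simp only [l, r]
  have add3 : ∀ {q₁ q₂ q₃ : E → ℂ}, Integrable q₁ μ → Integrable q₂ μ → Integrable q₃ μ →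
      ∫ p, (q₁ p + q₂ p + q₃ p) ∂μ = ∫ p, q₁ p ∂μ + ∫ p, q₂ p ∂μ + ∫ p, q₃ p ∂μ := by
    intro q₁ q₂ q₃ h₁ h₂ h₃
    rw [← integral_add h₁ h₂]
    exact integral_add (h₁.add h₂) h₃
  rw [add3 (int1 X hg.conj hcg) (int1 Y hI hcI) (int1 S hB hcB),
    add3 (int2 X hg.conj hcg) (int2 Y hI hcI) (int2 S hB hcB),
    integral_dirDeriv_mul μ hf hg.conj hcg, integral_dirDeriv_mul μ hf hI hcI,
    integral_dirDeriv_mul μ hf hB hcB]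
  ring

/-- The Carleman identity for `dbarOp`, conjugated by a factor with logarithmic derivative `a`. -/
theorem integral_normSq_dbarOp_sub (hb : ContDiff ℝ ∞ b) (hu : ContDiff ℝ ∞ u)
    (hc : HasCompactSupport u) {a : E → ℂ} (ha : ContDiff ℝ ∞ a)
    (hB : ∀ p, u p ≠ 0 → dbarOp X Y S b b p = 0) :
    ∫ p, (dbarOp X Y S b u p - a p * u p) * starRingEnd ℂ (dbarOp X Y S b u p - a p * u p) ∂μ =
    ∫ p, (dOp X Y S b u p + (dirDeriv S b p + starRingEnd ℂ (a p)) * u p) *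
        starRingEnd ℂ (dOp X Y S b u p + (dirDeriv S b p + starRingEnd ℂ (a p)) * u p) ∂μ
    + ∫ p, (dOp X Y S b a p + starRingEnd ℂ (dOp X Y S b a p)
        + dbarOp X Y S b (dirDeriv S b) p) * (u p * starRingEnd ℂ (u p)) ∂μ := by
  set w : E → ℂ := fun p => dbarOp X Y S b u p - a p * u p with hw
  set h : E → ℂ := fun p => dirDeriv S b p + starRingEnd ℂ (a p) with hh
  set v : E → ℂ := fun p => dOp X Y S b u p + h p * u p with hv
  have sh : ContDiff ℝ ∞ h := (hb.dirDeriv S).add ha.conj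
  have sw : ContDiff ℝ ∞ w := (hb.dbarOp hu).sub (ha.mul hu)
  have sv : ContDiff ℝ ∞ v := (hb.dOp hu).add (sh.mul hu)
  have cw : HasCompactSupport w := hc.dbarOp.sub hc.mul_left
  have cv : HasCompactSupport v := hc.dOp.add hc.mul_left
  have cconj : ∀ {q : E → ℂ}, HasCompactSupport q →
      HasCompactSupport (fun p => starRingEnd ℂ (q p)) := fun hq =>
    hq.comp_left (g := starRingEnd ℂ) (map_zero _)
  have e1 : ∫ p, dbarOp X Y S b u p * starRingEnd ℂ (w p) ∂μ =
      - ∫ p, u p * starRingEnd ℂ (dOp X Y S b w p + dirDeriv S b p * w p) ∂μ :=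
    integral_dbarOp_mul_conj μ hb hu sw cw
  have e2 : ∫ p, dbarOp X Y S b v p * starRingEnd ℂ (u p) ∂μ =
      - ∫ p, v p * starRingEnd ℂ (dOp X Y S b u p + dirDeriv S b p * u p) ∂μ :=
    integral_dbarOp_mul_conj μ hb sv hu hc
  have i1 : Integrable (fun p => dbarOp X Y S b u p * starRingEnd ℂ (w p)) μ :=
    ((hb.dbarOp hu).continuous.mul sw.conj.continuous).integrable_of_hasCompactSupport
      (cconj cw).mul_left
  have i2 : Integrable (fun p => a p * u p * starRingEnd ℂ (w p)) μ :=
    ((ha.mul hu).continuous.mul sw.conj.continuous).integrable_of_hasCompactSupport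
      (cconj cw).mul_left
  have i3 : Integrable (fun p => u p * starRingEnd ℂ (dOp X Y S b w p + dirDeriv S b p * w p)) μ :=
    (hu.continuous.mul ((hb.dOp sw).add ((hb.dirDeriv S).mul sw)).conj.continuous)
      |>.integrable_of_hasCompactSupport hc.mul_right
  have i4 : Integrable (fun p => dbarOp X Y S b v p * starRingEnd ℂ (u p)) μ :=
    ((hb.dbarOp sv).continuous.mul hu.conj.continuous).integrable_of_hasCompactSupport
      (cconj hc).mul_left
  have i5 : Integrable
      (fun p => v p * starRingEnd ℂ (dOp X Y S b u p + dirDeriv S b p * u p)) μ :=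
    (sv.continuous.mul ((hb.dOp hu).add ((hb.dirDeriv S).mul hu)).conj.continuous)
      |>.integrable_of_hasCompactSupport cv.mul_right
  have i6 : Integrable (fun p => a p * v p * starRingEnd ℂ (u p)) μ :=
    ((ha.mul sv).continuous.mul hu.conj.continuous).integrable_of_hasCompactSupport
      (cconj hc).mul_left
  have i7 : Integrable (fun p => starRingEnd ℂ (u p * starRingEnd ℂ
      (dOp X Y S b w p + (dirDeriv S b p + starRingEnd ℂ (a p)) * w p))) μ :=
    (hu.mul ((hb.dOp sw).add (sh.mul sw)).conj).conj.continuous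
      |>.integrable_of_hasCompactSupport (cconj hc.mul_right)
  have i8 : Integrable (fun p => (dbarOp X Y S b v p - a p * v p) * starRingEnd ℂ (u p)) μ :=
    (((hb.dbarOp sv).sub (ha.mul sv)).continuous.mul
      hu.conj.continuous).integrable_of_hasCompactSupport (cconj hc).mul_left
  -- With w = (D̄ - a)u and v = (D + ∂_S b + ā)u, the operators D̄ - a and -(D + ∂_S b + ā) are
  -- adjoint. So ‖w‖² and ‖v‖² become pairings of `u` with the two products of these operators.
  have A1 : ∫ p, w p * starRingEnd ℂ (w p) ∂μ = - ∫ p, u p * starRingEnd ℂ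
      (dOp X Y S b w p + (dirDeriv S b p + starRingEnd ℂ (a p)) * w p) ∂μ := by
    have : ∀ p, w p * starRingEnd ℂ (w p) = dbarOp X Y S b u p * starRingEnd ℂ (w p)
        - a p * u p * starRingEnd ℂ (w p) := fun p => by simp only [hw]; ring
    simp only [this]
    rw [integral_sub i1 i2, e1, ← neg_add', ← integral_add i3 i2]
    congr 2
    funext p
    simp only [map_add, map_mul, Complex.conj_conj]
    ring
  have A2 : ∫ p, v p * starRingEnd ℂ (v p) ∂μ =
      - ∫ p, (dbarOp X Y S b v p - a p * v p) * starRingEnd ℂ (u p) ∂μ := by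
    have h1 : ∀ p, v p * starRingEnd ℂ (v p) =
        v p * starRingEnd ℂ (dOp X Y S b u p + dirDeriv S b p * u p)
        + a p * v p * starRingEnd ℂ (u p) := fun p => by
      simp only [hv, hh, map_add, map_mul, Complex.conj_conj]; ring
    have h2 : ∀ p, (dbarOp X Y S b v p - a p * v p) * starRingEnd ℂ (u p) =
        dbarOp X Y S b v p * starRingEnd ℂ (u p) - a p * v p * starRingEnd ℂ (u p) :=
      fun p => by ring
    simp only [h1, h2]
    rw [integral_add i5 i6, integral_sub i4 i6, e2]
    ring
  -- ‖w‖² is real, so its formula may be conjugated to match the form of `A2`.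
  have A3 : ∫ p, w p * starRingEnd ℂ (w p) ∂μ =
      - ∫ p, starRingEnd ℂ (u p * starRingEnd ℂ
        (dOp X Y S b w p + (dirDeriv S b p + starRingEnd ℂ (a p)) * w p)) ∂μ := by
    have h1 : ∫ p, w p * starRingEnd ℂ (w p) ∂μ =
        starRingEnd ℂ (∫ p, w p * starRingEnd ℂ (w p) ∂μ) := by
      rw [← integral_conj]
      congr 1
      funext p
      simp [mul_comm]
    rw [h1, A1, map_neg, ← integral_conj]
  -- Where `u` is nonzero `dOp` and `dbarOp` commute, so the two integrands differ by a zero-order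
  -- term only; where `u` is zero both sides vanish. Hence the equation for `b` is needed only where
  -- `u` is nonzero.
  have key : ∀ p, starRingEnd ℂ (u p * starRingEnd ℂ
        (dOp X Y S b w p + (dirDeriv S b p + starRingEnd ℂ (a p)) * w p)) =
      (dbarOp X Y S b v p - a p * v p) * starRingEnd ℂ (u p)
      - (dOp X Y S b a p + starRingEnd ℂ (dOp X Y S b a p)
        + dbarOp X Y S b (dirDeriv S b) p) * (u p * starRingEnd ℂ (u p)) := by
    intro p
    by_cases hp : u p = 0
    · simp [hp]
    have com := dOp_dbarOp_comm (f := u) hb hu (hB p hp)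
    have x1 : dOp X Y S b w p = dOp X Y S b (dbarOp X Y S b u) p
        - (dOp X Y S b a p * u p + a p * dOp X Y S b u p) := by
      rw [hw, dOp_sub (hb.dbarOp hu) (ha.mul hu), dOp_mul ha hu]
    have x2 : dbarOp X Y S b v p = dbarOp X Y S b (dOp X Y S b u) p
        + ((dbarOp X Y S b (dirDeriv S b) p + starRingEnd ℂ (dOp X Y S b a p)) * u p
          + h p * dbarOp X Y S b u p) := by
      rw [hv, dbarOp_add (hb.dOp hu) (sh.mul hu), dbarOp_mul sh hu]
      simp only [hh]
      rw [dbarOp_add (hb.dirDeriv S) ha.conj, dbarOp_conj ha]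
    rw [x1, x2, com]
    simp only [hw, hv, hh, map_mul, Complex.conj_conj]
    ring
  rw [A3, A2]
  simp only [key]
  have i9 : Integrable (fun p => (dOp X Y S b a p + starRingEnd ℂ (dOp X Y S b a p)
        + dbarOp X Y S b (dirDeriv S b) p) * (u p * starRingEnd ℂ (u p))) μ :=
    (((((hb.dOp ha).add (hb.dOp ha).conj).add (hb.dbarOp (hb.dirDeriv S))).continuous).mul
      (hu.mul hu.conj).continuous).integrable_of_hasCompactSupport
      (HasCompactSupport.mul_left hc.mul_right)
  rw [integral_sub i8 i9]
  ring

/-- The Carleman inequality for `dbarOp`. -/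
theorem carleman_inequality (hb : ContDiff ℝ ∞ b) (hu : ContDiff ℝ ∞ u)
    (hc : HasCompactSupport u) {a : E → ℂ} (ha : ContDiff ℝ ∞ a)
    (hB : ∀ p, u p ≠ 0 → dbarOp X Y S b b p = 0) {c : ℝ}
    (hcp : ∀ p, u p ≠ 0 →
      c ≤ 2 * (dOp X Y S b a p).re + (dbarOp X Y S b (dirDeriv S b) p).re) :
    c * ∫ p, ‖u p‖ ^ 2 ∂μ ≤ ∫ p, ‖dbarOp X Y S b u p - a p * u p‖ ^ 2 ∂μ := by
  have sq : ∀ z : ℂ, z * starRingEnd ℂ z = ((‖z‖ ^ 2 : ℝ) : ℂ) := fun z => by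
    rw [Complex.mul_conj, Complex.normSq_eq_norm_sq]
  have id := integral_normSq_dbarOp_sub μ hb hu hc ha hB
  have sκ : Continuous (fun p => dOp X Y S b a p + starRingEnd ℂ (dOp X Y S b a p)
        + dbarOp X Y S b (dirDeriv S b) p) :=
    (((hb.dOp ha).add (hb.dOp ha).conj).add (hb.dbarOp (hb.dirDeriv S))).continuous
  have hκ : ∀ p, u p ≠ 0 → c ≤ (dOp X Y S b a p + starRingEnd ℂ (dOp X Y S b a p)
        + dbarOp X Y S b (dirDeriv S b) p).re := by
    intro p hp
    have := hcp p hp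
    simp only [Complex.add_re, Complex.conj_re]
    linarith
  generalize hκdef : (fun p => dOp X Y S b a p + starRingEnd ℂ (dOp X Y S b a p)
        + dbarOp X Y S b (dirDeriv S b) p) = κ at sκ
  have hκ' : ∀ p, u p ≠ 0 → c ≤ (κ p).re := fun p hp => hκdef ▸ hκ p hp
  have hκ'' : ∀ p, dOp X Y S b a p + starRingEnd ℂ (dOp X Y S b a p)
        + dbarOp X Y S b (dirDeriv S b) p = κ p := fun p => congrFun hκdef p
  simp only [hκ'', sq] at id
  clear hκ hκ'' hκdef hcp
  have id' := congrArg Complex.re id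
  rw [Complex.add_re, integral_complex_ofReal, integral_complex_ofReal, Complex.ofReal_re,
    Complex.ofReal_re] at id'
  rw [id']
  have hn : 0 ≤ ∫ p, ‖dOp X Y S b u p + (dirDeriv S b p + starRingEnd ℂ (a p)) * u p‖ ^ 2 ∂μ :=
    integral_nonneg fun p => by positivity
  have hcu : HasCompactSupport (fun p => ‖u p‖ ^ 2) :=
    hc.comp_left (g := fun z => ‖z‖ ^ 2) (by simp)
  have i9 : Integrable (fun p => κ p * ((‖u p‖ ^ 2 : ℝ) : ℂ)) μ := by
    simp only [← sq]
    exact (sκ.mul (hu.mul hu.conj).continuous).integrable_of_hasCompactSupport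
      (HasCompactSupport.mul_left hc.mul_right)
  have i11 : Integrable (fun p => (κ p * ((‖u p‖ ^ 2 : ℝ) : ℂ)).re) μ := i9.re
  have hre : (∫ p, κ p * ((‖u p‖ ^ 2 : ℝ) : ℂ) ∂μ).re =
      ∫ p, (κ p * ((‖u p‖ ^ 2 : ℝ) : ℂ)).re ∂μ := (integral_re i9).symm
  rw [hre, ← integral_const_mul]
  have i10 : Integrable (fun p => c * ‖u p‖ ^ 2) μ :=
    (continuous_const.mul (hu.continuous.norm.pow 2)).integrable_of_hasCompactSupport
      (HasCompactSupport.mul_left hcu)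
  refine le_trans (integral_mono i10 i11 ?_) (le_add_of_nonneg_left hn)
  intro p
  simp only [Complex.re_mul_ofReal]
  by_cases hp : u p = 0
  · simp [hp]
  exact mul_le_mul_of_nonneg_right (hκ' p hp) (by positivity)

end Carleman

/-! ### Unique continuation from the Carleman estimate -/

section UniqueContinuation

open MeasureTheory

/-- Since `dbarOp` is a derivation, multiplication by e^{τφ} conjugates it into D̄ - τ D̄φ; this is
where the factor `a` of the Carleman inequality comes from. -/
theorem dbarOp_exp_weight {E : Type*} [NormedAddCommGroup E] [NormedSpace ℝ E]
    {X Y S : E} (b : E → ℂ) {φ : E → ℝ} (hφ : ContDiff ℝ ∞ φ) (τ : ℝ) (p : E) :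
    dbarOp X Y S b (fun p => ((Real.exp (τ * φ p) : ℝ) : ℂ)) p =
      τ * dbarOp X Y S b (fun p => (φ p : ℂ)) p * ((Real.exp (τ * φ p) : ℝ) : ℂ) := by
  have hs : ContDiff ℝ ∞ (fun p => Real.exp (τ * φ p)) := (contDiff_const.mul hφ).exp
  have h : ∀ v, dirDeriv v (fun p => ((Real.exp (τ * φ p) : ℝ) : ℂ)) p =
      τ * dirDeriv v (fun p => (φ p : ℂ)) p * ((Real.exp (τ * φ p) : ℝ) : ℂ) := by
    intro v
    rw [dirDeriv_ofReal hs, dirDeriv_ofReal hφ]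
    have := (((hφ.differentiableAt_of_smooth p).hasFDerivAt.const_mul τ).exp).fderiv
    simp only [dirDeriv, this]
    simp
    ring
  simp only [dbarOp, h]
  ring

variable {E : Type*} [NormedAddCommGroup E] [NormedSpace ℝ E] [FiniteDimensional ℝ E]
variable {X Y S : E} {b f : E → ℂ}

/-- Unique continuation at `0` for solutions of `|dbarOp b f| ≤ C |f|` across a level set
of a weight `φ` which is strictly subharmonic along the leaves. -/
theorem eventually_eq_zero_of_dbarOp_le (hb : ContDiff ℝ ∞ b) (hf : ContDiff ℝ ∞ f)
    {φ : E → ℝ} (hφ : ContDiff ℝ ∞ φ) {ε C : ℝ} (hε : 0 < ε)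
    (hB : ∀ p ∈ Metric.ball (0 : E) ε, dbarOp X Y S b b p = 0)
    (hle : ∀ p ∈ Metric.ball (0 : E) ε, ‖dbarOp X Y S b f p‖ ≤ C * ‖f p‖)
    (hφ0 : φ 0 = 0)
    (hconv : ∀ p ∈ Metric.ball (0 : E) ε,
      1 ≤ (dOp X Y S b (dbarOp X Y S b (fun p => (φ p : ℂ))) p).re)
    (hneg : ∀ p ∈ Metric.ball (0 : E) ε, f p ≠ 0 → φ p ≤ -‖p‖ ^ 2) :
    ∀ᶠ p in 𝓝 0, f p = 0 := by
  borelize E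
  let μ : Measure E := Measure.addHaar
  let χ : ContDiffBump (0 : E) := ⟨ε / 3, ε / 2, by positivity, by linarith⟩
  have sχ : ContDiff ℝ ∞ (fun p => ((χ p : ℝ) : ℂ)) := ContDiff.complex_ofReal χ.contDiff
  have cχ : HasCompactSupport (fun p => ((χ p : ℝ) : ℂ)) :=
    χ.hasCompactSupport.comp_left (g := fun x : ℝ => (x : ℂ)) (by simp)
  set g : E → ℂ := fun p => ((χ p : ℝ) : ℂ) * f p with hg
  have sg : ContDiff ℝ ∞ g := sχ.mul hf
  have cg : HasCompactSupport g := cχ.mul_right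
  have sdg : ContDiff ℝ ∞ (dbarOp X Y S b g) := hb.dbarOp sg
  have cdg : HasCompactSupport (dbarOp X Y S b g) := cg.dbarOp
  have gz : ∀ p, p ∉ Metric.ball (0 : E) ε → g =ᶠ[𝓝 p] fun _ => 0 := by
    intro p hp
    have h1 : p ∉ tsupport χ := by
      rw [χ.tsupport_eq]
      simp only [Metric.mem_closedBall, Metric.mem_ball, dist_zero_right] at hp ⊢
      change ¬ (‖p‖ ≤ ε / 2)
      linarith
    filter_upwards [notMem_tsupport_iff_eventuallyEq.1 h1] with q hq
    simp [hg, hq]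
  have gball : ∀ p, g p ≠ 0 → p ∈ Metric.ball (0 : E) ε := by
    intro p hp
    by_contra h
    exact hp (gz p h).self_of_nhds
  obtain ⟨D, hD⟩ : ∃ D, ∀ p, ‖dbarOp X Y S b g p‖ ≤ D := by
    obtain ⟨D, hD⟩ := cdg.exists_bound_of_continuous sdg.continuous
    exact ⟨D, hD⟩
  obtain ⟨M, hM⟩ : ∃ M, ∀ p ∈ Metric.closedBall (0 : E) ε,
      ‖dbarOp X Y S b (dirDeriv S b) p‖ ≤ M :=
    (isCompact_closedBall (0 : E) ε).exists_bound_of_continuousOn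
      (hb.dbarOp (hb.dirDeriv S)).continuous.continuousOn
  have hD0 : 0 ≤ D := (norm_nonneg _).trans (hD 0)
  -- The cutoff is 1 for ‖p‖ < ε/3. Beyond that radius, wherever `f` is nonzero, `hneg` gives φ ≤
  -- -κ.
  set κ : ℝ := (ε / 3) ^ 2 with hκ
  have κpos : 0 < κ := by positivity
  -- Inside the radius ε/3 the hypothesis on `f` bounds D̄g by C|g|. Further out D̄g is only bounded
  -- by `D`, but the weight makes it exponentially small. Where f = 0 in the ball, `hle` forces D̄f
  -- = 0, so D̄g = 0 as well.
  have dsmall : ∀ p, ∀ τ : ℝ, 0 ≤ τ →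
      ‖((Real.exp (τ * φ p) : ℝ) : ℂ) * dbarOp X Y S b g p‖ ^ 2 ≤
        C ^ 2 * ‖((Real.exp (τ * φ p) : ℝ) : ℂ) * g p‖ ^ 2
        + (Metric.ball (0 : E) ε).indicator (fun _ => D ^ 2 * Real.exp (-2 * τ * κ)) p := by
    intro p τ hτ
    have hex : ‖((Real.exp (τ * φ p) : ℝ) : ℂ)‖ = Real.exp (τ * φ p) := by
      rw [Complex.norm_real, Real.norm_of_nonneg (Real.exp_pos _).le]
    rw [norm_mul, norm_mul, hex, mul_pow, mul_pow]
    by_cases hp : p ∈ Metric.ball (0 : E) ε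
    · rw [Set.indicator_of_mem hp]
      have hsq : Real.exp (τ * φ p) ^ 2 = Real.exp (2 * τ * φ p) := by
        rw [← Real.exp_nat_mul]
        congr 1
        push_cast
        ring
      by_cases hfp : f p = 0
      · have h0 : dbarOp X Y S b f p = 0 := by
          have := hle p hp
          rw [hfp, norm_zero, mul_zero] at this
          exact norm_le_zero_iff.1 this
        have h1 : dbarOp X Y S b g p = 0 := by
          rw [hg, dbarOp_mul sχ hf]
          simp [hfp, h0]
        rw [h1]
        simp only [norm_zero, ne_eq, OfNat.ofNat_ne_zero, not_false_eq_true, zero_pow, mul_zero]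
        positivity
      by_cases hpn : ‖p‖ < ε / 3
      · have h1 : dbarOp X Y S b g p = dbarOp X Y S b f p := by
          have : g =ᶠ[𝓝 p] f := by
            have h2 : p ∈ Metric.ball (0 : E) χ.rIn := by simpa using hpn
            filter_upwards [Metric.isOpen_ball.mem_nhds h2] with q hq
            simp [hg, χ.one_of_mem_closedBall (Metric.ball_subset_closedBall hq)]
          simp only [dbarOp, dirDeriv, this.fderiv_eq]
        have h2 : g p = f p := by
          have h2 : p ∈ Metric.ball (0 : E) χ.rIn := by simpa using hpn
          simp [hg, χ.one_of_mem_closedBall (Metric.ball_subset_closedBall h2)]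
        rw [h1, h2]
        have h3 : ‖dbarOp X Y S b f p‖ ^ 2 ≤ C ^ 2 * ‖f p‖ ^ 2 := by
          rw [← mul_pow]
          exact pow_le_pow_left₀ (norm_nonneg _) (hle p hp) 2
        have h4 := mul_le_mul_of_nonneg_left h3 (sq_nonneg (Real.exp (τ * φ p)))
        have h5 : 0 ≤ D ^ 2 * Real.exp (-2 * τ * κ) := by positivity
        linarith
      · have h1 : φ p ≤ -κ := by
          have := hneg p hp hfp
          have h2 : κ ≤ ‖p‖ ^ 2 := pow_le_pow_left₀ (by positivity) (not_lt.1 hpn) 2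
          linarith
        have h2 : Real.exp (2 * τ * φ p) ≤ Real.exp (-2 * τ * κ) := by
          apply Real.exp_le_exp.2
          nlinarith
        have h3 : ‖dbarOp X Y S b g p‖ ^ 2 ≤ D ^ 2 := pow_le_pow_left₀ (norm_nonneg _) (hD p) 2
        have h4 : 0 ≤ C ^ 2 * (Real.exp (τ * φ p) ^ 2 * ‖g p‖ ^ 2) := by positivity
        have h5 := mul_le_mul h2 h3 (by positivity) (by positivity)
        rw [hsq] at h4 ⊢
        linarith
    · rw [Set.indicator_of_notMem hp]
      have h1 : dbarOp X Y S b g p = 0 := by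
        simp [dbarOp, dirDeriv, (gz p hp).fderiv_eq]
      rw [h1]
      simp only [norm_zero, add_zero, ne_eq, OfNat.ofNat_ne_zero, not_false_eq_true, zero_pow,
        mul_zero]
      positivity
  have csq : ∀ {q : E → ℂ}, HasCompactSupport q → HasCompactSupport (fun p => ‖q p‖ ^ 2) :=
    fun hq => hq.comp_left (g := fun z => ‖z‖ ^ 2) (by simp)
  -- The Carleman constant is 2τ - M, with `M` bounding the curvature term D̄(∂_S b). The threshold
  -- on τ leaves a factor at least 1 after the term C²∫|u|² is absorbed.
  have est : ∀ τ : ℝ, 0 ≤ τ → M + C ^ 2 + 1 ≤ 2 * τ →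
      ∫ p, ‖((Real.exp (τ * φ p) : ℝ) : ℂ) * g p‖ ^ 2 ∂μ ≤
        D ^ 2 * Real.exp (-2 * τ * κ) * μ.real (Metric.ball (0 : E) ε) := by
    intro τ hτ hτM
    have sex : ContDiff ℝ ∞ (fun p => ((Real.exp (τ * φ p) : ℝ) : ℂ)) :=
      ContDiff.complex_ofReal (contDiff_const.mul hφ).exp
    have sφ : ContDiff ℝ ∞ (fun p => (φ p : ℂ)) := hφ.complex_ofReal
    set u : E → ℂ := fun p => ((Real.exp (τ * φ p) : ℝ) : ℂ) * g p with hu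
    have su : ContDiff ℝ ∞ u := sex.mul sg
    have cu : HasCompactSupport u := cg.mul_left
    have ub : ∀ p, u p ≠ 0 → p ∈ Metric.ball (0 : E) ε := fun p hp =>
      gball p (right_ne_zero_of_mul hp)
    have car := carleman_inequality (X := X) (Y := Y) (S := S) μ hb su cu
      (a := fun p => τ * dbarOp X Y S b (fun p => (φ p : ℂ)) p)
      (contDiff_const.mul (hb.dbarOp sφ)) (fun p hp => hB p (ub p hp)) (c := 2 * τ - M) (by
        intro p hp
        rw [dOp_const_mul (hb.dbarOp sφ), Complex.re_ofReal_mul]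
        have h1 := hconv p (ub p hp)
        have h2 := (abs_le.1 ((Complex.abs_re_le_norm _).trans
          (hM p (Metric.ball_subset_closedBall (ub p hp))))).1
        nlinarith)
    have hdu : ∀ p, dbarOp X Y S b u p - τ * dbarOp X Y S b (fun p => (φ p : ℂ)) p * u p =
        ((Real.exp (τ * φ p) : ℝ) : ℂ) * dbarOp X Y S b g p := by
      intro p
      rw [hu, dbarOp_mul sex sg]
      dsimp only
      rw [dbarOp_exp_weight b hφ]
      ring
    simp only [hdu] at car
    have i1 : Integrable (fun p => ‖u p‖ ^ 2) μ :=
      (su.continuous.norm.pow 2).integrable_of_hasCompactSupport (csq cu)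
    have i2 : Integrable (fun p => ‖((Real.exp (τ * φ p) : ℝ) : ℂ) * dbarOp X Y S b g p‖ ^ 2) μ :=
      ((sex.mul sdg).continuous.norm.pow 2).integrable_of_hasCompactSupport (csq cdg.mul_left)
    have i3 : Integrable ((Metric.ball (0 : E) ε).indicator
        (fun _ => D ^ 2 * Real.exp (-2 * τ * κ))) μ :=
      (integrable_indicator_iff measurableSet_ball).2
        (integrableOn_const measure_ball_lt_top.ne)
    have h2 := integral_mono i2 ((i1.const_mul (C ^ 2)).add i3) (fun p => dsmall p τ hτ)
    have h3 : ∫ p, (C ^ 2 * ‖u p‖ ^ 2 + (Metric.ball (0 : E) ε).indicator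
        (fun _ => D ^ 2 * Real.exp (-2 * τ * κ)) p) ∂μ = C ^ 2 * ∫ p, ‖u p‖ ^ 2 ∂μ
        + D ^ 2 * Real.exp (-2 * τ * κ) * μ.real (Metric.ball (0 : E) ε) := by
      rw [integral_add (i1.const_mul _) i3, integral_const_mul,
        integral_indicator measurableSet_ball, setIntegral_const, smul_eq_mul]
      ring
    have h4 := car.trans (h2.trans_eq h3)
    have h5 : 0 ≤ ∫ p, ‖u p‖ ^ 2 ∂μ := integral_nonneg fun p => by positivity
    nlinarith
  -- Where φ > -κ/2 the squared weight is at least e^{-τκ}. A nonzero value of `f` there would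
  -- contradict the upper bound of size e^{-2τκ} as τ tends to infinity.
  have hopen : ∀ᶠ p in 𝓝 (0 : E), -(κ / 2) < φ p ∧ p ∈ Metric.ball (0 : E) (ε / 3) := by
    refine (hφ.continuous.continuousAt.eventually (lt_mem_nhds ?_)).and
      (Metric.ball_mem_nhds _ (by positivity))
    rw [hφ0]
    linarith
  refine hopen.eventually_nhds.mono fun p0 hp0 => ?_
  by_contra hfp
  obtain ⟨δ, δpos, hδ⟩ := Metric.eventually_nhds_iff_ball.1 hp0
  let ψ : ContDiffBump p0 := ⟨δ / 3, δ / 2, by positivity, by linarith⟩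
  have cont : Continuous (fun p => ψ p * ‖f p‖ ^ 2) :=
    ψ.continuous.mul (hf.continuous.norm.pow 2)
  have comp : HasCompactSupport (fun p => ψ p * ‖f p‖ ^ 2) := ψ.hasCompactSupport.mul_right
  have mpos : 0 < ∫ p, ψ p * ‖f p‖ ^ 2 ∂μ := by
    refine cont.integral_pos_of_hasCompactSupport_nonneg_nonzero comp
      (fun p => mul_nonneg ψ.nonneg (by positivity)) (x := p0) ?_
    have : ψ p0 = 1 := ψ.one_of_mem_closedBall (by simp [ψ.rIn_pos.le])
    simp [this, hfp]
  have lower : ∀ τ : ℝ, 0 ≤ τ → Real.exp (-τ * κ) * ∫ p, ψ p * ‖f p‖ ^ 2 ∂μ ≤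
      ∫ p, ‖((Real.exp (τ * φ p) : ℝ) : ℂ) * g p‖ ^ 2 ∂μ := by
    intro τ hτ
    rw [← integral_const_mul]
    have sex : ContDiff ℝ ∞ (fun p => ((Real.exp (τ * φ p) : ℝ) : ℂ)) :=
      ContDiff.complex_ofReal (contDiff_const.mul hφ).exp
    have cu : HasCompactSupport (fun p => ((Real.exp (τ * φ p) : ℝ) : ℂ) * g p) := cg.mul_left
    have i1 : Integrable (fun p => ‖((Real.exp (τ * φ p) : ℝ) : ℂ) * g p‖ ^ 2) μ :=
      ((sex.mul sg).continuous.norm.pow 2).integrable_of_hasCompactSupport (csq cu)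
    refine integral_mono ((cont.integrable_of_hasCompactSupport comp).const_mul _) i1 ?_
    intro p
    dsimp only
    by_cases hp : p ∈ Metric.ball p0 δ
    · obtain ⟨h1, h2⟩ := hδ p hp
      have h3 : g p = f p := by
        simp [hg, χ.one_of_mem_closedBall (Metric.ball_subset_closedBall h2)]
      have hex : ‖((Real.exp (τ * φ p) : ℝ) : ℂ)‖ = Real.exp (τ * φ p) := by
        rw [Complex.norm_real, Real.norm_of_nonneg (Real.exp_pos _).le]
      rw [h3, norm_mul, hex, mul_pow, ← Real.exp_nat_mul]
      have h4 : Real.exp (-τ * κ) ≤ Real.exp ((2 : ℕ) * (τ * φ p)) := by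
        apply Real.exp_le_exp.2
        push_cast
        nlinarith
      have h5 : ψ p * ‖f p‖ ^ 2 ≤ ‖f p‖ ^ 2 :=
        mul_le_of_le_one_left (by positivity) ψ.le_one
      exact mul_le_mul h4 h5 (mul_nonneg ψ.nonneg (by positivity)) (by positivity)
    · have : ψ p = 0 := ψ.zero_of_le_dist (by
        simp only [Metric.mem_ball, not_lt] at hp
        change δ / 2 ≤ _
        linarith)
      rw [this]
      simp only [zero_mul, mul_zero]
      positivity
  have lim : Filter.Tendsto (fun τ : ℝ => D ^ 2 * μ.real (Metric.ball (0 : E) ε) *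
      Real.exp (-(κ * τ))) Filter.atTop (𝓝 0) := by
    have h1 : Filter.Tendsto (fun τ : ℝ => κ * τ) Filter.atTop Filter.atTop :=
      Filter.tendsto_id.const_mul_atTop κpos
    simpa using (Real.tendsto_exp_neg_atTop_nhds_zero.comp h1).const_mul
      (D ^ 2 * μ.real (Metric.ball (0 : E) ε))
  refine absurd (ge_of_tendsto lim ?_) (not_le.2 mpos)
  filter_upwards [Filter.eventually_ge_atTop 0,
    Filter.eventually_ge_atTop ((M + C ^ 2 + 1) / 2)] with τ h0 h1
  have h2 := (lower τ h0).trans (est τ h0 (by linarith))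
  have h3 : Real.exp (-2 * τ * κ) = Real.exp (-τ * κ) * Real.exp (-(κ * τ)) := by
    rw [← Real.exp_add]
    congr 1
    ring
  rw [h3] at h2
  have h4 := Real.exp_pos (-τ * κ)
  refine le_of_mul_le_mul_left (h2.trans_eq ?_) h4
  ring

end UniqueContinuation

/-! ### Hypersurfaces as graphs over Im p_k = 0 -/

section Graph

/-- Multiplication by a bump function. Graph functions may thus be taken smooth on all of ℂ^N, which
spares the operators and integrals any domain. -/
theorem exists_contDiff_eventuallyEq {E : Type*} [NormedAddCommGroup E] [NormedSpace ℝ E]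
    [FiniteDimensional ℝ E] {f : E → ℝ} {U : Set E} {x : E} (hU : U ∈ 𝓝 x)
    (hf : ContDiffOn ℝ ∞ f U) : ∃ g : E → ℝ, ContDiff ℝ ∞ g ∧ g =ᶠ[𝓝 x] f := by
  obtain ⟨ε, εpos, hε⟩ := Metric.mem_nhds_iff.1 hU
  let χ : ContDiffBump x := ⟨ε / 3, ε / 2, by positivity, by linarith⟩
  refine ⟨fun p => χ p * f p, contDiff_iff_contDiffAt.2 fun p => ?_, ?_⟩
  · by_cases hp : p ∈ Metric.ball x ε
    · exact χ.contDiff.contDiffAt.mul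
        ((hf.mono hε).contDiffAt (Metric.isOpen_ball.mem_nhds hp))
    · have h1 : p ∉ tsupport χ := by
        rw [χ.tsupport_eq]
        simp only [Metric.mem_closedBall, Metric.mem_ball] at hp ⊢
        change ¬ (dist p x ≤ ε / 2)
        linarith
      refine (contDiffAt_const (c := (0 : ℝ))).congr_of_eventuallyEq ?_
      filter_upwards [notMem_tsupport_iff_eventuallyEq.1 h1] with q hq
      simp [hq]
  · filter_upwards [χ.eventuallyEq_one] with q hq
    simp [hq]

variable {N : ℕ} (k : Fin N)

/-- The vector of `ℂ^N` with `k`-th coordinate `i` and other coordinates `0`. -/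
noncomputable abbrev imDir : Fin N → ℂ := Pi.single k Complex.I

/-- The vector of `ℂ^N` with `k`-th coordinate `1` and other coordinates `0`. -/
noncomputable abbrev reDir : Fin N → ℂ := Pi.single k 1

/-- The projection of `ℂ^N` removing the imaginary part of the `k`-th coordinate. -/
noncomputable def flatten : (Fin N → ℂ) →L[ℝ] (Fin N → ℂ) :=
  ContinuousLinearMap.id ℝ _ - (Complex.imCLM.comp
    (ContinuousLinearMap.proj (R := ℝ) (φ := fun _ : Fin N => ℂ) k)).smulRight
      (imDir k)

theorem flatten_apply (p : Fin N → ℂ) :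
    flatten k p = p - (p k).im • imDir k := rfl

theorem flatten_imDir : flatten k (imDir k) = 0 := by
  simp [flatten_apply]

theorem flatten_apply_self_im (p : Fin N → ℂ) : (flatten k p k).im = 0 := by
  simp [flatten_apply]

theorem flatten_apply_of_ne (p : Fin N → ℂ) {i : Fin N} (h : i ≠ k) : flatten k p i = p i := by
  simp [flatten_apply, h]

theorem flatten_flatten (p : Fin N → ℂ) : flatten k (flatten k p) = flatten k p := by
  rw [flatten_apply k (flatten k p), flatten_apply_self_im]
  simp

theorem flatten_add_smul (p : Fin N → ℂ) (t : ℝ) :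
    flatten k (p + t • imDir k) = flatten k p := by
  simp [flatten_imDir]

/-- Smooth real functions on `ℂ^N` which do not depend on the imaginary part of the `k`-th
coordinate, and hence define the hypersurface `Im p_k = r p`. -/
structure IsGraphFun (r : (Fin N → ℂ) → ℝ) : Prop where
  smooth : ContDiff ℝ ∞ r
  flat : ∀ p, r (flatten k p) = r p

/-- The point of the graph of `r` lying over `p`. -/
noncomputable def graphPt (r : (Fin N → ℂ) → ℝ) (p : Fin N → ℂ) : Fin N → ℂ :=
  flatten k p + r p • imDir k

variable {k}

theorem flatten_graphPt (r : (Fin N → ℂ) → ℝ) (p : Fin N → ℂ) :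
    flatten k (graphPt k r p) = flatten k p := by
  rw [graphPt, flatten_add_smul, flatten_flatten]

theorem graphPt_apply_im (r : (Fin N → ℂ) → ℝ) (p : Fin N → ℂ) :
    (graphPt k r p k).im = r p := by
  simp [graphPt, flatten_apply_self_im]

theorem graphPt_apply_of_ne (r : (Fin N → ℂ) → ℝ) (p : Fin N → ℂ) {i : Fin N} (h : i ≠ k) :
    graphPt k r p i = p i := by
  simp [graphPt, flatten_apply_of_ne, h]

theorem graphPt_eq_self {r : (Fin N → ℂ) → ℝ} {p : Fin N → ℂ} (h : (p k).im = r p) :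
    graphPt k r p = p := by
  rw [graphPt, flatten_apply, h]
  simp

theorem graphPt_eq_add (r : (Fin N → ℂ) → ℝ) (p : Fin N → ℂ) :
    graphPt k r p = p + (r p - (p k).im) • imDir k := by
  rw [graphPt, flatten_apply, sub_smul]
  abel

namespace IsGraphFun

variable {r : (Fin N → ℂ) → ℝ}

theorem apply_graphPt (hr : IsGraphFun k r) (s : (Fin N → ℂ) → ℝ) (p : Fin N → ℂ) :
    r (graphPt k s p) = r p := by
  rw [← hr.flat, flatten_graphPt, hr.flat]

theorem contDiff_graphPt (hr : IsGraphFun k r) : ContDiff ℝ ∞ (graphPt k r) :=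
  (flatten k).contDiff.add (hr.smooth.smul contDiff_const)

theorem graphPt_zero (h0 : r 0 = 0) : graphPt k r 0 = 0 := by
  simp [graphPt, h0]

theorem tendsto_graphPt (hr : IsGraphFun k r) (h0 : r 0 = 0) :
    Filter.Tendsto (graphPt k r) (𝓝 0) (𝓝 0) := by
  have := hr.contDiff_graphPt.continuous.tendsto 0
  rwa [graphPt_zero h0] at this

theorem fderiv_imDir (hr : IsGraphFun k r) (p : Fin N → ℂ) :
    fderiv ℝ r p (imDir k) = 0 := by
  refine dirDeriv_eq_zero_of_eventually_line (c := r p) (hr.smooth.differentiableAt_of_smooth p) ?_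
  refine Filter.Eventually.of_forall fun t => ?_
  rw [← hr.flat, flatten_add_smul, hr.flat]

theorem hasFDerivAt_graphPt (hr : IsGraphFun k r)
    (p : Fin N → ℂ) :
    HasFDerivAt (graphPt k r) (flatten k + (fderiv ℝ r p).smulRight (imDir k)) p :=
  (flatten k).hasFDerivAt.add
    ((hr.smooth.differentiableAt_of_smooth p).hasFDerivAt.smul_const (imDir k))

end IsGraphFun

/-- The implicit function theorem: Φ replaces Im p_k by ρ(p) and keeps the other coordinates, so it
is locally invertible, and `r` is the k-th imaginary part of its inverse on the hyperplane Im p_k =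
0. -/
theorem exists_graph_of_fderiv_ne_zero {ρ : (Fin N → ℂ) → ℝ} {O : Set (Fin N → ℂ)}
    (hO : IsOpen O) (h0O : (0 : Fin N → ℂ) ∈ O) (hρ : ContDiffOn ℝ ∞ ρ O) (h0 : ρ 0 = 0)
    (hk : fderiv ℝ ρ 0 (imDir k) ≠ 0) :
    ∃ r, IsGraphFun k r ∧ r 0 = 0 ∧ ∀ᶠ p in 𝓝 (0 : Fin N → ℂ), (ρ p = 0 ↔ (p k).im = r p) := by
  set J : Fin N → ℂ := imDir k with hJ
  set Φ : (Fin N → ℂ) → (Fin N → ℂ) := fun p => flatten k p + ρ p • J with hΦ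
  have sΦ : ContDiffOn ℝ ∞ Φ O := (flatten k).contDiff.contDiffOn.add (hρ.smul contDiffOn_const)
  have fΦ : ∀ p, flatten k (Φ p) = flatten k p := fun p => by
    rw [hΦ]
    simp only [hJ, flatten_add_smul, flatten_flatten]
  have hder : ∀ p ∈ O, fderiv ℝ ρ p J ≠ 0 →
      ∃ A : (Fin N → ℂ) ≃L[ℝ] (Fin N → ℂ), HasFDerivAt Φ (A : (Fin N → ℂ) →L[ℝ] (Fin N → ℂ)) p := by
    intro p hp hne
    have hd : HasFDerivAt ρ (fderiv ℝ ρ p) p :=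
      ((hρ.contDiffAt (hO.mem_nhds hp)).differentiableAt (by simp)).hasFDerivAt
    have hA : HasFDerivAt Φ (flatten k + (fderiv ℝ ρ p).smulRight J) p :=
      (flatten k).hasFDerivAt.add (hd.smul_const J)
    set A := flatten k + (fderiv ℝ ρ p).smulRight J with hAdef
    have inj : Function.Injective A := by
      rw [injective_iff_map_eq_zero]
      intro v hv
      have h1 : flatten k v + fderiv ℝ ρ p v • J = 0 := hv
      have h2 : flatten k v = 0 := by
        have := congrArg (flatten k) h1
        rwa [hJ, flatten_add_smul, flatten_flatten, map_zero] at this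
      have h3 : v = (v k).im • J := by
        rw [flatten_apply] at h2
        exact sub_eq_zero.1 h2
      rw [h2, zero_add] at h1
      have h4 : fderiv ℝ ρ p v = 0 := by
        have := congrFun h1 k
        simpa [hJ] using this
      rw [h3, map_smul, smul_eq_mul] at h4
      rw [h3, (mul_eq_zero.1 h4).resolve_right hne, zero_smul]
    let A' := (LinearEquiv.ofInjectiveEndo (A : (Fin N → ℂ) →ₗ[ℝ] (Fin N → ℂ)) inj)
    refine ⟨A'.toContinuousLinearEquiv, ?_⟩
    have hco : (A'.toContinuousLinearEquiv : (Fin N → ℂ) →L[ℝ] (Fin N → ℂ)) = A := by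
      ext v : 1
      rfl
    rw [hco]
    exact hA
  obtain ⟨A0, hA0⟩ := hder 0 h0O hk
  let e := (sΦ.contDiffAt (hO.mem_nhds h0O)).toOpenPartialHomeomorph Φ hA0 (by simp)
  have ecoe : ∀ p, e p = Φ p := fun p => rfl
  have h0e : (0 : Fin N → ℂ) ∈ e.source :=
    (sΦ.contDiffAt (hO.mem_nhds h0O)).mem_toOpenPartialHomeomorph_source hA0 (by simp)
  have hΦ0 : Φ 0 = 0 := by simp [hΦ, h0]
  have cdρ : ContinuousOn (fun p => fderiv ℝ ρ p J) O :=
    (hρ.continuousOn_fderiv_of_isOpen hO (by simp)).clm_apply continuousOn_const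
  -- Smoothness of the inverse is obtained point by point, so the derivative of Φ must be invertible
  -- on a whole neighbourhood.
  set O' : Set (Fin N → ℂ) := O ∩ (fun p => fderiv ℝ ρ p J) ⁻¹' {0}ᶜ with hO'
  have oO' : IsOpen O' := cdρ.isOpen_inter_preimage hO isOpen_compl_singleton
  have h0O' : (0 : Fin N → ℂ) ∈ O' := ⟨h0O, hk⟩
  set T : Set (Fin N → ℂ) := e.target ∩ e.symm ⁻¹' O' with hT
  have oT : IsOpen T := e.isOpen_inter_preimage_symm oO'
  have h0t : (0 : Fin N → ℂ) ∈ e.target := by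
    have := e.map_source h0e
    rwa [ecoe, hΦ0] at this
  have hs0 : e.symm 0 = 0 := by
    have := e.left_inv h0e
    rwa [ecoe, hΦ0] at this
  have h0T : (0 : Fin N → ℂ) ∈ T := ⟨h0t, by simpa [hs0] using h0O'⟩
  have sΨ : ContDiffOn ℝ ∞ e.symm T := by
    intro q hq
    obtain ⟨A, hA⟩ := hder _ hq.2.1 hq.2.2
    exact (e.contDiffAt_symm hq.1 hA (sΦ.contDiffAt (hO.mem_nhds hq.2.1))).contDiffWithinAt
  obtain ⟨g, sg, hg⟩ := exists_contDiff_eventuallyEq (f := fun q => (e.symm q k).im)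
    (oT.mem_nhds h0T) (by
      have h1 : ContDiff ℝ ∞ (fun q : Fin N → ℂ => (q k).im) :=
        Complex.imCLM.contDiff.comp (contDiff_apply ℝ ℂ k)
      exact h1.comp_contDiffOn sΨ)
  have hfl : Filter.Tendsto (flatten k) (𝓝 0) (𝓝 0) := by
    simpa using (flatten k).continuous.tendsto 0
  refine ⟨fun p => g (flatten k p), ⟨sg.comp (flatten k).contDiff, fun p => by
    rw [flatten_flatten]⟩, ?_, ?_⟩
  · simp only [map_zero]
    rw [hg.self_of_nhds]
    simp [hs0]
  · filter_upwards [hfl.eventually hg, e.open_source.mem_nhds h0e,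
      hfl.eventually (e.open_target.mem_nhds h0t)] with p h1 h2 h3
    rw [h1]
    constructor
    · intro h
      have : Φ p = flatten k p := by simp [hΦ, h]
      rw [← this, ← ecoe, e.left_inv h2]
    · intro h
      have h4 : Φ (e.symm (flatten k p)) = flatten k p := by
        rw [← ecoe, e.right_inv h3]
      have h5 : flatten k (e.symm (flatten k p)) = flatten k p := by
        rw [← fΦ, h4, flatten_flatten]
      have h6 : e.symm (flatten k p) = p := by
        rw [flatten_apply k (e.symm _), ← h] at h5
        exact sub_left_injective (h5.trans (flatten_apply k p))
      rw [h6] at h4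
      have := congrArg (fun q => (q k).im) h4
      simpa [hΦ, hJ, flatten_apply_self_im] using this

theorem IsSmoothChart.exists_hasFDerivAt
    {φ : OpenPartialHomeomorph (Fin N → ℂ) (Fin (2 * N) → ℝ)} (hφ : IsSmoothChart φ)
    {p : Fin N → ℂ} (hp : p ∈ φ.source) :
    ∃ A : (Fin N → ℂ) ≃L[ℝ] (Fin (2 * N) → ℝ),
      HasFDerivAt φ (A : (Fin N → ℂ) →L[ℝ] (Fin (2 * N) → ℝ)) p ∧
      HasFDerivAt φ.symm (A.symm : (Fin (2 * N) → ℝ) →L[ℝ] (Fin N → ℂ)) (φ p) := by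
  have h1 := ((hφ.1.contDiffAt (φ.open_source.mem_nhds hp)).differentiableAt (by simp)).hasFDerivAt
  have hq := φ.map_source hp
  have h2 := ((hφ.2.contDiffAt (φ.open_target.mem_nhds hq)).differentiableAt (by simp)).hasFDerivAt
  have e1 : HasFDerivAt (φ.symm ∘ φ) ((fderiv ℝ φ.symm (φ p)).comp (fderiv ℝ φ p)) p :=
    h2.comp p h1
  have e1' : (fderiv ℝ φ.symm (φ p)).comp (fderiv ℝ φ p) = ContinuousLinearMap.id ℝ _ := by
    refine e1.unique ((hasFDerivAt_id p).congr_of_eventuallyEq ?_)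
    filter_upwards [φ.open_source.mem_nhds hp] with q hq
    exact φ.left_inv hq
  have h1' : HasFDerivAt φ (fderiv ℝ φ p) (φ.symm (φ p)) := by rwa [φ.left_inv hp]
  have e2 : HasFDerivAt (φ ∘ φ.symm) ((fderiv ℝ φ p).comp (fderiv ℝ φ.symm (φ p))) (φ p) :=
    h1'.comp (φ p) h2
  have e2' : (fderiv ℝ φ p).comp (fderiv ℝ φ.symm (φ p)) = ContinuousLinearMap.id ℝ _ := by
    refine e2.unique ((hasFDerivAt_id _).congr_of_eventuallyEq ?_)
    filter_upwards [φ.open_target.mem_nhds hq] with q hq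
    exact φ.right_inv hq
  exact ⟨ContinuousLinearEquiv.equivOfInverse _ _ (fun v => congrArg (fun A => A v) e1')
    (fun v => congrArg (fun A => A v) e2'), h1, h2⟩

end Graph

/-! ### Complex tangent spaces and integrability of a Levi-flat graph -/

section Tangent

variable {N : ℕ} {k : Fin N} {r : (Fin N → ℂ) → ℝ} {S : Set (Fin N → ℂ)} {p : Fin N → ℂ}

/-- A curve in the graph satisfies the linearised equation. Conversely the line p + t v lifts to the
graph by `graphPt`, with velocity `v` when `v` satisfies that equation. -/
theorem IsGraphFun.mem_realTangent_iff (hr : IsGraphFun k r)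
    (hS : ∀ᶠ q in 𝓝 p, (q ∈ S ↔ (q k).im = r q)) (hp : p ∈ S) (v : Fin N → ℂ) :
    v ∈ realTangent S p ↔ (v k).im = fderiv ℝ r p v := by
  constructor
  · rintro ⟨γ, h0, hγ, hmem⟩
    have h1 : HasDerivAt (fun t => (γ t k).im) (v k).im 0 := by
      have h2 : HasDerivAt (fun t => γ t k) (v k) 0 := (hasDerivAt_pi.1 hγ) k
      exact Complex.imCLM.hasFDerivAt.comp_hasDerivAt (0 : ℝ) h2
    have h2 : HasDerivAt (fun t => r (γ t)) (fderiv ℝ r p v) 0 := by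
      have := (hr.smooth.differentiableAt_of_smooth (γ 0)).hasFDerivAt.comp_hasDerivAt (0 : ℝ) hγ
      rwa [h0] at this
    refine h1.unique (h2.congr_of_eventuallyEq ?_)
    have hc : Filter.Tendsto γ (𝓝 0) (𝓝 p) := h0 ▸ hγ.continuousAt
    filter_upwards [hc.eventually hS, hmem] with t ht htm
    exact ht.1 htm
  · intro hv
    have hpr : (p k).im = r p := hS.self_of_nhds.1 hp
    have hline : HasDerivAt (fun t : ℝ => p + t • v) v 0 := by
      simpa using ((hasDerivAt_id (0 : ℝ)).smul_const v).const_add p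
    have hpt : p + (0 : ℝ) • v = p := by simp
    have hd : HasDerivAt (fun t : ℝ => graphPt k r (p + t • v)) v 0 := by
      have h2 : HasFDerivAt (graphPt k r) (flatten k + (fderiv ℝ r p).smulRight (imDir k))
          (p + (0 : ℝ) • v) := by
        rw [hpt]
        exact hr.hasFDerivAt_graphPt p
      have h3 := h2.comp_hasDerivAt (0 : ℝ) hline
      have h4 : (flatten k + (fderiv ℝ r p).smulRight (imDir k)) v = v := by
        change flatten k v + fderiv ℝ r p v • imDir k = v
        rw [← hv, flatten_apply]
        abel
      rw [h4] at h3
      exact h3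
    refine ⟨fun t => graphPt k r (p + t • v), ?_, hd, ?_⟩
    · simp only [hpt]
      exact graphPt_eq_self hpr
    · have hc : Filter.Tendsto (fun t : ℝ => graphPt k r (p + t • v)) (𝓝 0) (𝓝 p) := by
        have := hd.continuousAt.tendsto
        simp only [hpt] at this
        rwa [graphPt_eq_self hpr] at this
      filter_upwards [hc.eventually hS] with t ht
      exact ht.2 (by rw [graphPt_apply_im, hr.apply_graphPt])

/-- The complex linear form `2 ∂ρ`, for `ρ p = r p - Im p_k`. -/
noncomputable def leviForm (k : Fin N) (r : (Fin N → ℂ) → ℝ) (p u : Fin N → ℂ) : ℂ :=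
  fderiv ℝ r p u - Complex.I * fderiv ℝ r p (Complex.I • u) + Complex.I * u k

theorem leviForm_add (u v : Fin N → ℂ) :
    leviForm k r p (u + v) = leviForm k r p u + leviForm k r p v := by
  simp only [leviForm, smul_add, map_add, Complex.ofReal_add, Pi.add_apply]
  ring

/-- Split `c • u` into real multiples of `u` and i u; the combination dr(u) - i dr(iu) is complex
linear. Slopes are therefore complex linear in the direction. -/
theorem leviForm_smul (c : ℂ) (u : Fin N → ℂ) :
    leviForm k r p (c • u) = c * leviForm k r p u := by
  have h1 : c • u = c.re • u + c.im • (Complex.I • u) := by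
    funext i
    simp only [Pi.smul_apply, Pi.add_apply, smul_eq_mul, Complex.real_smul]
    nth_rewrite 1 [← Complex.re_add_im c]
    ring
  have h2 : Complex.I • (c • u) = c.re • (Complex.I • u) - c.im • u := by
    rw [h1]
    funext i
    simp only [Pi.smul_apply, Pi.add_apply, Pi.sub_apply, smul_eq_mul, Complex.real_smul]
    linear_combination (c.im : ℂ) * u i * Complex.I_mul_I
  have h3 : (c • u) k = c * u k := rfl
  rw [leviForm, leviForm, h2, h3, h1]
  simp only [map_add, map_sub, map_smul, smul_eq_mul, Complex.ofReal_add, Complex.ofReal_sub,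
    Complex.ofReal_mul]
  linear_combination (c.im : ℂ) * fderiv ℝ r p (Complex.I • u) * Complex.I_mul_I
    + (fderiv ℝ r p u - Complex.I * fderiv ℝ r p (Complex.I • u)) * Complex.re_add_im c

/-- The real part of the form vanishes when `v` is tangent, the imaginary part when i v is. -/
theorem IsGraphFun.mem_complexTangent_iff (hr : IsGraphFun k r)
    (hS : ∀ᶠ q in 𝓝 p, (q ∈ S ↔ (q k).im = r q)) (hp : p ∈ S) (v : Fin N → ℂ) :
    v ∈ complexTangent S p ↔ leviForm k r p v = 0 := by
  have key : v ∈ (fun v : Fin N → ℂ => Complex.I • v) '' realTangent S p ↔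
      (v k).re = fderiv ℝ r p (Complex.I • v) := by
    have h1 : ∀ w : Fin N → ℂ, Complex.I • (-(Complex.I • w)) = w := fun w => by
      rw [smul_neg, smul_smul, Complex.I_mul_I]
      simp
    have h2 : -(Complex.I • v) ∈ realTangent S p ↔ (v k).re = fderiv ℝ r p (Complex.I • v) := by
      rw [hr.mem_realTangent_iff hS hp, map_neg]
      simp
    rw [← h2]
    constructor
    · rintro ⟨w, hw, rfl⟩
      have : -(Complex.I • (Complex.I • w)) = w := by rw [← smul_neg, h1]
      rwa [this]
    · exact fun h => ⟨_, h, h1 v⟩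
  rw [complexTangent, Set.mem_inter_iff, key, hr.mem_realTangent_iff hS hp, leviForm,
    Complex.ext_iff]
  simp
  constructor
  · rintro ⟨h1, h2⟩
    constructor <;> linarith
  · rintro ⟨h1, h2⟩
    constructor <;> linarith

theorem realTangent_congr {S S' : Set (Fin N → ℂ)} (h : ∀ᶠ q in 𝓝 p, (q ∈ S ↔ q ∈ S')) :
    realTangent S p = realTangent S' p := by
  have aux : ∀ {S S' : Set (Fin N → ℂ)}, (∀ᶠ q in 𝓝 p, (q ∈ S ↔ q ∈ S')) →
      realTangent S p ⊆ realTangent S' p := by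
    rintro S S' h v ⟨γ, h0, hγ, hm⟩
    refine ⟨γ, h0, hγ, ?_⟩
    have hc : Filter.Tendsto γ (𝓝 0) (𝓝 p) := h0 ▸ hγ.continuousAt
    filter_upwards [hc.eventually h, hm] with t h1 h2 using h1.1 h2
  exact (aux h).antisymm (aux (h.mono fun q hq => hq.symm))

theorem complexTangent_congr {S S' : Set (Fin N → ℂ)} (h : ∀ᶠ q in 𝓝 p, (q ∈ S ↔ q ∈ S')) :
    complexTangent S p = complexTangent S' p := by
  rw [complexTangent, complexTangent, realTangent_congr h]

/-- Levi-flatness is a local property. -/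
theorem IsLeviFlat.lieBracket_mem_of_eqOn {S S' O : Set (Fin N → ℂ)} (hS : IsLeviFlat S)
    (hO : IsOpen O) (h : ∀ q ∈ O, (q ∈ S ↔ q ∈ S')) {U : Set (Fin N → ℂ)}
    {X Y : (Fin N → ℂ) → (Fin N → ℂ)} (hU : IsOpen U) (hX : ContDiffOn ℝ ∞ X U)
    (hY : ContDiffOn ℝ ∞ Y U) (hXt : ∀ p ∈ S' ∩ U, X p ∈ complexTangent S' p)
    (hYt : ∀ p ∈ S' ∩ U, Y p ∈ complexTangent S' p) (hp : p ∈ S' ∩ U) (hpO : p ∈ O) :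
    VectorField.lieBracket ℝ X Y p ∈ complexTangent S' p := by
  have hc : ∀ q ∈ O, complexTangent S q = complexTangent S' q := fun q hq =>
    complexTangent_congr (by filter_upwards [hO.mem_nhds hq] with q' hq' using h q' hq')
  have hmem : ∀ q ∈ S ∩ (U ∩ O), q ∈ S' ∩ U := fun q hq => ⟨(h q hq.2.2).1 hq.1, hq.2.1⟩
  rw [← hc p hpO]
  refine hS (U ∩ O) X Y (hU.inter hO) (hX.mono Set.inter_subset_left)
    (hY.mono Set.inter_subset_left) (fun q hq => ?_) (fun q hq => ?_) p
    ⟨(h p hpO).2 hp.1, hp.2, hpO⟩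
  · rw [hc q hq.2.2]
    exact hXt q (hmem q hq)
  · rw [hc q hq.2.2]
    exact hYt q (hmem q hq)

theorem IsGraphFun.leviForm_reDir (hr : IsGraphFun k r) :
    leviForm k r p (reDir k) = fderiv ℝ r p (reDir k) + Complex.I := by
  have : Complex.I • reDir k = imDir k := by
    funext i
    by_cases h : i = k
    · subst h; simp
    · simp [h]
  rw [leviForm, this, hr.fderiv_imDir]
  simp

theorem IsGraphFun.leviForm_reDir_ne_zero (hr : IsGraphFun k r) :
    leviForm k r p (reDir k) ≠ 0 := by
  rw [hr.leviForm_reDir]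
  intro h
  simpa using congrArg Complex.im h

/-- The coefficient `a` such that `u + a e_k` is complex tangent to the graph of `r`. -/
noncomputable def crSlope (k : Fin N) (r : (Fin N → ℂ) → ℝ) (u p : Fin N → ℂ) : ℂ :=
  -leviForm k r p u / leviForm k r p (reDir k)

theorem IsGraphFun.leviForm_add_slope (hr : IsGraphFun k r) (u p : Fin N → ℂ) :
    leviForm k r p u + crSlope k r u p * leviForm k r p (reDir k) = 0 := by
  rw [crSlope, div_mul_cancel₀ _ hr.leviForm_reDir_ne_zero]
  ring

theorem crSlope_smul (c : ℂ) (u p : Fin N → ℂ) : crSlope k r (c • u) p = c * crSlope k r u p := by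
  rw [crSlope, crSlope, leviForm_smul]
  ring

theorem IsGraphFun.contDiff_leviForm (hr : IsGraphFun k r) (u : Fin N → ℂ) :
    ContDiff ℝ ∞ (fun p => leviForm k r p u) :=
  ((hr.smooth.dirDeriv u).complex_ofReal.sub
    (contDiff_const.mul (hr.smooth.dirDeriv (Complex.I • u)).complex_ofReal)).add contDiff_const

theorem IsGraphFun.contDiff_slope (hr : IsGraphFun k r) (u : Fin N → ℂ) :
    ContDiff ℝ ∞ (crSlope k r u) := by
  have h := (hr.contDiff_leviForm u).neg.mul
    ((hr.contDiff_leviForm (reDir k)).inv fun _ => hr.leviForm_reDir_ne_zero)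
  exact h

/-- A point and the graph point over it differ by a translation in Im p_k, which `f` does not see.
Equations on the graph thus become equations at arbitrary base points. -/
theorem fderiv_graphPt_of_flat {G : Type*} [NormedAddCommGroup G] [NormedSpace ℝ G]
    {f : (Fin N → ℂ) → G} (hf : ∀ p, f (flatten k p) = f p) (s : (Fin N → ℂ) → ℝ)
    (p : Fin N → ℂ) : fderiv ℝ f (graphPt k s p) = fderiv ℝ f p := by
  rw [graphPt_eq_add]
  set c := (s p - (p k).im) • imDir k with hc
  have : (fun q => f (q + c)) = f := by
    funext q
    rw [← hf, hc, flatten_add_smul, hf]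
  rw [← fderiv_comp_add_right c, this]

theorem flatten_eq_graphPt (p : Fin N → ℂ) : flatten k p = graphPt k (fun _ => 0) p := by
  simp [graphPt]

theorem IsGraphFun.slope_flat (hr : IsGraphFun k r) (u p : Fin N → ℂ) :
    crSlope k r u (flatten k p) = crSlope k r u p := by
  simp only [crSlope, leviForm, flatten_eq_graphPt, fderiv_graphPt_of_flat hr.flat]

theorem IsGraphFun.fderiv_slope_imDir (hr : IsGraphFun k r) (u p : Fin N → ℂ) :
    fderiv ℝ (crSlope k r u) p (imDir k) = 0 := by
  refine dirDeriv_eq_zero_of_eventually_line (c := crSlope k r u p)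
    ((hr.contDiff_slope u).differentiableAt_of_smooth p) ?_
  refine Filter.Eventually.of_forall fun t => ?_
  rw [← hr.slope_flat, flatten_add_smul, hr.slope_flat]

theorem IsGraphFun.fderiv_slope_add_smul (hr : IsGraphFun k r) (u v p : Fin N → ℂ) (c : ℂ) :
    fderiv ℝ (crSlope k r u) p (v + c • reDir k) =
      fderiv ℝ (crSlope k r u) p v + c.re * fderiv ℝ (crSlope k r u) p (reDir k) := by
  have : c • reDir k = c.re • reDir k + c.im • imDir k := by
    funext i
    by_cases h : i = k
    · subst h; simp
    · simp [h]
  rw [this, map_add, map_add, map_smul, map_smul, hr.fderiv_slope_imDir]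
  simp

/-- The integrability equations of a Levi-flat graph. -/
theorem IsLeviFlat.slope_integrable (hS : IsLeviFlat S) (hr : IsGraphFun k r)
    {O : Set (Fin N → ℂ)} (hO : IsOpen O) (h : ∀ q ∈ O, (q ∈ S ↔ (q k).im = r q))
    (hp : graphPt k r p ∈ O) (u v : Fin N → ℂ) :
    fderiv ℝ (crSlope k r v) p u + (crSlope k r u p).re * fderiv ℝ (crSlope k r v) p (reDir k) =
    fderiv ℝ (crSlope k r u) p v + (crSlope k r v p).re * fderiv ℝ (crSlope k r u) p (reDir k) := by
  set q := graphPt k r p with hq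
  have hqS : q ∈ S := (h q hp).2 (by rw [hq, graphPt_apply_im, hr.apply_graphPt])
  have ev : ∀ x ∈ O, ∀ᶠ y in 𝓝 x, (y ∈ S ↔ (y k).im = r y) := fun x hx => by
    filter_upwards [hO.mem_nhds hx] with y hy using h y hy
  -- These fields are complex tangent to the graph and vary only along e_k, so their bracket is a
  -- multiple of e_k. Since e_k is never complex tangent, involutivity makes the bracket vanish.
  let X : (Fin N → ℂ) → (Fin N → ℂ) → (Fin N → ℂ) := fun u p => u + crSlope k r u p • reDir k
  have sX : ∀ u, ContDiff ℝ ∞ (X u) := fun u =>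
    contDiff_const.add ((hr.contDiff_slope u).smul contDiff_const)
  have dX : ∀ u x w, fderiv ℝ (X u) x w = fderiv ℝ (crSlope k r u) x w • reDir k := by
    intro u x w
    have h1 := ((hr.contDiff_slope u).differentiableAt_of_smooth x).hasFDerivAt.smul_const (reDir k)
    have h2 : fderiv ℝ (X u) x = _ := (h1.const_add u).fderiv
    rw [h2]
    rfl
  have tX : ∀ u, ∀ x ∈ S ∩ O, X u x ∈ complexTangent S x := by
    rintro u x ⟨hxS, hxO⟩
    rw [hr.mem_complexTangent_iff (ev x hxO) hxS, leviForm_add, leviForm_smul]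
    exact hr.leviForm_add_slope u x
  have br := hS O (X u) (X v) hO (sX u).contDiffOn (sX v).contDiffOn (tX u) (tX v) q ⟨hqS, hp⟩
  rw [hr.mem_complexTangent_iff (ev q hp) hqS, VectorField.lieBracket, dX, dX, ← sub_smul,
    leviForm_smul] at br
  have e := sub_eq_zero.1 ((mul_eq_zero.1 br).resolve_right hr.leviForm_reDir_ne_zero)
  simp only [X, hr.fderiv_slope_add_smul] at e
  have es : ∀ u, crSlope k r u q = crSlope k r u p := fun u => by
    rw [hq, ← hr.slope_flat, flatten_graphPt, hr.slope_flat]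
  rw [es, es, hq, fderiv_graphPt_of_flat (hr.slope_flat v),
    fderiv_graphPt_of_flat (hr.slope_flat u)] at e
  exact e

/-- Integrability for the pair e, i e: the slope of i e is i b, and the two real parts Re b and Re(i
b) = -Im b combine to the coefficient conj(b). -/
theorem IsLeviFlat.dbarOp_slope (hS : IsLeviFlat S) (hr : IsGraphFun k r)
    {O : Set (Fin N → ℂ)} (hO : IsOpen O) (h : ∀ q ∈ O, (q ∈ S ↔ (q k).im = r q))
    (hp : graphPt k r p ∈ O) (e : Fin N → ℂ) :
    dbarOp e (Complex.I • e) (reDir k) (crSlope k r e) (crSlope k r e) p = 0 := by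
  have := hS.slope_integrable hr hO h hp e (Complex.I • e)
  have h1 : crSlope k r (Complex.I • e) = fun p => Complex.I * crSlope k r e p :=
    funext fun p => crSlope_smul _ _ _
  have h2 : ∀ v, fderiv ℝ (crSlope k r (Complex.I • e)) p v
      = Complex.I * fderiv ℝ (crSlope k r e) p v := fun v => by
    rw [h1]
    exact congrFun (dirDeriv_const_mul (hr.contDiff_slope e) Complex.I v) p
  rw [h2, h2, crSlope_smul] at this
  simp only [Complex.I_mul_re, Complex.ofReal_neg] at this
  have h3 : starRingEnd ℂ (crSlope k r e p)
      = (crSlope k r e p).re - Complex.I * (crSlope k r e p).im := by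
    apply Complex.ext <;> simp
  simp only [dbarOp, dirDeriv, h3]
  linear_combination (-Complex.I) * this + (fderiv ℝ (crSlope k r e) p e
    + (crSlope k r e p).re * fderiv ℝ (crSlope k r e) p (reDir k)) * Complex.I_mul_I

end Tangent

/-! ### Conjugation of Levi-flat hypersurfaces -/

section Conjugation

variable {N : ℕ} {k : Fin N} {r : (Fin N → ℂ) → ℝ} {S : Set (Fin N → ℂ)}

/-- Complex conjugation of all the coordinates of `ℂ^N`. -/
noncomputable def conjMap (N : ℕ) : (Fin N → ℂ) →L[ℝ] (Fin N → ℂ) :=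
  ContinuousLinearMap.pi fun i => (Complex.conjCLE : ℂ →L[ℝ] ℂ).comp
    (ContinuousLinearMap.proj (R := ℝ) (φ := fun _ : Fin N => ℂ) i)

theorem conjMap_apply (p : Fin N → ℂ) (i : Fin N) : conjMap N p i = starRingEnd ℂ (p i) := rfl

theorem conjMap_conjMap (p : Fin N → ℂ) : conjMap N (conjMap N p) = p := by
  funext i
  simp [conjMap_apply]

theorem conjMap_smul_I (p : Fin N → ℂ) :
    conjMap N (Complex.I • p) = -(Complex.I • conjMap N p) := by
  funext i
  simp [conjMap_apply]

theorem conjMap_flatten (p : Fin N → ℂ) : conjMap N (flatten k p) = flatten k (conjMap N p) := by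
  funext i
  by_cases h : i = k
  · subst h
    apply Complex.ext <;> simp [conjMap_apply, flatten_apply]
  · simp [conjMap_apply, flatten_apply_of_ne, h]

theorem norm_conjMap (p : Fin N → ℂ) : ‖conjMap N p‖ = ‖p‖ := by
  simp [Pi.norm_def, conjMap_apply]

theorem neg_mem_realTangent {p v : Fin N → ℂ} (h : v ∈ realTangent S p) :
    -v ∈ realTangent S p := by
  obtain ⟨γ, h0, hγ, hm⟩ := h
  refine ⟨fun t => γ (-t), by simpa using h0, ?_, ?_⟩
  · have h1 : HasDerivAt γ v (-(0 : ℝ)) := by simpa using hγ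
    have h2 := h1.scomp (0 : ℝ) (hasDerivAt_neg (0 : ℝ))
    rw [neg_one_smul] at h2
    exact h2
  · have : Filter.Tendsto (fun t : ℝ => -t) (𝓝 0) (𝓝 0) := by
      simpa using (continuous_neg (G := ℝ)).tendsto 0
    exact this.eventually hm

theorem conjMap_mem_realTangent {p v : Fin N → ℂ} (h : v ∈ realTangent (conjMap N ⁻¹' S) p) :
    conjMap N v ∈ realTangent S (conjMap N p) := by
  obtain ⟨γ, h0, hγ, hm⟩ := h
  exact ⟨fun t => conjMap N (γ t), by simp [h0],
    (conjMap N).hasFDerivAt.comp_hasDerivAt (0 : ℝ) hγ, hm⟩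

theorem conjMap_mem_complexTangent {p v : Fin N → ℂ}
    (h : v ∈ complexTangent (conjMap N ⁻¹' S) p) :
    conjMap N v ∈ complexTangent S (conjMap N p) := by
  obtain ⟨⟨w, hw, rfl⟩, h2⟩ := h
  refine ⟨⟨-conjMap N w, neg_mem_realTangent (conjMap_mem_realTangent hw), ?_⟩,
    conjMap_mem_realTangent h2⟩
  simp [conjMap_smul_I]

theorem conjMap_preimage_preimage (S : Set (Fin N → ℂ)) :
    conjMap N ⁻¹' (conjMap N ⁻¹' S) = S := by
  ext p
  simp [conjMap_conjMap]

theorem fderiv_conj_field {X : (Fin N → ℂ) → (Fin N → ℂ)} {p : Fin N → ℂ}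
    (hX : DifferentiableAt ℝ X (conjMap N p)) (v : Fin N → ℂ) :
    fderiv ℝ (fun q => conjMap N (X (conjMap N q))) p v =
      conjMap N (fderiv ℝ X (conjMap N p) (conjMap N v)) := by
  have := ((conjMap N).hasFDerivAt.comp p
    (hX.hasFDerivAt.comp p (conjMap N).hasFDerivAt)).fderiv
  exact congrArg (fun A => A v) this

/-- Conjugation is real linear, so it commutes with brackets. It turns i into -i, and tangent spaces
are stable under sign, so complex tangent spaces correspond. -/
theorem IsLeviFlat.conj (hS : IsLeviFlat S) : IsLeviFlat (conjMap N ⁻¹' S) := by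
  intro U X Y hU hX hY hXt hYt p hp
  have hU' : IsOpen (conjMap N ⁻¹' U) := hU.preimage (conjMap N).continuous
  have smooth : ∀ {Z : (Fin N → ℂ) → (Fin N → ℂ)}, ContDiffOn ℝ ∞ Z U →
      ContDiffOn ℝ ∞ (fun q => conjMap N (Z (conjMap N q))) (conjMap N ⁻¹' U) := fun hZ =>
    (conjMap N).contDiff.comp_contDiffOn
      (hZ.comp (conjMap N).contDiff.contDiffOn fun _ h => h)
  have tang : ∀ {Z : (Fin N → ℂ) → (Fin N → ℂ)},
      (∀ p ∈ conjMap N ⁻¹' S ∩ U, Z p ∈ complexTangent (conjMap N ⁻¹' S) p) →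
      ∀ q ∈ S ∩ conjMap N ⁻¹' U, conjMap N (Z (conjMap N q)) ∈ complexTangent S q := by
    intro Z hZ q hq
    have := conjMap_mem_complexTangent (hZ (conjMap N q)
      ⟨by simpa [conjMap_conjMap] using hq.1, hq.2⟩)
    rwa [conjMap_conjMap] at this
  have hp' : conjMap N p ∈ S ∩ conjMap N ⁻¹' U :=
    ⟨hp.1, by simpa [conjMap_conjMap] using hp.2⟩
  have key := hS _ _ _ hU' (smooth hX) (smooth hY) (tang hXt) (tang hYt) _ hp'
  have dZ : ∀ {Z : (Fin N → ℂ) → (Fin N → ℂ)}, ContDiffOn ℝ ∞ Z U →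
      DifferentiableAt ℝ Z (conjMap N (conjMap N p)) := fun hZ => by
    rw [conjMap_conjMap]
    exact (hZ.contDiffAt (hU.mem_nhds hp.2)).differentiableAt (by simp)
  have hbr : VectorField.lieBracket ℝ (fun q => conjMap N (X (conjMap N q)))
      (fun q => conjMap N (Y (conjMap N q))) (conjMap N p) =
      conjMap N (VectorField.lieBracket ℝ X Y p) := by
    simp only [VectorField.lieBracket, fderiv_conj_field (dZ hX), fderiv_conj_field (dZ hY),
      conjMap_conjMap, map_sub]
  rw [hbr, ← conjMap_preimage_preimage S] at key
  have := conjMap_mem_complexTangent key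
  rwa [conjMap_conjMap, conjMap_conjMap] at this

/-- The function whose graph is conjugate to the graph of `r`. -/
noncomputable def reflectFun (r : (Fin N → ℂ) → ℝ) : (Fin N → ℂ) → ℝ :=
  fun p => -r (conjMap N p)

theorem IsGraphFun.reflect (hr : IsGraphFun k r) : IsGraphFun k (reflectFun r) where
  smooth := (hr.smooth.comp (conjMap N).contDiff).neg
  flat p := by simp only [reflectFun, conjMap_flatten, hr.flat]

theorem IsGraphFun.fderiv_reflectFun (hr : IsGraphFun k r) (p u : Fin N → ℂ) :
    fderiv ℝ (reflectFun r) p u = -fderiv ℝ r (conjMap N p) (conjMap N u) := by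
  have := (((hr.smooth.differentiableAt_of_smooth (conjMap N p)).hasFDerivAt.comp p
    (conjMap N).hasFDerivAt).neg).fderiv
  exact congrArg (fun A => A u) this

theorem IsGraphFun.leviForm_reflectFun (hr : IsGraphFun k r) (p u : Fin N → ℂ) :
    leviForm k (reflectFun r) p u =
      -starRingEnd ℂ (leviForm k r (conjMap N p) (conjMap N u)) := by
  simp only [leviForm, hr.fderiv_reflectFun, conjMap_smul_I, conjMap_apply]
  simp
  ring

theorem conjMap_reDir : conjMap N (reDir k) = reDir k := by
  funext i
  by_cases h : i = k
  · subst h; simp [conjMap_apply]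
  · simp [conjMap_apply, h]

theorem IsGraphFun.crSlope_reflectFun (hr : IsGraphFun k r) (u p : Fin N → ℂ) :
    crSlope k (reflectFun r) u p =
      starRingEnd ℂ (crSlope k r (conjMap N u) (conjMap N p)) := by
  rw [crSlope, crSlope, hr.leviForm_reflectFun, hr.leviForm_reflectFun, conjMap_reDir]
  rw [neg_neg, div_neg, map_div₀, map_neg, neg_div]

end Conjugation

/-! ### Infinite-order agreement with the reflection along the edge -/

section Reflection

variable {N : ℕ} {j k : Fin N} {r : (Fin N → ℂ) → ℝ} {C : Set (Fin N → ℂ)} {σ : ℝ}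

/-- `σ Im p_j`. -/
noncomputable def sideCoord (σ : ℝ) (j : Fin N) : (Fin N → ℂ) →L[ℝ] ℝ :=
  σ • Complex.imCLM.comp (ContinuousLinearMap.proj (R := ℝ) (φ := fun _ : Fin N => ℂ) j)

theorem sideCoord_apply (p : Fin N → ℂ) : sideCoord σ j p = σ * (p j).im := rfl

theorem sideCoord_conjMap (p : Fin N → ℂ) : sideCoord σ j (conjMap N p) = -sideCoord σ j p := by
  simp [sideCoord_apply, conjMap_apply]

theorem sideCoord_smul_reDir : sideCoord σ j (σ • reDir j) = 0 := by
  simp [sideCoord_apply]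

theorem sideCoord_I_smul (hσ : σ * σ = 1) :
    sideCoord σ j (Complex.I • σ • reDir j) = 1 := by
  simp [sideCoord_apply, hσ]

theorem sideCoord_reDir : sideCoord σ j (reDir k) = 0 := by
  by_cases h : j = k
  · subst h; simp [sideCoord_apply]
  · simp [sideCoord_apply, h]

theorem conjMap_smul_reDir : conjMap N (σ • reDir j) = σ • reDir j := by
  rw [map_smul, conjMap_reDir]

theorem IsGraphFun.fderiv_eq_zero_of_tangent (hr : IsGraphFun k r) (hC : IsOpen C)
    (h0 : ∀ p ∈ C, sideCoord σ j p = 0 → r p = 0) {v p : Fin N → ℂ} (hv : sideCoord σ j v = 0)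
    (hp : p ∈ C) (hy : sideCoord σ j p = 0) : fderiv ℝ r p v = 0 := by
  have h1 := dirDeriv_eq_zero_of_tangent hC hr.smooth.complex_ofReal
    (fun p hp hy => by simp [h0 p hp hy]) hv p hp hy
  rw [dirDeriv_ofReal hr.smooth] at h1
  exact Complex.ofReal_eq_zero.1 h1

/-- On the edge the slope is real and depends on the real parts of the last coordinates only. -/
theorem IsGraphFun.crSlope_eq_reflect_on_edge (hr : IsGraphFun k r) (hjk : j ≠ k)
    (hσ : σ * σ = 1) (hC : IsOpen C) (hconv : Convex ℝ C) (hconj : ∀ p ∈ C, conjMap N p ∈ C)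
    (h0 : ∀ p ∈ C, sideCoord σ j p = 0 → r p = 0)
    (hint : ∀ p ∈ C, 0 < sideCoord σ j p → ∀ u : Fin N → ℂ,
      fderiv ℝ (crSlope k r u) p (σ • reDir j) +
        (crSlope k r (σ • reDir j) p).re * fderiv ℝ (crSlope k r u) p (reDir k) =
      fderiv ℝ (crSlope k r (σ • reDir j)) p u +
        (crSlope k r u p).re * fderiv ℝ (crSlope k r (σ • reDir j)) p (reDir k)) :
    ∀ p ∈ C, sideCoord σ j p = 0 →
      crSlope k r (σ • reDir j) p = crSlope k (reflectFun r) (σ • reDir j) p := by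
  set e : Fin N → ℂ := σ • reDir j with he
  have hek : e k = 0 := by simp [he, hjk.symm]
  have hYpos : 0 < sideCoord σ j (Complex.I • e) := by
    rw [he, sideCoord_I_smul hσ]
    exact one_pos
  -- On the edge dr vanishes along e and e_k, and the slope reduces to the real number dr(i e).
  have real : ∀ p ∈ C, sideCoord σ j p = 0 →
      starRingEnd ℂ (crSlope k r e p) = crSlope k r e p := by
    intro p hp hy
    have h1 : fderiv ℝ r p e = 0 :=
      hr.fderiv_eq_zero_of_tangent hC h0 sideCoord_smul_reDir hp hy
    have h2 : fderiv ℝ r p (reDir k) = 0 :=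
      hr.fderiv_eq_zero_of_tangent hC h0 sideCoord_reDir hp hy
    rw [crSlope, hr.leviForm_reDir, leviForm, h1, h2, hek]
    simp
  -- For such `u` both u and i u are tangent to the edge, where `r` is zero.
  have slope0 : ∀ u : Fin N → ℂ, u j = 0 → u k = 0 → ∀ p ∈ C, sideCoord σ j p = 0 →
      crSlope k r u p = 0 := by
    intro u hj hk p hp hy
    have h1 : fderiv ℝ r p u = 0 :=
      hr.fderiv_eq_zero_of_tangent hC h0 (by simp [sideCoord_apply, hj]) hp hy
    have h2 : fderiv ℝ r p (Complex.I • u) = 0 :=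
      hr.fderiv_eq_zero_of_tangent hC h0 (by simp [sideCoord_apply, hj]) hp hy
    rw [crSlope, leviForm, h1, h2, hk]
    simp
  -- The integrability equation extends to the edge by continuity; every term except the derivative
  -- of b along `u` vanishes there by `slope0`.
  have db0 : ∀ u : Fin N → ℂ, u j = 0 → u k = 0 → ∀ p ∈ C, sideCoord σ j p = 0 →
      fderiv ℝ (crSlope k r e) p u = 0 := by
    intro u hj hk p hp hy
    have su := hr.contDiff_slope u
    have sb := hr.contDiff_slope e
    have cre : ∀ {f : (Fin N → ℂ) → ℂ}, ContDiff ℝ ∞ f →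
        Continuous fun p => ((f p).re : ℂ) := fun hf =>
      Complex.continuous_ofReal.comp (Complex.continuous_re.comp hf.continuous)
    have hcont : Continuous (fun p => dirDeriv e (crSlope k r u) p +
        (crSlope k r e p).re * dirDeriv (reDir k) (crSlope k r u) p -
        (dirDeriv u (crSlope k r e) p +
        (crSlope k r u p).re * dirDeriv (reDir k) (crSlope k r e) p)) :=
      ((su.dirDeriv e).continuous.add ((cre sb).mul (su.dirDeriv _).continuous)).sub
        ((sb.dirDeriv u).continuous.add ((cre su).mul (sb.dirDeriv _).continuous))
    have h1 := eq_zero_on_hyperplane_of_side hC hYpos hcont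
      (fun p hp hy => sub_eq_zero.2 (hint p hp hy u)) p hp hy
    have h2 := dirDeriv_eq_zero_of_tangent hC su (slope0 u hj hk) (v := e)
      sideCoord_smul_reDir p hp hy
    have h3 := dirDeriv_eq_zero_of_tangent hC su (slope0 u hj hk) (v := reDir k)
      sideCoord_reDir p hp hy
    rw [h2, h3, slope0 u hj hk p hp hy] at h1
    simpa [dirDeriv] using h1
  intro p hp hy
  rw [hr.crSlope_reflectFun, he, conjMap_smul_reDir, ← he, real _ (hconj p hp)
    (by rw [sideCoord_conjMap, hy, neg_zero])]
  -- Conjugation moves `p` within the edge by `w`, whose j-th coordinate is 0 and whose k-th is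
  -- imaginary, hence invisible to the slope. By `db0` the slope is constant on the segment from `p`
  -- to its conjugate.
  set w := conjMap N p - p with hw
  have hpj : (p j).im = 0 := by
    rw [sideCoord_apply] at hy
    exact (mul_eq_zero.1 hy).resolve_left (by rintro rfl; simp at hσ)
  have hwj : w j = 0 := by
    apply Complex.ext <;> simp [hw, conjMap_apply, hpj]
  have hwsplit : w = flatten k w + (w k).im • imDir k := by
    rw [flatten_apply]
    abel
  have hfk : flatten k w k = 0 := by
    refine Complex.ext ?_ (flatten_apply_self_im k w)
    simp [flatten_apply, hw, conjMap_apply]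
  have hline : ∀ t ∈ Set.Icc (0 : ℝ) 1, p + t • w ∈ C ∧ sideCoord σ j (p + t • w) = 0 := by
    intro t ht
    constructor
    · exact hconv.add_smul_sub_mem hp (hconj p hp) ht
    · rw [map_add, hy, map_smul, sideCoord_apply, hwj]
      simp
  have hder : ∀ t ∈ Set.Icc (0 : ℝ) 1,
      HasDerivAt (fun t : ℝ => crSlope k r e (p + t • w)) 0 t := by
    intro t ht
    obtain ⟨h1, h2⟩ := hline t ht
    have h3 : fderiv ℝ (crSlope k r e) (p + t • w) w = 0 := by
      rw [hwsplit, map_add, map_smul, hr.fderiv_slope_imDir, smul_zero, add_zero, ← hwsplit]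
      exact db0 _ (by rw [flatten_apply_of_ne _ _ hjk, hwj]) hfk _ h1 h2
    have h4 : HasDerivAt (fun t : ℝ => p + t • w) w t := by
      simpa using ((hasDerivAt_id t).smul_const w).const_add p
    have h5 := ((hr.contDiff_slope e).differentiableAt_of_smooth
      (p + t • w)).hasFDerivAt.comp_hasDerivAt t h4
    rwa [h3] at h5
  have hconst := constant_of_has_deriv_right_zero
    (f := fun t : ℝ => crSlope k r e (p + t • w)) (a := 0) (b := 1)
    (fun t ht => (hder t ht).continuousAt.continuousWithinAt)
    (fun t ht => (hder t (Set.Ico_subset_Icc_self ht)).hasDerivWithinAt) 1 (by simp)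
  simp only [one_smul, zero_smul, add_zero] at hconst
  rw [← hconst, hw]
  congr 1
  abel

/-- Across the edge, a Levi-flat graph agrees to infinite order with its reflection. -/
theorem IsGraphFun.vanishTo_sub_reflectFun (hr : IsGraphFun k r) (hjk : j ≠ k)
    (hσ : σ * σ = 1) (hC : IsOpen C) (hconj : ∀ p ∈ C, conjMap N p ∈ C)
    (h0 : ∀ p ∈ C, sideCoord σ j p = 0 → r p = 0)
    (hB : ∀ p ∈ C, 0 < sideCoord σ j p → dbarOp (σ • reDir j) (Complex.I • σ • reDir j) (reDir k)
      (crSlope k r (σ • reDir j)) (crSlope k r (σ • reDir j)) p = 0)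
    (hedge : ∀ p ∈ C, sideCoord σ j p = 0 →
      crSlope k r (σ • reDir j) p = crSlope k (reflectFun r) (σ • reDir j) p) (n : ℕ) :
    VanishTo C (sideCoord σ j) n (fun p => (r p : ℂ) - (reflectFun r p : ℂ)) := by
  set e : Fin N → ℂ := σ • reDir j with he
  set Y : Fin N → ℂ := Complex.I • e with hY
  set y := sideCoord σ j with hy
  set b := crSlope k r e with hb
  set b' := crSlope k (reflectFun r) e with hb'
  have hek : e k = 0 := by simp [he, hjk.symm]
  have hye : y e = 0 := sideCoord_smul_reDir
  have hyY : y Y = 1 := sideCoord_I_smul hσ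
  have hyk : y (reDir k) = 0 := sideCoord_reDir
  have ce : conjMap N e = e := conjMap_smul_reDir
  have cY : conjMap N Y = -Y := by rw [hY, conjMap_smul_I, ce]
  have hr' := hr.reflect
  have sb : ContDiff ℝ ∞ b := hr.contDiff_slope e
  have sb' : ContDiff ℝ ∞ b' := hr'.contDiff_slope e
  have hbc : b' = fun p => starRingEnd ℂ (b (conjMap N p)) := by
    funext p
    rw [hb', hr.crSlope_reflectFun, ce]
  set F := dbarOp e Y (reDir k) b b with hF
  set F' := dbarOp e Y (reDir k) b' b' with hF'
  have sF : ContDiff ℝ ∞ F := sb.dbarOp sb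
  have sF' : ContDiff ℝ ∞ F' := sb'.dbarOp sb'
  have F'eq : ∀ p, F' p = starRingEnd ℂ (F (conjMap N p)) := by
    intro p
    have sbc : ContDiff ℝ ∞ (fun p => b (conjMap N p)) := sb.comp (conjMap N).contDiff
    have h1 : ∀ v, dirDeriv v b' p = starRingEnd ℂ (dirDeriv (conjMap N v) b (conjMap N p)) := by
      intro v
      rw [hbc, dirDeriv_conj sbc, dirDeriv_comp_clm sb]
    have h2 : dirDeriv (-Y) b (conjMap N p) = -dirDeriv Y b (conjMap N p) := by
      simp [dirDeriv]
    simp only [hF', hF, dbarOp, h1, ce, cY, h2, conjMap_reDir]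
    rw [hbc]
    simp
  -- `F` is known to vanish on one side and `F'` on the other; smoothness makes both flat on the
  -- edge, which suffices.
  have vF : ∀ n, VanishTo C y n F := vanishTo_of_side hC (by rw [hyY]; exact one_pos) sF hB
  have vF' : ∀ n, VanishTo C y n F' := fun n => by
    refine VanishTo.neg_functional (vanishTo_of_side hC (Y := -Y) (by simp [hyY]) sF' ?_ n)
    intro p hp hyp
    rw [F'eq, hB _ (hconj p hp) (by rw [sideCoord_conjMap]; exact hyp), map_zero]
  set δ : (Fin N → ℂ) → ℂ := fun p => b p - b' p with hδ
  have sδ : ContDiff ℝ ∞ δ := sb.sub sb'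
  have dδ : ∀ v p, dirDeriv v δ p = dirDeriv v b p - dirDeriv v b' p := fun v p => by
    rw [hδ, dirDeriv_sub sb sb']
  have sneg : ∀ {f : (Fin N → ℂ) → ℂ} {n : ℕ} (c : ℂ), ContDiff ℝ ∞ f → VanishTo C y n f →
      VanishTo C y n (fun p => c * f p) := fun c hf h => h.mul_left contDiff_const hf
  have vδ : ∀ n, VanishTo C y n δ := by
    intro n
    induction n with
    | zero => trivial
    | succ n ih =>
      refine VanishTo.succ_of_normal hC hyY sδ
        (fun p hp hyp => sub_eq_zero.2 (hedge p hp hyp)) ?_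
      -- The difference of the equations for b and b', solved for the normal derivative. The right
      -- side contains flat terms, tangential derivatives of δ and multiples of conj(δ), all
      -- vanishing to the order already reached.
      have hid : dirDeriv Y δ = fun p => ((-Complex.I) * F p + Complex.I * F' p)
          + Complex.I * (dirDeriv e δ p + (starRingEnd ℂ (δ p) * dirDeriv (reDir k) b p
            + starRingEnd ℂ (b' p) * dirDeriv (reDir k) δ p)) := by
        funext p
        simp only [dδ, hF, hF', dbarOp]
        simp only [hδ, map_sub]
        linear_combination (dirDeriv Y b p - dirDeriv Y b' p) * Complex.I_mul_I
      rw [hid]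
      have s1 := sδ.dirDeriv e
      have s2 := sδ.conj.mul (sb.dirDeriv (reDir k))
      have s3 := sb'.conj.mul (sδ.dirDeriv (reDir k))
      refine VanishTo.add ((contDiff_const.mul sF).add (contDiff_const.mul sF'))
        (contDiff_const.mul (s1.add (s2.add s3)))
        (VanishTo.add (contDiff_const.mul sF) (contDiff_const.mul sF') (sneg _ sF (vF n))
          (sneg _ sF' (vF' n))) (sneg _ (s1.add (s2.add s3)) ?_)
      refine VanishTo.add s1 (s2.add s3) (ih.dirDeriv_tangent hC sδ hye)
        (VanishTo.add s2 s3 ?_ ?_)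
      · exact (ih.conj sδ).mul_right sδ.conj (sb.dirDeriv _)
      · exact (ih.dirDeriv_tangent hC sδ hyk).mul_left sb'.conj (sδ.dirDeriv _)
  have sR : ContDiff ℝ ∞ (fun p => (r p : ℂ)) := hr.smooth.complex_ofReal
  have sR' : ContDiff ℝ ∞ (fun p => (reflectFun r p : ℂ)) := hr'.smooth.complex_ofReal
  set d : (Fin N → ℂ) → ℂ := fun p => (r p : ℂ) - (reflectFun r p : ℂ) with hd
  have sd : ContDiff ℝ ∞ d := sR.sub sR'
  have ddiff : ∀ v p, dirDeriv v d p = fderiv ℝ r p v - fderiv ℝ (reflectFun r) p v := fun v p => by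
    rw [hd, dirDeriv_sub sR sR', dirDeriv_ofReal hr.smooth, dirDeriv_ofReal hr'.smooth]
    rfl
  have sT : ContDiff ℝ ∞ (fun p => leviForm k (reflectFun r) p (reDir k)) :=
    hr'.contDiff_leviForm _
  induction n with
  | zero => trivial
  | succ n ih =>
    refine VanishTo.succ_of_normal hC hyY sd (fun p hp hyp => ?_) ?_
    · have h1 := h0 p hp hyp
      have h2 := h0 _ (hconj p hp) (by rw [sideCoord_conjMap, hyp, neg_zero])
      simp [hd, reflectFun, h1, h2]
    -- The difference of the slope equations of `r` and its reflection, solved for the normal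
    -- derivative of `d`; now δ is a known flat term.
    · have hid : dirDeriv Y d = fun p => (-Complex.I) * (dirDeriv e d p
          + (b p * dirDeriv (reDir k) d p
            + δ p * leviForm k (reflectFun r) p (reDir k))) := by
        funext p
        have h1 := hr.leviForm_add_slope e p
        have h2 := hr'.leviForm_add_slope e p
        rw [hr.leviForm_reDir, leviForm, hek] at h1
        rw [hr'.leviForm_reDir, leviForm, hek] at h2
        simp only [ddiff, hδ, hr'.leviForm_reDir]
        linear_combination Complex.I * (h1 - h2)
          + ((fderiv ℝ r p Y : ℂ) - fderiv ℝ (reflectFun r) p Y) * Complex.I_mul_I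
      rw [hid]
      have s1 := sd.dirDeriv e
      have s2 := sb.mul (sd.dirDeriv (reDir k))
      have s3 := sδ.mul sT
      refine sneg _ (s1.add (s2.add s3)) (VanishTo.add s1 (s2.add s3)
        (ih.dirDeriv_tangent hC sd hye) (VanishTo.add s2 s3 ?_ ?_))
      · exact (ih.dirDeriv_tangent hC sd hyk).mul_left sb (sd.dirDeriv _)
      · exact (vδ n).mul_right sδ sT

end Reflection

/-! ### The Levi-flat extension by reflection -/

section Extension

variable {N : ℕ} {j k : Fin N} {r : (Fin N → ℂ) → ℝ} {σ : ℝ}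

theorem exists_realCoordinates (k : Fin N) :
    ∃ L : (Fin N → ℂ) ≃L[ℝ] (Fin (2 * N) → ℝ),
      ∀ p, ∀ i : Fin (2 * N), (i : ℕ) + 1 = 2 * N → L p i = (p k).im := by
  have hN : 0 < N := k.pos
  let B := Pi.basis (fun _ : Fin N => Complex.basisOneI)
  have hcard : Fintype.card ((_ : Fin N) × Fin 2) = Fintype.card (Fin (2 * N)) := by
    simp [mul_comm]
  let l : Fin (2 * N) := ⟨2 * N - 1, by omega⟩
  let f0 := Fintype.equivOfCardEq hcard
  -- An arbitrary numbering of the real coordinates, with Im p_k swapped into the last place.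
  let f := f0.trans (Equiv.swap (f0 ⟨k, 1⟩) l)
  have hf : f.symm l = ⟨k, 1⟩ := by
    rw [Equiv.symm_apply_eq]
    simp [f]
  refine ⟨(B.reindex f).equivFun.toContinuousLinearEquiv, fun p i hi => ?_⟩
  have hil : i = l := Fin.ext (by simp only [l]; omega)
  rw [hil]
  change (B.reindex f).equivFun p l = _
  rw [Module.Basis.equivFun_apply, Module.Basis.repr_reindex_apply, hf]
  simp [B, Pi.basis_repr]

/-- The shear subtracting `r` from Im p_k flattens the graph; its inverse adds `r` back because `r`
ignores Im p_k. -/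
theorem IsGraphFun.isSmoothHypersurface (hr : IsGraphFun k r) {O : Set (Fin N → ℂ)}
    (hO : IsOpen O) : IsSmoothHypersurface {p | p ∈ O ∧ (p k).im = r p} := by
  obtain ⟨L, hL⟩ := exists_realCoordinates k
  have inv : ∀ (p : Fin N → ℂ) (t : ℝ), r (p + t • imDir k) = r p := fun p t => by
    rw [← hr.flat, flatten_add_smul, hr.flat]
  have s1 : ContDiff ℝ ∞ (fun p => p + (-r p) • imDir k) :=
    contDiff_id.add (hr.smooth.neg.smul contDiff_const)
  have s2 : ContDiff ℝ ∞ (fun p => p + r p • imDir k) :=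
    contDiff_id.add (hr.smooth.smul contDiff_const)
  let shear : (Fin N → ℂ) ≃ₜ (Fin N → ℂ) :=
    { toFun := fun p => p + (-r p) • imDir k
      invFun := fun p => p + r p • imDir k
      left_inv := fun p => by simp only [inv]; simp
      right_inv := fun p => by simp only [inv]; simp
      continuous_toFun := s1.continuous
      continuous_invFun := s2.continuous }
  let φ := ((shear.trans L.toHomeomorph).toOpenPartialHomeomorph).restrOpen O hO
  have hsource : φ.source = O := by simp [φ]
  have hφ : ∀ p, φ p = L (p + (-r p) • imDir k) := fun p => rfl
  intro p hp
  refine ⟨φ, by rw [hsource]; exact hp.1, ⟨?_, ?_⟩, ?_⟩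
  · exact (L.contDiff.comp s1).contDiffOn
  · exact (s2.comp L.symm.contDiff).contDiffOn
  · have hlast : ∀ q, φ q ∈ modelHyperplane N ↔ (q k).im = r q := by
      intro q
      have hN : 0 < N := k.pos
      have h1 : ∀ i : Fin (2 * N), (i : ℕ) + 1 = 2 * N → φ q i = (q k).im - r q := by
        intro i hi
        rw [hφ, hL _ i hi]
        simp [sub_eq_add_neg]
      constructor
      · intro h
        have h2 := h ⟨2 * N - 1, by omega⟩ (by simp only; omega)
        rw [h1 _ (by simp only; omega)] at h2
        linarith
      · intro h i hi
        rw [h1 i hi, h, sub_self]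
    ext x
    constructor
    · rintro ⟨q, ⟨hq, hqs⟩, rfl⟩
      exact ⟨φ.map_source hqs, (hlast q).2 hq.2⟩
    · rintro ⟨hx, hxm⟩
      have h1 := φ.map_target hx
      refine ⟨φ.symm x, ⟨⟨by rwa [hsource] at h1, ?_⟩, h1⟩, φ.right_inv hx⟩
      rw [← hlast, φ.right_inv hx]
      exact hxm

/-- The points whose projection removing `Im p_k` has norm less than `ε`. -/
def cylinder (k : Fin N) (ε : ℝ) : Set (Fin N → ℂ) := flatten k ⁻¹' Metric.ball 0 ε

theorem isOpen_cylinder (ε : ℝ) : IsOpen (cylinder k ε) :=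
  Metric.isOpen_ball.preimage (flatten k).continuous

theorem mem_cylinder {ε : ℝ} {p : Fin N → ℂ} : p ∈ cylinder k ε ↔ ‖flatten k p‖ < ε := by
  simp [cylinder]

theorem convex_cylinder (ε : ℝ) : Convex ℝ (cylinder k ε) :=
  (convex_ball (0 : Fin N → ℂ) ε).linear_preimage (flatten k : (Fin N → ℂ) →ₗ[ℝ] (Fin N → ℂ))

theorem conjMap_mem_cylinder {ε : ℝ} {p : Fin N → ℂ} (hp : p ∈ cylinder k ε) :
    conjMap N p ∈ cylinder k ε := by
  rw [mem_cylinder] at hp ⊢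
  rwa [← conjMap_flatten, norm_conjMap]

theorem graphPt_flatten (hr : IsGraphFun k r) (p : Fin N → ℂ) :
    graphPt k r (flatten k p) = graphPt k r p := by
  rw [graphPt, graphPt, flatten_flatten, hr.flat]

theorem graphPt_mem_cylinder {ε : ℝ} {p : Fin N → ℂ} :
    graphPt k r p ∈ cylinder k ε ↔ p ∈ cylinder k ε := by
  rw [mem_cylinder, mem_cylinder, flatten_graphPt]

theorem sideCoord_flatten (hjk : j ≠ k) (p : Fin N → ℂ) :
    sideCoord σ j (flatten k p) = sideCoord σ j p := by
  rw [sideCoord_apply, sideCoord_apply, flatten_apply_of_ne k p hjk]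

theorem sideCoord_graphPt (hjk : j ≠ k) (p : Fin N → ℂ) :
    sideCoord σ j (graphPt k r p) = sideCoord σ j p := by
  rw [sideCoord_apply, sideCoord_apply, graphPt_apply_of_ne r p hjk]

/-- A property holding near `0` and insensitive to `Im p_k` holds on a cylinder. -/
theorem exists_cylinder_of_eventually {P : (Fin N → ℂ) → Prop} (h : ∀ᶠ p in 𝓝 0, P p) :
    ∃ ε > 0, ∀ p ∈ cylinder k ε, P (flatten k p) := by
  obtain ⟨ε, hε, h⟩ := Metric.eventually_nhds_iff_ball.1 h
  exact ⟨ε, hε, fun p hp => h _ hp⟩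

/-- The function equal to `r` on the side `σ Im p_j ≥ 0` and to its reflection on the other. -/
noncomputable def reflectExtend (σ : ℝ) (j : Fin N) (r : (Fin N → ℂ) → ℝ) : (Fin N → ℂ) → ℝ :=
  open Classical in fun p => if 0 ≤ sideCoord σ j p then r p else reflectFun r p

/-- The glued function is the reflection plus the real part of the cut-off difference, and the
difference is flat on the edge. -/
theorem contDiffOn_reflectExtend (hr : IsGraphFun k r) {C : Set (Fin N → ℂ)} (hC : IsOpen C)
    (h : ∀ n, VanishTo C (sideCoord σ j) n (fun p => (r p : ℂ) - (reflectFun r p : ℂ))) :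
    ContDiffOn ℝ ∞ (reflectExtend σ j r) C := by
  have h1 := contDiffOn_cutSide hC
    (hr.smooth.complex_ofReal.sub hr.reflect.smooth.complex_ofReal) h
  have h2 := hr.reflect.smooth.contDiffOn.add (Complex.reCLM.contDiff.comp_contDiffOn h1)
  refine h2.congr fun p _ => ?_
  by_cases hy : 0 ≤ sideCoord σ j p <;> simp [reflectExtend, cutSide, hy]

theorem continuousAt_leviForm (hr : IsGraphFun k r) {B : (Fin N → ℂ) → (Fin N → ℂ)}
    {p : Fin N → ℂ} (hB : ContinuousAt B p) :
    ContinuousAt (fun q => leviForm k r q (B q)) p := by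
  have h1 : ContinuousAt (fderiv ℝ r) p :=
    (hr.smooth.continuous_fderiv (by simp)).continuousAt
  have h2 : ContinuousAt (fun q => Complex.I • B q) p := by fun_prop
  have c : Continuous (fun x : ℝ => (x : ℂ)) := Complex.continuous_ofReal
  exact ((c.continuousAt.comp (h1.clm_apply hB)).sub
    (continuousAt_const.mul (c.continuousAt.comp (h1.clm_apply h2)))).add
    (continuousAt_const.mul ((continuous_apply k).continuousAt.comp hB))

theorem continuousAt_lieBracket {X Y : (Fin N → ℂ) → (Fin N → ℂ)} {U : Set (Fin N → ℂ)}
    (hU : IsOpen U) (hX : ContDiffOn ℝ ∞ X U) (hY : ContDiffOn ℝ ∞ Y U) {p : Fin N → ℂ}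
    (hp : p ∈ U) : ContinuousAt (VectorField.lieBracket ℝ X Y) p := by
  have hn := hU.mem_nhds hp
  have h1 : ContinuousAt (fderiv ℝ X) p :=
    (hX.continuousOn_fderiv_of_isOpen hU (by simp)).continuousAt hn
  have h2 : ContinuousAt (fderiv ℝ Y) p :=
    (hY.continuousOn_fderiv_of_isOpen hU (by simp)).continuousAt hn
  exact (h2.clm_apply (hX.continuousOn.continuousAt hn)).sub
    (h1.clm_apply (hY.continuousOn.continuousAt hn))

/-- A graph over a cylinder which is Levi-flat off the edge is Levi-flat. -/
theorem isLeviFlat_graph_of_sides (hr : IsGraphFun k r) (hjk : j ≠ k) (hσ : σ * σ = 1) {ε : ℝ}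
    {K : Set (Fin N → ℂ)} (hK : K = {p | p ∈ cylinder k ε ∧ (p k).im = r p})
    (h : ∀ p ∈ K, sideCoord σ j p ≠ 0 → ∃ S O : Set (Fin N → ℂ), IsLeviFlat S ∧ IsOpen O ∧
      p ∈ O ∧ ∀ q ∈ O, (q ∈ S ↔ q ∈ K)) : IsLeviFlat K := by
  intro U X Y hU hX hY hXt hYt
  have off : ∀ p ∈ K ∩ U, sideCoord σ j p ≠ 0 →
      VectorField.lieBracket ℝ X Y p ∈ complexTangent K p := by
    intro p hp hy
    obtain ⟨S, O, hS, hO, hpO, hSO⟩ := h p hp.1 hy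
    exact hS.lieBracket_mem_of_eqOn hO hSO hU hX hY hXt hYt hp hpO
  intro p hp
  by_cases hy : sideCoord σ j p = 0
  swap
  · exact off p hp hy
  have graph : ∀ q ∈ K, ∀ᶠ x in 𝓝 q, (x ∈ K ↔ (x k).im = r x) := by
    intro q hq
    rw [hK] at hq
    filter_upwards [(isOpen_cylinder ε).mem_nhds hq.1] with x hx
    rw [hK]
    exact ⟨fun h => h.2, fun h => ⟨hx, h⟩⟩
  rw [hr.mem_complexTangent_iff (graph p hp.1) hp.1]
  set V : Fin N → ℂ := Complex.I • σ • reDir j with hV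
  -- A path in the graph leaving the edge at `p`. The bracket is complex tangent along it for t > 0,
  -- and the tangency equation passes to the limit.
  set γ : ℝ → Fin N → ℂ := fun t => graphPt k r (p + t • V) with hγ
  have cγ : Continuous γ := hr.contDiff_graphPt.continuous.comp (by fun_prop)
  have hpK := hp.1
  rw [hK] at hpK
  have γ0 : γ 0 = p := by
    simp only [hγ, zero_smul, add_zero]
    exact graphPt_eq_self hpK.2
  have lim : Filter.Tendsto (fun t => leviForm k r (γ t) (VectorField.lieBracket ℝ X Y (γ t)))
      (𝓝[>] 0) (𝓝 (leviForm k r p (VectorField.lieBracket ℝ X Y p))) := by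
    have h1 := continuousAt_leviForm hr (continuousAt_lieBracket hU hX hY hp.2)
    have h2 : Filter.Tendsto γ (𝓝[>] 0) (𝓝 p) := by
      have := cγ.tendsto 0
      rw [γ0] at this
      exact this.mono_left nhdsWithin_le_nhds
    exact h1.tendsto.comp h2
  refine tendsto_nhds_unique (lim.congr' ?_) tendsto_const_nhds
  have hmem : ∀ᶠ t in 𝓝 (0 : ℝ), γ t ∈ cylinder k ε ∩ U :=
    cγ.continuousAt.eventually_mem
      (by rw [γ0]; exact ((isOpen_cylinder ε).inter hU).mem_nhds ⟨hpK.1, hp.2⟩)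
  filter_upwards [nhdsWithin_le_nhds hmem, self_mem_nhdsWithin] with t ht ht0
  have hKt : γ t ∈ K := by
    rw [hK]
    exact ⟨ht.1, by simp only [hγ]; rw [graphPt_apply_im, hr.apply_graphPt]⟩
  rw [← hr.mem_complexTangent_iff (graph _ hKt) hKt]
  refine off _ ⟨hKt, ht.2⟩ ?_
  simp only [hγ]
  rw [sideCoord_graphPt hjk, map_add, hy, map_smul, hV, sideCoord_I_smul hσ]
  simpa using (ne_of_gt ht0)

theorem exists_leviFlat_extension {H bH : Set (Fin N → ℂ)} (hflat : IsLeviFlat (H \ bH))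
    (hr : IsGraphFun k r) (hr0 : r 0 = 0) (hjk : j ≠ k) (hσ : σ * σ = 1)
    (hH : ∀ᶠ p in 𝓝 0, (p ∈ H ↔ (p k).im = r p ∧ 0 ≤ sideCoord σ j p))
    (hbH : ∀ᶠ p in 𝓝 0, (p ∈ bH ↔ (p k).im = r p ∧ sideCoord σ j p = 0))
    (hedge : ∀ᶠ p in 𝓝 0, sideCoord σ j p = 0 → r p = 0) :
    ∃ R, ∃ ε > 0, IsGraphFun k R ∧ R 0 = 0 ∧
      (∀ᶠ p in 𝓝 0, 0 ≤ sideCoord σ j p → R p = r p) ∧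
      IsLeviFlat {p | p ∈ cylinder k ε ∧ (p k).im = R p} := by
  obtain ⟨η, ηpos, hη⟩ := Metric.eventually_nhds_iff_ball.1 (hH.and hbH)
  set W := Metric.ball (0 : Fin N → ℂ) η with hW
  have hmem : ∀ q ∈ W, 0 < sideCoord σ j q → (q ∈ H \ bH ↔ (q k).im = r q) := by
    intro q hq hy
    rw [Set.mem_sdiff, (hη q hq).1, (hη q hq).2]
    constructor
    · exact fun h => h.1.1
    · exact fun h => ⟨⟨h, hy.le⟩, fun h' => hy.ne' h'.2⟩
  obtain ⟨ε₁, ε₁pos, hε₁⟩ := exists_cylinder_of_eventually (k := k)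
    (((hr.tendsto_graphPt hr0).eventually (Metric.ball_mem_nhds _ ηpos)).and hedge)
  set C := cylinder k ε₁ with hCdef
  have hC : IsOpen C := isOpen_cylinder ε₁
  have hgW : ∀ p ∈ C, graphPt k r p ∈ W := fun p hp => by
    rw [← graphPt_flatten hr]
    exact (hε₁ p hp).1
  set O := W ∩ {q | 0 < sideCoord σ j q} with hO
  have oO : IsOpen O :=
    Metric.isOpen_ball.inter (isOpen_lt continuous_const (sideCoord σ j).continuous)
  have hOS : ∀ q ∈ O, (q ∈ H \ bH ↔ (q k).im = r q) := fun q hq => hmem q hq.1 hq.2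
  have hgO : ∀ p ∈ C, 0 < sideCoord σ j p → graphPt k r p ∈ O := fun p hp hy =>
    ⟨hgW p hp, by rw [Set.mem_ofPred_eq, sideCoord_graphPt hjk]; exact hy⟩
  have h0 : ∀ p ∈ C, sideCoord σ j p = 0 → r p = 0 := fun p hp hy => by
    rw [← hr.flat]
    exact (hε₁ p hp).2 (by rw [sideCoord_flatten hjk, hy])
  have hconj : ∀ p ∈ C, conjMap N p ∈ C := fun p hp => conjMap_mem_cylinder hp
  have hvan := hr.vanishTo_sub_reflectFun hjk hσ hC hconj h0
    (fun p hp hy => hflat.dbarOp_slope hr oO hOS (hgO p hp hy) _)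
    (hr.crSlope_eq_reflect_on_edge hjk hσ hC (convex_cylinder ε₁) hconj h0
      (fun p hp hy u => hflat.slope_integrable hr oO hOS (hgO p hp hy) _ u))
  have h0C : (0 : Fin N → ℂ) ∈ C := by simp [hCdef, mem_cylinder, ε₁pos]
  -- The glued function is smooth on `C` only. It is replaced by a global function with the same
  -- germ, made independent of Im p_k again by composing with `flatten`.
  obtain ⟨g, sg, hg⟩ := exists_contDiff_eventuallyEq (hC.mem_nhds h0C)
    (contDiffOn_reflectExtend hr hC hvan)
  obtain ⟨ε₂, ε₂pos, hε₂⟩ := exists_cylinder_of_eventually (k := k) hg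
  set R : (Fin N → ℂ) → ℝ := fun p => g (flatten k p) with hR
  have gR : IsGraphFun k R := ⟨sg.comp (flatten k).contDiff, fun p => by
    simp only [hR, flatten_flatten]⟩
  have Rpos : ∀ p ∈ cylinder k ε₂, 0 ≤ sideCoord σ j p → R p = r p := by
    intro p hp hy
    simp only [hR]
    rw [hε₂ p hp, reflectExtend, if_pos (by rwa [sideCoord_flatten hjk]), hr.flat]
  have Rneg : ∀ p ∈ cylinder k ε₂, sideCoord σ j p < 0 → R p = reflectFun r p := by
    intro p hp hy
    simp only [hR]
    rw [hε₂ p hp, reflectExtend, if_neg (by rw [sideCoord_flatten hjk]; exact not_le.2 hy),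
      hr.reflect.flat]
  set ε := min ε₁ ε₂ with hε
  have εpos : 0 < ε := lt_min ε₁pos ε₂pos
  have sub₁ : ∀ p ∈ cylinder k ε, p ∈ C := fun p hp =>
    mem_cylinder.2 ((mem_cylinder.1 hp).trans_le (min_le_left _ _))
  have sub₂ : ∀ p ∈ cylinder k ε, p ∈ cylinder k ε₂ := fun p hp =>
    mem_cylinder.2 ((mem_cylinder.1 hp).trans_le (min_le_right _ _))
  have h0ε : (0 : Fin N → ℂ) ∈ cylinder k ε := by simp [mem_cylinder, εpos]
  refine ⟨R, ε, εpos, gR, ?_, ?_, ?_⟩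
  · rw [Rpos 0 (sub₂ 0 h0ε) (by simp), hr0]
  · filter_upwards [(isOpen_cylinder ε).mem_nhds h0ε] with p hp using Rpos p (sub₂ p hp)
  · refine isLeviFlat_graph_of_sides gR hjk hσ rfl ?_
    rintro p ⟨hp, hpR⟩ hy
    rcases lt_or_gt_of_ne hy with hy | hy
    -- On the negative side the graph is locally the conjugate of the given hypersurface.
    · refine ⟨conjMap N ⁻¹' (H \ bH), cylinder k ε ∩ conjMap N ⁻¹' O, hflat.conj,
        (isOpen_cylinder ε).inter (oO.preimage (conjMap N).continuous), ⟨hp, ?_⟩, ?_⟩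
      · have h1 : (conjMap N p k).im = r (conjMap N p) := by
          rw [Rneg p (sub₂ p hp) hy, reflectFun] at hpR
          simp [conjMap_apply, hpR]
        rw [Set.mem_preimage, ← graphPt_eq_self h1]
        refine hgO _ (hconj p (sub₁ p hp)) ?_
        rw [sideCoord_conjMap]
        linarith
      · rintro q ⟨hq, hqO⟩
        have hyq : sideCoord σ j q < 0 := by
          have := hqO.2
          rw [Set.mem_ofPred_eq, sideCoord_conjMap] at this
          linarith
        rw [Set.mem_preimage, hOS _ hqO, Set.mem_ofPred_eq, Rneg q (sub₂ q hq) hyq, reflectFun,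
          conjMap_apply, Complex.conj_im]
        constructor
        · exact fun h => ⟨hq, by linarith⟩
        · exact fun h => by linarith [h.2]
    · refine ⟨H \ bH, cylinder k ε ∩ O, hflat, (isOpen_cylinder ε).inter oO, ⟨hp, ?_⟩, ?_⟩
      · rw [Rpos p (sub₂ p hp) hy.le] at hpR
        rw [← graphPt_eq_self hpR]
        exact hgO p (sub₁ p hp) hy
      · rintro q ⟨hq, hqO⟩
        have hyq : 0 < sideCoord σ j q := hqO.2
        rw [hOS _ hqO, Set.mem_ofPred_eq, Rpos q (sub₂ q hq) hyq.le]
        exact ⟨fun h => ⟨hq, h⟩, fun h => h.2⟩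

end Extension

/-! ### Uniqueness: the convex weight and comparison of two extensions -/

section Uniqueness

/-- Expanding leaves one first-order term, (D b̄) ∂_S f, which the equation for `b` kills. What
remains is positive definite in the pure second derivatives and easy to bound for a quadratic
weight. -/
theorem dOp_dbarOp_of_orthogonal {E : Type*} [NormedAddCommGroup E] [NormedSpace ℝ E]
    {X Y S : E} {b f : E → ℂ} (hb : ContDiff ℝ ∞ b) (hf : ContDiff ℝ ∞ f) {p : E}
    (h : dbarOp X Y S b b p = 0) (hXY : dirDeriv X (dirDeriv Y f) p = 0)
    (hXS : dirDeriv X (dirDeriv S f) p = 0) (hYS : dirDeriv Y (dirDeriv S f) p = 0) :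
    dOp X Y S b (dbarOp X Y S b f) p = dirDeriv X (dirDeriv X f) p + dirDeriv Y (dirDeriv Y f) p
      + b p * starRingEnd ℂ (b p) * dirDeriv S (dirDeriv S f) p := by
  have h' : dOp X Y S b (fun p => starRingEnd ℂ (b p)) p = 0 := by
    rw [dOp_conj hb]
    simp [h]
  have l : dOp X Y S b (dbarOp X Y S b f) p = dirDeriv X (dbarOp X Y S b f) p
    - Complex.I * dirDeriv Y (dbarOp X Y S b f) p + b p * dirDeriv S (dbarOp X Y S b f) p := rfl
  simp only [l, dirDeriv_dbarOp hb hf]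
  rw [dirDeriv_comm hf Y X, dirDeriv_comm hf S X, dirDeriv_comm hf S Y, hXY, hXS,
    hYS]
  simp only [dOp] at h'
  linear_combination dirDeriv S f p * h' - dirDeriv Y (dirDeriv Y f) p * Complex.I_mul_I

variable {N : ℕ} {j k : Fin N} {σ : ℝ}

/-- The real scalar product of `ℂ^N`. -/
noncomputable def realDot (p v : Fin N → ℂ) : ℝ := ∑ i, ((p i).re * (v i).re + (p i).im * (v i).im)

theorem realDot_reDir (i : Fin N) (v : Fin N → ℂ) : realDot (reDir i) v = (v i).re := by
  rw [realDot, Finset.sum_eq_single i]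
  · simp
  · intro l _ hl
    simp [hl]
  · simp

theorem realDot_imDir (i : Fin N) (v : Fin N → ℂ) : realDot (imDir i) v = (v i).im := by
  rw [realDot, Finset.sum_eq_single i]
  · simp
  · intro l _ hl
    simp [hl]
  · simp

theorem realDot_smul (c : ℝ) (u v : Fin N → ℂ) : realDot (c • u) v = c * realDot u v := by
  simp only [realDot, Finset.mul_sum]
  refine Finset.sum_congr rfl fun i _ => ?_
  simp
  ring

theorem norm_sq_le_realDot (p : Fin N → ℂ) : ‖p‖ ^ 2 ≤ realDot p p := by
  have hs : ∀ i, ‖p i‖ ^ 2 = (p i).re * (p i).re + (p i).im * (p i).im := fun i => by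
    rw [← Complex.normSq_eq_norm_sq, Complex.normSq_apply]
  have h0 : 0 ≤ realDot p p := Finset.sum_nonneg fun i _ => by rw [← hs]; positivity
  have h1 : ‖p‖ ≤ Real.sqrt (realDot p p) := by
    refine (pi_norm_le_iff_of_nonneg (Real.sqrt_nonneg _)).2 fun i => ?_
    refine Real.le_sqrt_of_sq_le ?_
    rw [hs]
    exact Finset.single_le_sum (f := fun i => (p i).re * (p i).re + (p i).im * (p i).im)
      (fun i _ => by rw [← hs]; positivity) (Finset.mem_univ i)
  calc ‖p‖ ^ 2 ≤ Real.sqrt (realDot p p) ^ 2 := pow_le_pow_left₀ (norm_nonneg _) h1 2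
    _ = realDot p p := Real.sq_sqrt h0

/-- A quadratic weight, strongly convex in the direction of `y`. -/
noncomputable def quadWeight (y : (Fin N → ℂ) →L[ℝ] ℝ) (A : ℝ) (p : Fin N → ℂ) : ℝ :=
  y p + A * (y p) ^ 2 - realDot p p

theorem hasFDerivAt_coord_re (i : Fin N) (p : Fin N → ℂ) :
    HasFDerivAt (fun p : Fin N → ℂ => (p i).re) (Complex.reCLM.comp
      (ContinuousLinearMap.proj (R := ℝ) (φ := fun _ : Fin N => ℂ) i)) p :=
  (Complex.reCLM.comp
    (ContinuousLinearMap.proj (R := ℝ) (φ := fun _ : Fin N => ℂ) i)).hasFDerivAt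

theorem hasFDerivAt_coord_im (i : Fin N) (p : Fin N → ℂ) :
    HasFDerivAt (fun p : Fin N → ℂ => (p i).im) (Complex.imCLM.comp
      (ContinuousLinearMap.proj (R := ℝ) (φ := fun _ : Fin N => ℂ) i)) p :=
  (Complex.imCLM.comp
    (ContinuousLinearMap.proj (R := ℝ) (φ := fun _ : Fin N => ℂ) i)).hasFDerivAt

theorem contDiff_quadWeight (y : (Fin N → ℂ) →L[ℝ] ℝ) (A : ℝ) :
    ContDiff ℝ ∞ (quadWeight y A) := by
  have hre : ∀ i, ContDiff ℝ ∞ (fun p : Fin N → ℂ => (p i).re) := fun i =>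
    Complex.reCLM.contDiff.comp (contDiff_apply ℝ ℂ i)
  have him : ∀ i, ContDiff ℝ ∞ (fun p : Fin N → ℂ => (p i).im) := fun i =>
    Complex.imCLM.contDiff.comp (contDiff_apply ℝ ℂ i)
  exact (y.contDiff.add (contDiff_const.mul (y.contDiff.pow 2))).sub
    (ContDiff.sum fun i _ => ((hre i).mul (hre i)).add ((him i).mul (him i)))

theorem dirDeriv_quadWeight (y : (Fin N → ℂ) →L[ℝ] ℝ) (A : ℝ) (v : Fin N → ℂ) :
    dirDeriv v (quadWeight y A) = fun p => y v + 2 * A * y v * y p - 2 * realDot v p := by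
  funext p
  have h1 : HasFDerivAt (fun p : Fin N → ℂ => realDot p p) _ p :=
    HasFDerivAt.fun_sum (u := Finset.univ) fun i _ =>
      ((hasFDerivAt_coord_re i p).mul (hasFDerivAt_coord_re i p)).add
        ((hasFDerivAt_coord_im i p).mul (hasFDerivAt_coord_im i p))
  have h2 : HasFDerivAt (quadWeight y A) _ p :=
    (y.hasFDerivAt.add ((y.hasFDerivAt.pow 2).const_mul A)).sub h1
  rw [dirDeriv, h2.fderiv]
  simp [realDot, Finset.mul_sum]
  congr 1
  · ring
  · refine Finset.sum_congr rfl fun i _ => ?_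
    ring

theorem dirDeriv_dirDeriv_quadWeight (y : (Fin N → ℂ) →L[ℝ] ℝ) (A : ℝ) (u v p : Fin N → ℂ) :
    dirDeriv u (dirDeriv v (quadWeight y A)) p = 2 * A * y v * y u - 2 * realDot v u := by
  rw [dirDeriv_quadWeight]
  have h1 : HasFDerivAt (fun p : Fin N → ℂ => realDot v p) _ p :=
    HasFDerivAt.fun_sum (u := Finset.univ) fun i _ =>
      ((hasFDerivAt_coord_re i p).const_mul (v i).re).add
        ((hasFDerivAt_coord_im i p).const_mul (v i).im)
  have h2 : HasFDerivAt (fun p => y v + 2 * A * y v * y p - 2 * realDot v p) _ p :=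
    ((y.hasFDerivAt.const_mul (2 * A * y v)).const_add (y v)).sub (h1.const_mul 2)
  rw [dirDeriv, h2.fderiv]
  simp [realDot]

theorem abs_sideCoord_le (hσ : σ * σ = 1) (p : Fin N → ℂ) : |sideCoord σ j p| ≤ ‖p‖ := by
  have h1 : |σ| = 1 := by
    have : |σ| * |σ| = 1 := by rw [← abs_mul, hσ, abs_one]
    nlinarith [abs_nonneg σ]
  rw [sideCoord_apply, abs_mul, h1, one_mul]
  exact (Complex.abs_im_le_norm _).trans (norm_le_pi_norm p j)

/-- Unique continuation across `σ Im p_j = 0`. -/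
theorem eventually_eq_zero_of_side (hjk : j ≠ k) (hσ : σ * σ = 1) {b f : (Fin N → ℂ) → ℂ}
    (hb : ContDiff ℝ ∞ b) (hf : ContDiff ℝ ∞ f) {C : ℝ}
    (hB : ∀ᶠ p in 𝓝 0, dbarOp (σ • reDir j) (Complex.I • σ • reDir j) (reDir k) b b p = 0)
    (hle : ∀ᶠ p in 𝓝 0,
      ‖dbarOp (σ • reDir j) (Complex.I • σ • reDir j) (reDir k) b f p‖ ≤ C * ‖f p‖)
    (hside : ∀ᶠ p in 𝓝 0, 0 ≤ sideCoord σ j p → f p = 0) : ∀ᶠ p in 𝓝 0, f p = 0 := by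
  set e : Fin N → ℂ := σ • reDir j with he
  set Y : Fin N → ℂ := Complex.I • e with hY
  set y := sideCoord σ j with hy
  have hYim : Y = σ • imDir j := by
    funext i
    by_cases h : i = j
    · subst h
      simp [hY, he, mul_comm]
    · simp [hY, he, h]
  set M := ‖b 0‖ ^ 2 + 1 with hM
  -- For the weight y + A y² - |p|² the operator D D̄ gives 2A - 4 - 2|b|². As |b|² < M near 0, this
  -- exceeds 2.
  set A := M + 3 with hA
  have Mpos : 0 < M := by positivity
  have Apos : 0 < A := by positivity
  have hbM : ∀ᶠ p in 𝓝 0, ‖b p‖ ^ 2 < M :=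
    (hb.continuous.norm.pow 2).continuousAt.eventually (gt_mem_nhds (by simp [hM]))
  have hsmall : ∀ᶠ p in 𝓝 (0 : Fin N → ℂ), ‖p‖ < 1 / A := by
    filter_upwards [Metric.ball_mem_nhds (0 : Fin N → ℂ) (ε := 1 / A) (by positivity)] with p hp
    simpa using hp
  obtain ⟨ε, εpos, hε⟩ := Metric.eventually_nhds_iff_ball.1
    (hB.and (hle.and (hside.and (hbM.and hsmall))))
  have sφ : ContDiff ℝ ∞ (quadWeight y A) := contDiff_quadWeight y A
  refine eventually_eq_zero_of_dbarOp_le hb hf sφ εpos (fun p hp => (hε p hp).1)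
    (fun p hp => (hε p hp).2.1) (by simp [quadWeight, realDot]) ?_ ?_
  · intro p hp
    obtain ⟨h1, -, -, h2, -⟩ := hε p hp
    have second : ∀ u v, dirDeriv u (dirDeriv v (fun p => (quadWeight y A p : ℂ))) p =
        ((2 * A * y v * y u - 2 * realDot v u : ℝ) : ℂ) := by
      intro u v
      rw [dirDeriv_ofReal sφ, dirDeriv_ofReal (sφ.dirDeriv v)]
      exact congrArg _ (dirDeriv_dirDeriv_quadWeight y A u v p)
    have ye : y e = 0 := sideCoord_smul_reDir
    have yY : y Y = 1 := sideCoord_I_smul hσ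
    have yk : y (reDir k) = 0 := sideCoord_reDir
    have dee : realDot e e = 1 := by
      rw [he, realDot_smul, realDot_reDir]
      simp [hσ]
    have dYY : realDot Y Y = 1 := by
      rw [hYim, realDot_smul, realDot_imDir]
      simp [hσ]
    have dkk : realDot (reDir k) (reDir k) = 1 := by
      rw [realDot_reDir]
      simp
    have dYe : realDot Y e = 0 := by
      rw [hYim, realDot_smul, realDot_imDir]
      simp [he]
    have dke : realDot (reDir k) e = 0 := by
      rw [realDot_reDir]
      simp [he, hjk.symm]
    have dkY : realDot (reDir k) Y = 0 := by
      rw [realDot_reDir, hYim]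
      simp [hjk.symm]
    rw [dOp_dbarOp_of_orthogonal hb sφ.complex_ofReal h1 (by rw [second, ye, dYe]; simp)
      (by rw [second, ye, dke]; simp) (by rw [second, yk, dkY]; simp), second, second, second,
      ye, yY, yk, dee, dYY, dkk, Complex.mul_conj, Complex.normSq_eq_norm_sq]
    rw [← Complex.ofReal_mul, ← Complex.ofReal_add, ← Complex.ofReal_add, Complex.ofReal_re]
    nlinarith
  · intro p hp hfp
    obtain ⟨-, -, h1, -, h2⟩ := hε p hp
    have hneg : y p < 0 := not_le.1 fun h => hfp (h1 h)
    have h3 := (abs_le.1 ((abs_sideCoord_le (j := j) hσ p).trans h2.le)).1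
    -- Since -1/A ≤ y < 0, y + A y² = y(1 + A y) ≤ 0, and the weight is at most -|p|².
    have h4 : 0 ≤ 1 + A * y p := by
      have := mul_le_mul_of_nonneg_left h3 Apos.le
      rw [mul_neg, mul_one_div_cancel Apos.ne'] at this
      linarith
    have h5 := norm_sq_le_realDot p
    rw [quadWeight]
    nlinarith

/-- Two Levi-flat graphs which agree on one side of `Im p_j = 0` agree near `0`. -/
theorem eventually_eq_of_side {R R' : (Fin N → ℂ) → ℝ} (hR : IsGraphFun k R)
    (hR' : IsGraphFun k R') (hjk : j ≠ k) (hσ : σ * σ = 1)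
    (hB : ∀ᶠ p in 𝓝 0, dbarOp (σ • reDir j) (Complex.I • σ • reDir j) (reDir k)
      (crSlope k R (σ • reDir j)) (crSlope k R (σ • reDir j)) p = 0)
    (hB' : ∀ᶠ p in 𝓝 0, dbarOp (σ • reDir j) (Complex.I • σ • reDir j) (reDir k)
      (crSlope k R' (σ • reDir j)) (crSlope k R' (σ • reDir j)) p = 0)
    (hside : ∀ᶠ p in 𝓝 0, 0 ≤ sideCoord σ j p → R p = R' p) : ∀ᶠ p in 𝓝 0, R p = R' p := by
  set e : Fin N → ℂ := σ • reDir j with he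
  set Y : Fin N → ℂ := Complex.I • e with hY
  set b := crSlope k R e with hb
  set b' := crSlope k R' e with hb'
  have hek : e k = 0 := by simp [he, hjk.symm]
  have sb : ContDiff ℝ ∞ b := hR.contDiff_slope e
  have sb' : ContDiff ℝ ∞ b' := hR'.contDiff_slope e
  have sδ : ContDiff ℝ ∞ (fun p => b p - b' p) := sb.sub sb'
  have slopes : ∀ᶠ p in 𝓝 0, b p - b' p = 0 := by
    have hbd : ∀ᶠ p in 𝓝 0, ‖dirDeriv (reDir k) b' p‖ < ‖dirDeriv (reDir k) b' 0‖ + 1 :=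
      (sb'.dirDeriv _).continuous.norm.continuousAt.eventually (gt_mem_nhds (by simp))
    refine eventually_eq_zero_of_side hjk hσ sb sδ (C := ‖dirDeriv (reDir k) b' 0‖ + 1) hB ?_ ?_
    · filter_upwards [hB, hB', hbd] with p h1 h2 h3
      -- Subtracting the two Burgers equations gives D̄_b δ = -conj(δ) ∂_S b', whence the bound by
      -- C|δ|.
      have hid : dbarOp e Y (reDir k) b (fun p => b p - b' p) p =
          -(starRingEnd ℂ (b p - b' p) * dirDeriv (reDir k) b' p) := by
        simp only [dbarOp, dirDeriv_sub sb sb', map_sub] at h1 h2 ⊢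
        linear_combination h1 - h2
      rw [hid, norm_neg, norm_mul, RCLike.norm_conj, mul_comm]
      exact mul_le_mul_of_nonneg_right h3.le (norm_nonneg _)
    · obtain ⟨η, ηpos, hη⟩ := Metric.eventually_nhds_iff_ball.1 hside
      have hpos : ∀ p ∈ Metric.ball (0 : Fin N → ℂ) η, 0 < sideCoord σ j p → b p - b' p = 0 := by
        intro p hp hy
        have : R =ᶠ[𝓝 p] R' := by
          filter_upwards [Metric.isOpen_ball.mem_nhds hp,
            (sideCoord σ j).continuous.continuousAt.eventually (lt_mem_nhds hy)] with q h1 h2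
          exact hη q h1 h2.le
        simp only [hb, hb', crSlope, leviForm, this.fderiv_eq, sub_self]
      have hzero := eq_zero_on_hyperplane_of_side (Y := Y) Metric.isOpen_ball
        (by rw [hY, he, sideCoord_I_smul hσ]; exact one_pos) sδ.continuous hpos
      filter_upwards [Metric.ball_mem_nhds _ ηpos] with p hp hy
      rcases hy.lt_or_eq with hy | hy
      · exact hpos p hp hy
      · exact hzero p hp hy.symm
  have sR := hR.smooth.complex_ofReal
  have sR' := hR'.smooth.complex_ofReal
  have final : ∀ᶠ p in 𝓝 0, (R p : ℂ) - (R' p : ℂ) = 0 := by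
    refine eventually_eq_zero_of_side hjk hσ sb (sR.sub sR') (C := 0) hB ?_ ?_
    · filter_upwards [slopes] with p hp
      have h1 := hR.leviForm_add_slope e p
      have h2 := hR'.leviForm_add_slope e p
      rw [hR.leviForm_reDir, leviForm, hek, ← hb] at h1
      rw [hR'.leviForm_reDir, leviForm, hek, ← hb', ← sub_eq_zero.1 hp] at h2
      -- With a common slope, the conjugated slope equations differ exactly by D̄_b(R - R') = 0.
      have h3 := congrArg (starRingEnd ℂ) (h1.trans h2.symm)
      simp only [map_add, map_sub, map_mul, Complex.conj_ofReal, Complex.conj_I, map_zero] at h3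
      have hid : dbarOp e Y (reDir k) b (fun p => (R p : ℂ) - (R' p : ℂ)) p = 0 := by
        simp only [dbarOp, dirDeriv_sub sR sR', dirDeriv_ofReal hR.smooth,
          dirDeriv_ofReal hR'.smooth]
        simp only [dirDeriv]
        linear_combination h3
      rw [hid]
      simp
    · filter_upwards [hside] with p hp hy
      simp [hp hy]
  filter_upwards [final] with p hp
  exact_mod_cast sub_eq_zero.1 hp

end Uniqueness

/-! ### Graph form of a hypersurface near its boundary -/

section Boundary

variable {N : ℕ}

theorem chart_mem_iff {φ : OpenPartialHomeomorph (Fin N → ℂ) (Fin (2 * N) → ℝ)}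
    {S : Set (Fin N → ℂ)} {M : Set (Fin (2 * N) → ℝ)} (h : φ '' (S ∩ φ.source) = φ.target ∩ M)
    {p : Fin N → ℂ} (hp : p ∈ φ.source) : p ∈ S ↔ φ p ∈ M := by
  constructor
  · intro hpS
    have : φ p ∈ φ '' (S ∩ φ.source) := ⟨p, ⟨hpS, hp⟩, rfl⟩
    rw [h] at this
    exact this.2
  · intro hpM
    have : φ p ∈ φ '' (S ∩ φ.source) := by
      rw [h]
      exact ⟨φ.map_source hp, hpM⟩
    obtain ⟨q, ⟨hqS, hq⟩, hqp⟩ := this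
    rwa [← φ.injOn hq hp hqp]

theorem mem_modelHyperplane_iff {l : Fin (2 * N)} (hl : (l : ℕ) + 1 = 2 * N)
    (x : Fin (2 * N) → ℝ) : x ∈ modelHyperplane N ↔ x l = 0 := by
  constructor
  · exact fun h => h l hl
  · intro h i hi
    rwa [show i = l from Fin.ext (by omega)]

theorem mem_modelHalf_iff {l m : Fin (2 * N)} (hl : (l : ℕ) + 1 = 2 * N)
    (hm : (m : ℕ) + 2 = 2 * N) (x : Fin (2 * N) → ℝ) :
    x ∈ modelHalf N ↔ x l = 0 ∧ 0 ≤ x m := by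
  constructor
  · exact fun h => ⟨h.2 l hl, h.1 m hm⟩
  · rintro ⟨h1, h2⟩
    refine ⟨fun i hi => ?_, fun i hi => ?_⟩
    · rwa [show i = m from Fin.ext (by omega)]
    · rwa [show i = l from Fin.ext (by omega)]

theorem mem_modelEdge_iff {l m : Fin (2 * N)} (hl : (l : ℕ) + 1 = 2 * N)
    (hm : (m : ℕ) + 2 = 2 * N) (x : Fin (2 * N) → ℝ) :
    x ∈ modelEdge N ↔ x l = 0 ∧ x m = 0 := by
  constructor
  · exact fun h => ⟨h.2 l hl, h.1 m hm⟩
  · rintro ⟨h1, h2⟩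
    refine ⟨fun i hi => ?_, fun i hi => ?_⟩
    · rwa [show i = m from Fin.ext (by omega)]
    · rwa [show i = l from Fin.ext (by omega)]

theorem IsSmoothChart.contDiffOn_coord
    {φ : OpenPartialHomeomorph (Fin N → ℂ) (Fin (2 * N) → ℝ)} (hφ : IsSmoothChart φ)
    (i : Fin (2 * N)) : ContDiffOn ℝ ∞ (fun p => φ p i) φ.source :=
  (contDiff_apply ℝ ℝ i).comp_contDiffOn hφ.1

theorem HasFDerivAt.chart_coord {φ : (Fin N → ℂ) → (Fin (2 * N) → ℝ)} {p : Fin N → ℂ}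
    {A : (Fin N → ℂ) →L[ℝ] (Fin (2 * N) → ℝ)} (h : HasFDerivAt φ A p) (i : Fin (2 * N)) :
    HasFDerivAt (fun p => φ p i) ((ContinuousLinearMap.proj (R := ℝ) i).comp A) p :=
  (ContinuousLinearMap.proj (R := ℝ) (φ := fun _ : Fin (2 * N) => ℝ) i).hasFDerivAt.comp p h

theorem IsSmoothHypersurface.exists_definingFunction {K : Set (Fin N → ℂ)}
    (hK : IsSmoothHypersurface K) (hN : 0 < N) {p : Fin N → ℂ} (hp : p ∈ K) :
    ∃ (ρ : (Fin N → ℂ) → ℝ) (O : Set (Fin N → ℂ)), IsOpen O ∧ p ∈ O ∧ ContDiffOn ℝ ∞ ρ O ∧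
      fderiv ℝ ρ p ≠ 0 ∧ ∀ q ∈ O, (q ∈ K ↔ ρ q = 0) := by
  obtain ⟨φ, hps, hφ, him⟩ := hK p hp
  let l : Fin (2 * N) := ⟨2 * N - 1, by omega⟩
  have hl : (l : ℕ) + 1 = 2 * N := by simp only [l]; omega
  obtain ⟨A, hA, -⟩ := hφ.exists_hasFDerivAt hps
  refine ⟨fun p => φ p l, φ.source, φ.open_source, hps, hφ.contDiffOn_coord l, ?_, ?_⟩
  · rw [(hA.chart_coord l).fderiv]
    intro h
    have := congrArg (fun B => B (A.symm (Pi.single l 1))) h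
    simp at this
  · intro q hq
    rw [chart_mem_iff him hq, mem_modelHyperplane_iff hl]

/-- A function strictly increasing in the direction `V` whose zeros lie in the hyperplane `y = 0`
has, near `0`, the sign of `y`. -/
theorem eventually_sign_eq {E : Type*} [NormedAddCommGroup E] [NormedSpace ℝ E] {g : E → ℝ}
    {O : Set E} (hO : O ∈ 𝓝 (0 : E)) (hg : ContDiffOn ℝ ∞ g O) (hO' : IsOpen O)
    (g0 : g 0 = 0) {y : E →L[ℝ] ℝ} {V : E} (hV : y V = 1) (hgV : 0 < fderiv ℝ g 0 V)
    (hzero : ∀ᶠ p in 𝓝 0, g p = 0 → y p = 0) :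
    ∀ᶠ p in 𝓝 0, (0 ≤ g p ↔ 0 ≤ y p) ∧ (g p = 0 ↔ y p = 0) := by
  have cdg : ContinuousAt (fun p => fderiv ℝ g p V) 0 :=
    ((hg.continuousOn_fderiv_of_isOpen hO' (by simp)).continuousAt hO).clm_apply
      continuousAt_const
  obtain ⟨δ, δpos, hδ⟩ := Metric.eventually_nhds_iff_ball.1
    (((cdg.eventually (lt_mem_nhds hgV)).and hzero).and hO)
  set B := Metric.ball (0 : E) δ with hB
  have hconv : Convex ℝ B := convex_ball 0 δ
  have hline : ∀ p (s : ℝ), HasDerivAt (fun s : ℝ => p + s • V) V s := fun p s => by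
    simpa using ((hasDerivAt_id s).smul_const V).const_add p
  have hder : ∀ p (s : ℝ), p + s • V ∈ B →
      HasDerivAt (fun s : ℝ => g (p + s • V)) (fderiv ℝ g (p + s • V) V) s := by
    intro p s hs
    have h1 : DifferentiableAt ℝ g (p + s • V) :=
      (hg.contDiffAt (hO'.mem_nhds (hδ _ hs).2)).differentiableAt (by simp)
    exact h1.hasFDerivAt.comp_hasDerivAt s (hline p s)
  have hseg : ∀ p (a c : ℝ), p + a • V ∈ B → p + c • V ∈ B → ∀ s ∈ Set.Icc a c,
      p + s • V ∈ B := by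
    intro p a c ha hc s hs
    have hpre : Convex ℝ ((fun s : ℝ => p + s • V) ⁻¹' B) := by
      have h2 : Convex ℝ ((fun x => p + x) ⁻¹' B) := hconv.translate_preimage_right p
      exact h2.linear_preimage (LinearMap.toSpanSingleton ℝ E V)
    exact hpre.ordConnected.out ha hc hs
  -- Along segments in direction `V` inside the ball, `g` has positive derivative.
  have mono : ∀ p ∈ B, ∀ t : ℝ, 0 < t → p + t • V ∈ B → g p < g (p + t • V) := by
    intro p hp t ht htB
    have hin : ∀ s ∈ Set.Icc 0 t, p + s • V ∈ B := hseg p 0 t (by simpa using hp) htB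
    have hm : StrictMonoOn (fun s : ℝ => g (p + s • V)) (Set.Icc 0 t) := by
      refine strictMonoOn_of_deriv_pos (convex_Icc 0 t)
        (fun s hs => (hder p s (hin s hs)).continuousAt.continuousWithinAt) fun s hs => ?_
      have hs' := hin s (interior_subset hs)
      rw [(hder p s hs').deriv]
      exact (hδ _ hs').1.1
    have := hm (Set.left_mem_Icc.2 ht.le) (Set.right_mem_Icc.2 ht.le) ht
    simpa using this
  have hsc : ContinuousAt (fun s : ℝ => s • V) 0 := by fun_prop
  have hsB : ∀ᶠ s : ℝ in 𝓝 0, s • V ∈ B :=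
    hsc.eventually_mem (by simpa using Metric.ball_mem_nhds (0 : E) δpos)
  obtain ⟨s₀, s₀pos, hs₀⟩ := Metric.eventually_nhds_iff_ball.1 hsB
  set s := s₀ / 2 with hs
  have spos : 0 < s := by positivity
  have h1B : s • V ∈ B := hs₀ _ (by simp [abs_of_pos spos]; linarith)
  have h2B : (-s) • V ∈ B := hs₀ _ (by simp [abs_of_pos spos]; linarith)
  have h0B : (0 : E) ∈ B := Metric.mem_ball_self δpos
  have gpos : 0 < g (s • V) := by
    have := mono 0 h0B s spos (by simpa using h1B)
    rwa [zero_add, g0] at this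
  have gneg : g ((-s) • V) < 0 := by
    have := mono ((-s) • V) h2B s spos (by simpa using h0B)
    rwa [← add_smul, neg_add_cancel, zero_smul, g0] at this
  have cg : ∀ q ∈ B, ContinuousAt g q := fun q hq =>
    hg.continuousOn.continuousAt (hO'.mem_nhds (hδ q hq).2)
  have near : ∀ c : ℝ, Filter.Tendsto (fun p => p + c • V) (𝓝 0) (𝓝 (c • V)) := by
    intro c
    have : Continuous (fun p : E => p + c • V) := by fun_prop
    simpa using this.tendsto 0
  -- On the line through `p` in direction `V`, `g` changes sign and so has a zero. Zeros lie on y =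
  -- 0, which the line meets only at `p`.
  have edge : ∀ᶠ p in 𝓝 0, y p = 0 → g p = 0 := by
    filter_upwards [(near s).eventually ((cg _ h1B).eventually (lt_mem_nhds gpos)),
      (near (-s)).eventually ((cg _ h2B).eventually (gt_mem_nhds gneg)),
      (near s).eventually (Metric.isOpen_ball.mem_nhds h1B),
      (near (-s)).eventually (Metric.isOpen_ball.mem_nhds h2B)] with p k1 k2 k3 k4 hy
    have hin := hseg p (-s) s k4 k3
    have ivt := intermediate_value_Icc (show -s ≤ s by linarith)
      (f := fun s : ℝ => g (p + s • V))
      (fun t ht => (hder p t (hin t ht)).continuousAt.continuousWithinAt)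
    obtain ⟨t, ht, hgt⟩ := ivt ⟨k2.le, k1.le⟩
    have hyt := (hδ _ (hin t ht)).1.2 hgt
    rw [map_add, map_smul, hy, hV, zero_add, smul_eq_mul, mul_one] at hyt
    simpa [hyt] using hgt
  have tproj : Filter.Tendsto (fun p : E => p - y p • V) (𝓝 0) (𝓝 0) := by
    have : Continuous (fun p : E => p - y p • V) := by fun_prop
    simpa using this.tendsto 0
  -- Project `p` along `V` to y = 0, where `g` vanishes; monotonicity from there gives the sign of
  -- `g` at `p`.
  filter_upwards [tproj.eventually edge, tproj.eventually (Metric.ball_mem_nhds 0 δpos),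
    Metric.ball_mem_nhds (0 : E) δpos] with p k1 k2 k3
  have hq : g (p - y p • V) = 0 := k1 (by simp [hV])
  have hpq : p - y p • V + y p • V = p := sub_add_cancel _ _
  rcases lt_trichotomy (y p) 0 with hy | hy | hy
  · have := mono p k3 (-y p) (by linarith) (by rw [neg_smul, ← sub_eq_add_neg]; exact k2)
    rw [neg_smul, ← sub_eq_add_neg, hq] at this
    exact ⟨⟨fun h => absurd h (not_le.2 this), fun h => absurd h (not_le.2 hy)⟩,
      ⟨fun h => absurd h this.ne, fun h => absurd h hy.ne⟩⟩
  · rw [hy, zero_smul, sub_zero] at hq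
    simp [hq, hy]
  · have := mono (p - y p • V) k2 (y p) hy (by rw [hpq]; exact k3)
    rw [hpq, hq] at this
    exact ⟨⟨fun _ => hy.le, fun _ => this.le⟩,
      ⟨fun h => absurd h this.ne', fun h => absurd h hy.ne'⟩⟩

/-- Near the edge, a hypersurface with boundary in `ℂ^{N-2} × ℝ²` is one side of a graph. -/
theorem exists_boundary_graph (hN : 2 ≤ N) {H bH : Set (Fin N → ℂ)}
    (hH : IsSmoothHypersurfaceWithBoundary H bH) (h0 : (0 : Fin N → ℂ) ∈ bH)
    (hb : bH ⊆ flatModel N) :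
    ∃ (j k : Fin N) (σ : ℝ) (r : (Fin N → ℂ) → ℝ), j ≠ k ∧ σ * σ = 1 ∧ IsGraphFun k r ∧ r 0 = 0 ∧
      (∀ᶠ p in 𝓝 0, (p ∈ H ↔ (p k).im = r p ∧ 0 ≤ sideCoord σ j p)) ∧
      (∀ᶠ p in 𝓝 0, (p ∈ bH ↔ (p k).im = r p ∧ sideCoord σ j p = 0)) ∧
      (∀ᶠ p in 𝓝 0, sideCoord σ j p = 0 → r p = 0) := by
  obtain ⟨φ, h0s, hφ, htar, hHφ, hbφ⟩ := hH.boundary_chart 0 h0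
  let l : Fin (2 * N) := ⟨2 * N - 1, by omega⟩
  let m : Fin (2 * N) := ⟨2 * N - 2, by omega⟩
  have hl : (l : ℕ) + 1 = 2 * N := by simp only [l]; omega
  have hm : (m : ℕ) + 2 = 2 * N := by simp only [m]; omega
  have memH : ∀ p ∈ φ.source, (p ∈ H ↔ φ p l = 0 ∧ 0 ≤ φ p m) := fun p hp => by
    rw [chart_mem_iff (M := modelHalf N) (by rw [hHφ, htar, Set.univ_inter]) hp,
      mem_modelHalf_iff hl hm]
  have memb : ∀ p ∈ φ.source, (p ∈ bH ↔ φ p l = 0 ∧ φ p m = 0) := fun p hp => by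
    rw [chart_mem_iff (M := modelEdge N) (by rw [hbφ, htar, Set.univ_inter]) hp,
      mem_modelEdge_iff hl hm]
  obtain ⟨A, hA, hAs⟩ := hφ.exists_hasFDerivAt h0s
  obtain ⟨ρ0, h00⟩ := (memb 0 h0s).1 h0
  -- Vectors tangent to the edge are velocities of curves in the edge, read off the chart, so their
  -- last two coordinates are real.
  have tang : ∀ v, A v l = 0 → A v m = 0 → ∀ i : Fin N, N ≤ (i : ℕ) + 2 → (v i).im = 0 := by
    intro v hvl hvm i hi
    have hlin : HasDerivAt (fun t : ℝ => φ 0 + t • A v) (A v) 0 := by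
      simpa using ((hasDerivAt_id (0 : ℝ)).smul_const (A v)).const_add (φ 0)
    have hAs' : HasFDerivAt φ.symm (A.symm : (Fin (2 * N) → ℝ) →L[ℝ] (Fin N → ℂ))
        (φ 0 + (0 : ℝ) • A v) := by simpa using hAs
    have hγ : HasDerivAt (fun t : ℝ => φ.symm (φ 0 + t • A v)) v 0 := by
      have := hAs'.comp_hasDerivAt (0 : ℝ) hlin
      simp only [ContinuousLinearEquiv.coe_coe, ContinuousLinearEquiv.symm_apply_apply] at this
      exact this
    have him : HasDerivAt (fun t : ℝ => (φ.symm (φ 0 + t • A v) i).im) (v i).im 0 :=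
      Complex.imCLM.hasFDerivAt.comp_hasDerivAt (0 : ℝ) ((hasDerivAt_pi.1 hγ) i)
    have hz : (fun t : ℝ => (φ.symm (φ 0 + t • A v) i).im) = fun _ => 0 := by
      funext t
      have ht : φ 0 + t • A v ∈ φ.target := by rw [htar]; trivial
      refine hb ((memb _ (φ.map_target ht)).2 ?_) i hi
      rw [φ.right_inv ht]
      simp [ρ0, h00, hvl, hvm]
    rw [hz] at him
    exact him.unique (hasDerivAt_const _ _)
  -- If the differential of the defining function killed both imaginary directions, some nonzero
  -- real combination of them would be tangent to the edge, against `tang`.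
  obtain ⟨j, k, hjk, hj, hk, hAk⟩ : ∃ j k : Fin N, j ≠ k ∧ N ≤ (j : ℕ) + 2 ∧ N ≤ (k : ℕ) + 2 ∧
      A (imDir k) l ≠ 0 := by
    let a : Fin N := ⟨N - 2, by omega⟩
    let b : Fin N := ⟨N - 1, by omega⟩
    have ha : N ≤ (a : ℕ) + 2 := by simp only [a]; omega
    have hbN : N ≤ (b : ℕ) + 2 := by simp only [b]; omega
    have hab : a ≠ b := by
      intro h
      have := congrArg Fin.val h
      simp only [a, b] at this
      omega
    by_contra hcon
    push Not at hcon
    have h1 := hcon a b hab ha hbN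
    have h2 := hcon b a hab.symm hbN ha
    have hw := tang (A (imDir b) m • imDir a - A (imDir a) m • imDir b)
      (by simp only [map_sub, map_smul, Pi.sub_apply, Pi.smul_apply, h1, h2]; simp)
      (by
        simp only [map_sub, map_smul, Pi.sub_apply, Pi.smul_apply, smul_eq_mul]
        ring)
    have h3 := hw b hbN
    simp [hab.symm] at h3
    have h4 := tang (imDir a) h2 h3 a ha
    simp at h4
  have hfd : fderiv ℝ (fun p => φ p l) 0 (imDir k) ≠ 0 := by
    rw [(hA.chart_coord l).fderiv]
    exact hAk
  obtain ⟨r, hr, hr0, hgr⟩ := exists_graph_of_fderiv_ne_zero φ.open_source h0s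
    (hφ.contDiffOn_coord l) ρ0 hfd
  have tgr := hr.tendsto_graphPt hr0
  have evs : ∀ᶠ p in 𝓝 (0 : Fin N → ℂ), p ∈ φ.source := φ.open_source.mem_nhds h0s
  have hρz : ∀ᶠ p in 𝓝 (0 : Fin N → ℂ), φ (graphPt k r p) l = 0 := by
    filter_upwards [tgr.eventually hgr] with p hp
    exact hp.2 (by rw [graphPt_apply_im, hr.apply_graphPt])
  set g : (Fin N → ℂ) → ℝ := fun p => φ (graphPt k r p) m with hg
  set O := graphPt k r ⁻¹' φ.source with hO
  have oO : IsOpen O := φ.open_source.preimage hr.contDiff_graphPt.continuous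
  have sg : ContDiffOn ℝ ∞ g O :=
    (hφ.contDiffOn_coord m).comp hr.contDiff_graphPt.contDiffOn fun _ h => h
  have h0O : (0 : Fin N → ℂ) ∈ O := by
    rw [hO, Set.mem_preimage, IsGraphFun.graphPt_zero hr0]
    exact h0s
  -- The lift of `imDir j` to the tangent space of the graph. Its j-th coordinate is not real, so it
  -- is not tangent to the edge and the boundary coordinate `m` has nonzero derivative along it; σ
  -- records the sign.
  set w := flatten k (imDir j) + fderiv ℝ r 0 (imDir j) • imDir k with hw
  have dcomp : ∀ i, fderiv ℝ (fun p => φ (graphPt k r p) i) 0 (imDir j) = A w i := by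
    intro i
    have h1 := (hr.hasFDerivAt_graphPt 0)
    have h2 : HasFDerivAt (fun p => φ p i) ((ContinuousLinearMap.proj (R := ℝ) i).comp
        (A : (Fin N → ℂ) →L[ℝ] (Fin (2 * N) → ℝ))) (graphPt k r 0) := by
      rw [IsGraphFun.graphPt_zero hr0]
      exact hA.chart_coord i
    have h3 := (h2.comp 0 h1).fderiv
    exact congrArg (fun B => B (imDir j)) h3
  have hwl : A w l = 0 := by
    have hz : (fun p => φ (graphPt k r p) l) =ᶠ[𝓝 0] fun _ => 0 := hρz
    rw [← dcomp, hz.fderiv_eq]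
    simp
  have hwm : A w m ≠ 0 := by
    intro h
    have := tang w hwl h j hj
    simp [hw, flatten_apply, hjk, hjk.symm] at this
  have hGd : fderiv ℝ g 0 (imDir j) = A w m := dcomp m
  obtain ⟨σ, hσ, hσG⟩ : ∃ σ : ℝ, σ * σ = 1 ∧ 0 < σ * A w m := by
    rcases lt_or_gt_of_ne hwm with h | h
    · exact ⟨-1, by norm_num, by linarith⟩
    · exact ⟨1, by norm_num, by linarith⟩
  -- Zeros of `g` correspond to boundary points on the graph, whose j-th and k-th coordinates are
  -- real.
  have hzero : ∀ᶠ p in 𝓝 0, g p = 0 → sideCoord σ j p = 0 ∧ r p = 0 := by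
    filter_upwards [tgr.eventually evs, hρz] with p h1 h2 h3
    have hmem : graphPt k r p ∈ flatModel N := hb ((memb _ h1).2 ⟨h2, h3⟩)
    have hj' := hmem j hj
    have hk' := hmem k hk
    rw [graphPt_apply_of_ne r p hjk] at hj'
    rw [graphPt_apply_im] at hk'
    exact ⟨by rw [sideCoord_apply, hj', mul_zero], hk'⟩
  have sign := eventually_sign_eq (oO.mem_nhds h0O) sg oO
    (by simp only [hg, IsGraphFun.graphPt_zero hr0]; exact h00) (y := sideCoord σ j)
    (V := σ • imDir j) (by simp [sideCoord_apply, hσ])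
    (by rw [map_smul, hGd]; exact hσG) (hzero.mono fun p hp h => (hp h).1)
  refine ⟨j, k, σ, r, hjk, hσ, hr, hr0, ?_, ?_, ?_⟩
  · filter_upwards [evs, hgr, sign] with p h1 h2 h3
    rw [memH p h1, h2]
    refine and_congr_right fun him => ?_
    rw [← h3.1, hg]
    simp only [graphPt_eq_self him]
  · filter_upwards [evs, hgr, sign] with p h1 h2 h3
    rw [memb p h1, h2]
    refine and_congr_right fun him => ?_
    rw [← h3.2, hg]
    simp only [graphPt_eq_self him]
  · filter_upwards [sign, hzero] with p h1 h2 h3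
    exact (h2 (h1.2.2 h3)).2

/-- A hypersurface containing one side of a graph is itself a graph. -/
theorem IsSmoothHypersurface.exists_graph_of_side {j k : Fin N} {σ : ℝ} {R : (Fin N → ℂ) → ℝ}
    {K : Set (Fin N → ℂ)} (hK : IsSmoothHypersurface K) (hR : IsGraphFun k R) (hR0 : R 0 = 0)
    (hσ : σ * σ = 1) (hmem : ∀ᶠ p in 𝓝 0, 0 ≤ sideCoord σ j p → graphPt k R p ∈ K) :
    ∃ r, IsGraphFun k r ∧ r 0 = 0 ∧ ∀ᶠ p in 𝓝 0, (p ∈ K ↔ (p k).im = r p) := by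
  have h0K : (0 : Fin N → ℂ) ∈ K := by
    have := hmem.self_of_nhds (by simp)
    rwa [IsGraphFun.graphPt_zero hR0] at this
  obtain ⟨ρ, O, hO, h0O, hρ, hρd, hKρ⟩ := hK.exists_definingFunction k.pos h0K
  have evO : ∀ᶠ p in 𝓝 (0 : Fin N → ℂ), p ∈ O := hO.mem_nhds h0O
  have hzero : ∀ᶠ p in 𝓝 0, 0 ≤ sideCoord σ j p → ρ (graphPt k R p) = 0 := by
    filter_upwards [hmem, (hR.tendsto_graphPt hR0).eventually evO] with p h1 h2 h3
    exact (hKρ _ h2).1 (h1 h3)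
  -- Otherwise lifting rays to the half graph, where ρ = 0, shows that dρ vanishes on the open
  -- half-space y > 0. Such vectors span, so dρ = 0, a contradiction.
  have hne : fderiv ℝ ρ 0 (imDir k) ≠ 0 := by
    intro hk
    apply hρd
    have hflat : ∀ u, fderiv ℝ ρ 0 (flatten k u) = fderiv ℝ ρ 0 u := fun u => by
      rw [flatten_apply, map_sub, map_smul, hk, smul_zero, sub_zero]
    have pos : ∀ u, 0 < sideCoord σ j u → fderiv ℝ ρ 0 u = 0 := by
      intro u hu
      have h1 : HasFDerivAt ρ (fderiv ℝ ρ 0) (graphPt k R 0) := by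
        rw [IsGraphFun.graphPt_zero hR0]
        exact ((hρ.contDiffAt (hO.mem_nhds h0O)).differentiableAt (by simp)).hasFDerivAt
      have h2 := h1.comp 0 (hR.hasFDerivAt_graphPt 0)
      have hline : HasDerivAt (fun t : ℝ => t • u) u 0 := by
        simpa using (hasDerivAt_id (0 : ℝ)).smul_const u
      have h2' : HasFDerivAt (ρ ∘ graphPt k R) ((fderiv ℝ ρ 0).comp
          (flatten k + (fderiv ℝ R 0).smulRight (imDir k))) ((0 : ℝ) • u) := by
        rwa [zero_smul]
      have h3 := h2'.comp_hasDerivAt (0 : ℝ) hline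
      have h4 : ((fderiv ℝ ρ 0).comp (flatten k + (fderiv ℝ R 0).smulRight (imDir k))) u
          = fderiv ℝ ρ 0 u := by
        change fderiv ℝ ρ 0 (flatten k u + fderiv ℝ R 0 u • imDir k) = _
        rw [map_add, map_smul, hk, smul_zero, add_zero, hflat]
      rw [h4] at h3
      have htend : Filter.Tendsto (fun t : ℝ => t • u) (𝓝 0) (𝓝 0) := by
        simpa using hline.continuousAt.tendsto
      have h5 : HasDerivWithinAt (fun _ : ℝ => (0 : ℝ)) (fderiv ℝ ρ 0 u) (Set.Ici 0) 0 := by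
        refine h3.hasDerivWithinAt.congr_of_eventuallyEq_of_mem ?_ Set.self_mem_Ici
        filter_upwards [nhdsWithin_le_nhds (htend.eventually hzero), self_mem_nhdsWithin]
          with t ht ht0
        refine (ht ?_).symm
        rw [map_smul, smul_eq_mul]
        exact mul_nonneg ht0 hu.le
      exact (uniqueDiffOn_Ici (0 : ℝ) 0 Set.self_mem_Ici).eq_deriv _ h5
        (hasDerivWithinAt_const _ _ _)
    ext u
    set V : Fin N → ℂ := Complex.I • σ • reDir j with hV
    have hyV : sideCoord σ j V = 1 := sideCoord_I_smul hσ
    have h1 := pos V (by rw [hyV]; exact one_pos)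
    have h2 := pos (u + (|sideCoord σ j u| + 1) • V) (by
      rw [map_add, map_smul, hyV, smul_eq_mul, mul_one]
      linarith [neg_abs_le (sideCoord σ j u)])
    rw [map_add, map_smul, h1, smul_zero, add_zero] at h2
    simpa using h2
  obtain ⟨r, hr, hr0, hgr⟩ := exists_graph_of_fderiv_ne_zero hO h0O hρ ((hKρ 0 h0O).1 h0K) hne
  refine ⟨r, hr, hr0, ?_⟩
  filter_upwards [hgr, evO] with p h1 h2
  rw [hKρ p h2, h1]

end Boundary

/-! ### The extension theorem -/

theorem theorem1p2 (N : ℕ) (hN : 2 ≤ N) (H bH : Set (Fin N → ℂ))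
    (hH : IsSmoothHypersurfaceWithBoundary H bH) (hflat : IsLeviFlat (H \ bH))
    (h0 : (0 : Fin N → ℂ) ∈ bH) (hb : bH ⊆ flatModel N) :
    ∃ U ∈ 𝓝 (0 : Fin N → ℂ), ∃ K : Set (Fin N → ℂ),
      IsSmoothHypersurface K ∧ IsLeviFlat K ∧ H ∩ U ⊆ K ∧
      ∀ K' : Set (Fin N → ℂ), IsSmoothHypersurface K' → IsLeviFlat K' →
        (∃ V ∈ 𝓝 (0 : Fin N → ℂ), H ∩ V ⊆ K') →
        ∃ W ∈ 𝓝 (0 : Fin N → ℂ), K' ∩ W = K ∩ W := by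
  obtain ⟨j, k, σ, r, hjk, hσ, hr, hr0, hHg, hbg, hedge⟩ := exists_boundary_graph hN hH h0 hb
  obtain ⟨R, ε, εpos, hR, hR0, hRr, hLF⟩ :=
    exists_leviFlat_extension hflat hr hr0 hjk hσ hHg hbg hedge
  set K : Set (Fin N → ℂ) := {p | p ∈ cylinder k ε ∧ (p k).im = R p} with hK
  have hcyl : ∀ᶠ p in 𝓝 (0 : Fin N → ℂ), p ∈ cylinder k ε :=
    (isOpen_cylinder ε).mem_nhds (by simp [mem_cylinder, εpos])
  have hsub : ∀ᶠ p in 𝓝 (0 : Fin N → ℂ), p ∈ H → p ∈ K := by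
    filter_upwards [hHg, hRr, hcyl] with p h1 h2 h3 hp
    obtain ⟨h4, h5⟩ := h1.1 hp
    exact ⟨h3, by rw [h2 h5, h4]⟩
  refine ⟨{p | p ∈ H → p ∈ K}, hsub, K, hR.isSmoothHypersurface (isOpen_cylinder ε), hLF,
    fun p hp => hp.2 hp.1, ?_⟩
  rintro K' hK' hLF' ⟨V, hV, hVK⟩
  have tR := hR.tendsto_graphPt hR0
  -- On the closed side R = r, so the lifted points belong to `H`, and hence to `K'`.
  have hmem : ∀ᶠ p in 𝓝 0, 0 ≤ sideCoord σ j p → graphPt k R p ∈ K' := by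
    filter_upwards [tR.eventually hHg, tR.eventually hRr, tR.eventually hV] with p h1 h2 h3 hy
    have hy' : 0 ≤ sideCoord σ j (graphPt k R p) := by rwa [sideCoord_graphPt hjk]
    refine hVK ⟨h1.2 ⟨?_, hy'⟩, h3⟩
    rw [← h2 hy', graphPt_apply_im, hR.apply_graphPt]
  obtain ⟨r', hr', hr0', hK'g⟩ := hK'.exists_graph_of_side hR hR0 hσ hmem
  have hside : ∀ᶠ p in 𝓝 0, 0 ≤ sideCoord σ j p → R p = r' p := by
    filter_upwards [hmem, tR.eventually hK'g] with p h1 h2 hy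
    have := h2.1 (h1 hy)
    rwa [graphPt_apply_im, hr'.apply_graphPt] at this
  have hB : ∀ᶠ p in 𝓝 0, dbarOp (σ • reDir j) (Complex.I • σ • reDir j) (reDir k)
      (crSlope k R (σ • reDir j)) (crSlope k R (σ • reDir j)) p = 0 := by
    filter_upwards [hcyl] with p hp
    exact hLF.dbarOp_slope hR (isOpen_cylinder ε)
      (fun q hq => ⟨fun h => h.2, fun h => ⟨hq, h⟩⟩) (graphPt_mem_cylinder.2 hp) _
  have hB' : ∀ᶠ p in 𝓝 0, dbarOp (σ • reDir j) (Complex.I • σ • reDir j) (reDir k)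
      (crSlope k r' (σ • reDir j)) (crSlope k r' (σ • reDir j)) p = 0 := by
    obtain ⟨η, ηpos, hη⟩ := Metric.eventually_nhds_iff_ball.1 hK'g
    filter_upwards [(hr'.tendsto_graphPt hr0').eventually (Metric.ball_mem_nhds _ ηpos)] with p hp
    exact hLF'.dbarOp_slope hr' Metric.isOpen_ball hη hp _
  have heq := eventually_eq_of_side hR hr' hjk hσ hB hB' hside
  have hiff : ∀ᶠ p in 𝓝 (0 : Fin N → ℂ), (p ∈ K' ↔ p ∈ K) := by
    filter_upwards [heq, hK'g, hcyl] with p h1 h2 h3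
    rw [h2, ← h1]
    exact ⟨fun h => ⟨h3, h⟩, fun h => h.2⟩
  refine ⟨{p | p ∈ K' ↔ p ∈ K}, hiff, ?_⟩
  ext p
  exact ⟨fun h => ⟨h.2.1 h.1, h.2⟩, fun h => ⟨h.2.2 h.1, h.2⟩⟩
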